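/- **Setting.** Composition is written in diagrammatic order. A Cartesian restriction category is a restriction category ($\overline f f=f$, $\overline f\,\overline g=\overline g\,\overline f$, $\overline{\overline f g}=\overline f\,\overline g$, $f\overline g=\overline{fg}\,f$) with a chosen restriction terminal object $1$ and chosen binary restriction products (total projections $\pi_0,\pi_1$, and a unique $\langle f,g\rangle$ with $\langle f,g\rangle\pi_0=\overline g f$ and $\langle f,g\rangle\pi_1=\overline f g$). A strict functor between Cartesian restriction categories is a functor that preserves restrictions and the chosen products on the nose. A total commutative monoid $(A,+,0)$ is a commutative monoid with $+:A\times A\to A$ and $0:1\to A$ total; for maps $f,g:T\to A$ put $f+g=\langle f,g\rangle +$, and write $0:T\to A$ for ${!}\,0$. For a Cartesian restriction category $\mathbb X$, let $\mathrm{Fa\grave a}(\mathbb X)$ have: * objects: pairs $((A,+,0),X)$ with $(A,+,0)$ a total commutative monoid in $\mathbb X$ and $X$ an object of $\mathbb X$; * maps $((A,+,0),X)\to((B,+,0),Y)$: sequences $(f_*,f_1,f_2,\dots)$ with $f_*:X\to Y$ and $f_n:A^n\times X\to B$, such that $\overline{f_n}=\overline{\pi_n f_*}$ and each $f_n$ is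 symmetric and additive in its first $n$ variables (preservation of zero reads $\langle\dots,0,\dots\rangle f_n=\overline{\langle\dots,0,\dots\rangle f_n}\,0$); * identities $(1,\pi_0,0,0,\dots)$ and composition $(fg)_*=f_*g_*$, $$(fg)_n=\sum_{\{\beta_1,\dots,\beta_k\}}\langle p_{\beta_1}f_{|\beta_1|},\dots,p_{\beta_k}f_{|\beta_k|},\pi_nf_*\rangle g_k ,$$ the sum being over all partitions of the $n$ vector variables into nonempty blocks, where $p_\beta$ projects to the variables in $\beta$ and the last variable; * restriction $\overline f=(\overline{f_*},\overline{\pi_1f_*}\,\pi_0,\overline{\pi_2f_*}\,0,\overline{\pi_3f_*}\,0,\dots)$; * terminal object $(1,1)$, products $((A,+,0),X)\times((B,+,0),Y)=((A\times B,+,0),X\times Y)$ with the componentwise monoid structure on $A\times B$, projections $(\pi_i,\pi_0\pi_i,0,0,\dots)$ and pairing $\langle f,g\rangle_*=\langle f_*,g_*\rangle$, $\langle f,g\rangle_n=\langle f_n,g_n\rangle$. For a strict functor $F:\mathbb X\to\mathbb Y$ let $\mathrm{Fa\grave a}(F)((A,+,0),X)=((FA,F{+},F0),FX)$ and $\mathrm{Fa\grave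 a}(F)(f_*,f_1,f_2,\dots)=(F f_*,F f_1,F f_2,\dots)$. **Proposition.** With these definitions, $\mathrm{Fa\grave a}(\mathbb X)$ is a Cartesian restriction category for every Cartesian restriction category $\mathbb X$, and $\mathrm{Fa\grave a}$ is an endofunctor on the category of Cartesian restriction categories and strict functors. It has the structure of a comonad, with counit $\epsilon:\mathrm{Fa\grave a}(\mathbb X)\to\mathbb X$ given by $$\epsilon((A,+,0),X)=X,\qquad \epsilon(f_*,f_1,f_2,\dots)=f_*,$$ and comultiplication $\delta:\mathrm{Fa\grave a}(\mathbb X)\to\mathrm{Fa\grave a}^2(\mathbb X)$ given on objects by $$\delta((A,+,0),X)=\Big(\big(((A,+,0),A),(+,\pi_0{+},0,\dots),(0,\pi_00,0,\dots)\big),((A,+,0),X)\Big)$$ and on maps by $\delta(f)_*=f$, $(\delta(f)_r)_*=f_r$ and, for $r,s\ge1$, at vectors $(a_{j,1},\dots,a_{j,r},b_j)$, $1\le j\le s$, and at the point $(c_1,\dots,c_r,x)$, $$(\delta(f)_r)_s=\sum_{\theta}f_{r+s-t}(e_1,\dots,e_r,b_{j_1},\dots,b_{j_{s-t}},x),$$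 where $\theta$ runs over the partial injections from $\{1,\dots,s\}$ to $\{1,\dots,r\}$, $t$ is the number of indices at which $\theta$ is defined, $j_1<\dots<j_{s-t}$ are the indices at which it is not, and $e_i=a_{j,i}$ if $\theta(j)=i$, $e_i=c_i$ if $i$ is not a value of $\theta$. In particular, all components of $\epsilon$ and $\delta$ are strict functors, so they preserve restrictions and the chosen products. -/

import Mathlib

open CategoryTheory

universe v u v' u'

namespace FaaRes

/-! ### Cartesian restriction categories

Composition is written in diagrammatic order, `f ≫ g` being "first `f`, then `g`". -/

/-- The operations of a category with a restriction operator `rst` and chosen finite products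
(terminal object `one`, binary products `prod`, projections, pairing), without any axioms. -/
class CRStruct (C : Type u) extends CategoryStruct.{v} C where
  /-- the restriction `f ↦ \bar f` -/
  rst : ∀ {X Y : C}, (X ⟶ Y) → (X ⟶ X)
  one : C
  bang : ∀ X : C, X ⟶ one
  prod : C → C → C
  fst : ∀ X Y : C, prod X Y ⟶ X
  snd : ∀ X Y : C, prod X Y ⟶ Y
  lift : ∀ {T X Y : C}, (T ⟶ X) → (T ⟶ Y) → (T ⟶ prod X Y)

open CRStruct

/-- The axioms of a Cartesian restriction category: a category, the four restriction axioms,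
a chosen restriction terminal object and chosen binary restriction products. -/
class IsCartesianRestriction (C : Type u) [CRStruct.{v} C] : Prop where
  id_comp : ∀ {X Y : C} (f : X ⟶ Y), 𝟙 X ≫ f = f
  comp_id : ∀ {X Y : C} (f : X ⟶ Y), f ≫ 𝟙 Y = f
  assoc : ∀ {W X Y Z : C} (f : W ⟶ X) (g : X ⟶ Y) (h : Y ⟶ Z), (f ≫ g) ≫ h = f ≫ g ≫ h
  rst_comp_self : ∀ {X Y : C} (f : X ⟶ Y), rst f ≫ f = f
  rst_comm : ∀ {X Y Z : C} (f : X ⟶ Y) (g : X ⟶ Z), rst f ≫ rst g = rst g ≫ rst f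
  rst_rst_comp : ∀ {X Y Z : C} (f : X ⟶ Y) (g : X ⟶ Z), rst (rst f ≫ g) = rst f ≫ rst g
  comp_rst : ∀ {X Y Z : C} (f : X ⟶ Y) (g : Y ⟶ Z), f ≫ rst g = rst (f ≫ g) ≫ f
  rst_bang : ∀ X : C, rst (bang X) = 𝟙 X
  bang_one : bang (one : C) = 𝟙 one
  comp_bang : ∀ {X Y : C} (f : X ⟶ Y), f ≫ bang Y = rst f ≫ bang X
  rst_fst : ∀ X Y : C, rst (fst X Y) = 𝟙 (prod X Y)
  rst_snd : ∀ X Y : C, rst (snd X Y) = 𝟙 (prod X Y)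
  lift_fst : ∀ {T X Y : C} (f : T ⟶ X) (g : T ⟶ Y), lift f g ≫ fst X Y = rst g ≫ f
  lift_snd : ∀ {T X Y : C} (f : T ⟶ X) (g : T ⟶ Y), lift f g ≫ snd X Y = rst f ≫ g
  lift_unique : ∀ {T X Y : C} (f : T ⟶ X) (g : T ⟶ Y) (h : T ⟶ prod X Y),
    h ≫ fst X Y = rst g ≫ f → h ≫ snd X Y = rst f ≫ g → h = lift f g

/-- A Cartesian restriction category (with chosen restriction products). -/
class CartRest (C : Type u) extends CRStruct.{v} C, IsCartesianRestriction C

instance CartRest.category (C : Type u) [CartRest.{v} C] : Category.{v} C where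
  id_comp := IsCartesianRestriction.id_comp
  comp_id := IsCartesianRestriction.comp_id
  assoc := IsCartesianRestriction.assoc

open IsCartesianRestriction

/-! ### Strict functors, and the category of Cartesian restriction categories -/

/-- Functors preserving restrictions and the chosen products on the nose.  (Preservation of
`bang` and of `lift` is a consequence, by uniqueness.) -/
structure StrictFunctor (C : Type u) [CartRest.{v} C] (D : Type u') [CartRest.{v'} D]
    extends C ⥤ D where
  map_rst : ∀ {X Y : C} (f : X ⟶ Y), map (rst f) = rst (map f)
  obj_one : obj one = one
  obj_prod : ∀ X Y : C, obj (prod X Y) = prod (obj X) (obj Y)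
  map_fst : ∀ X Y : C, map (fst X Y) = eqToHom (obj_prod X Y) ≫ fst (obj X) (obj Y)
  map_snd : ∀ X Y : C, map (snd X Y) = eqToHom (obj_prod X Y) ≫ snd (obj X) (obj Y)

set_option linter.checkUnivs false in
/-- A bundled Cartesian restriction category. -/
structure CartRestCat : Type (max (u + 1) (v + 1)) where
  carrier : Type u
  [str : CartRest.{v} carrier]

attribute [instance] CartRestCat.str

instance : CoeSort CartRestCat.{v, u} (Type u) := ⟨CartRestCat.carrier⟩

theorem StrictFunctor.eq_of_toFunctor {C : Type u} [CartRest.{v} C] {D : Type u'}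
    [CartRest.{v'} D] {F G : StrictFunctor C D} (h : F.toFunctor = G.toFunctor) : F = G := by
  cases F; cases G; cases h; rfl

def StrictFunctor.id (C : Type u) [CartRest.{v} C] : StrictFunctor C C where
  toFunctor := 𝟭 C
  map_rst _ := rfl
  obj_one := rfl
  obj_prod _ _ := rfl
  map_fst _ _ := by simp
  map_snd _ _ := by simp

def StrictFunctor.comp {C D E : Type u} [CartRest.{v} C] [CartRest.{v} D] [CartRest.{v} E]
    (F : StrictFunctor C D) (G : StrictFunctor D E) : StrictFunctor C E where
  toFunctor := F.toFunctor ⋙ G.toFunctor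
  map_rst f := by simp [F.map_rst, G.map_rst]
  obj_one := by simp [F.obj_one, G.obj_one]
  obj_prod X Y := by simp [F.obj_prod, G.obj_prod]
  map_fst X Y := by simp [F.map_fst, G.map_fst, eqToHom_map]
  map_snd X Y := by simp [F.map_snd, G.map_snd, eqToHom_map]

/-- The category of Cartesian restriction categories and strict functors. -/
instance : Category CartRestCat.{v, u} where
  Hom X Y := StrictFunctor X Y
  id X := StrictFunctor.id X
  comp F G := StrictFunctor.comp F G
  id_comp _ := StrictFunctor.eq_of_toFunctor rfl
  comp_id _ := StrictFunctor.eq_of_toFunctor rfl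
  assoc _ _ _ := StrictFunctor.eq_of_toFunctor rfl

/-! ### Total commutative monoids -/

section Monoids

variable {C : Type u} [CartRest.{v} C]

theorem rst_total_comp {X Y Z : C} (f : X ⟶ Y) (g : Y ⟶ Z) (hg : rst g = 𝟙 Y) :
    rst (f ≫ g) = rst f := by
  have key : ∀ {W : C} (k : X ⟶ W), rst (rst k) = rst k := fun k => by
    have := rst_rst_comp k (𝟙 X)
    have h1 : rst (𝟙 X) = 𝟙 X := by simpa using rst_comp_self (𝟙 X)
    simpa [h1] using this
  have h := comp_rst f g
  rw [hg, Category.comp_id] at h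
  have h2 : rst f = rst (f ≫ g) ≫ rst f := by
    rw [← rst_rst_comp, ← h]
  have h3 : rst (f ≫ g) = rst f ≫ rst (f ≫ g) := by
    rw [← rst_rst_comp, ← Category.assoc, rst_comp_self]
  rw [h3, rst_comm, ← h2]

theorem rst_lift {T X Y : C} (f : T ⟶ X) (g : T ⟶ Y) : rst (lift f g) = rst f ≫ rst g := by
  rw [← rst_total_comp (lift f g) _ (rst_snd X Y), lift_snd, rst_rst_comp]

theorem rst_rst {X Y : C} (f : X ⟶ Y) : rst (rst f) = rst f := by
  have h1 : rst (𝟙 X) = 𝟙 X := by simpa using rst_comp_self (𝟙 X)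
  simpa [h1] using rst_rst_comp f (𝟙 X)

theorem rst_idem {X Y : C} (f : X ⟶ Y) : rst f ≫ rst f = rst f := by
  rw [← rst_rst_comp, rst_comp_self]

theorem comp_lift {S T X Y : C} (h : S ⟶ T) (f : T ⟶ X) (g : T ⟶ Y) :
    h ≫ lift f g = lift (h ≫ f) (h ≫ g) := by
  apply lift_unique
  · rw [Category.assoc, lift_fst, ← Category.assoc, comp_rst, Category.assoc]
  · rw [Category.assoc, lift_snd, ← Category.assoc, comp_rst, Category.assoc]

theorem rst_lift_left {T U X Y : C} (e : T ⟶ U) (f : T ⟶ X) (g : T ⟶ Y) :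
    lift (rst e ≫ f) g = rst e ≫ lift f g := by
  symm
  apply lift_unique
  · rw [Category.assoc, lift_fst, ← Category.assoc, ← Category.assoc, rst_comm]
  · rw [Category.assoc, lift_snd, rst_rst_comp, Category.assoc]

theorem rst_lift_right {T U X Y : C} (e : T ⟶ U) (f : T ⟶ X) (g : T ⟶ Y) :
    lift f (rst e ≫ g) = rst e ≫ lift f g := by
  symm
  apply lift_unique
  · rw [Category.assoc, lift_fst, rst_rst_comp, Category.assoc]
  · rw [Category.assoc, lift_snd, ← Category.assoc, ← Category.assoc, rst_comm]

theorem hom_ext {T X Y : C} {h k : T ⟶ prod X Y} (h1 : h ≫ fst X Y = k ≫ fst X Y)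
    (h2 : h ≫ snd X Y = k ≫ snd X Y) : h = k := by
  have aux : ∀ m : T ⟶ prod X Y, m = lift (m ≫ fst X Y) (m ≫ snd X Y) := fun m => by
    apply lift_unique
    · rw [rst_total_comp _ _ (rst_snd X Y), ← Category.assoc, rst_comp_self]
    · rw [rst_total_comp _ _ (rst_fst X Y), ← Category.assoc, rst_comp_self]
  rw [aux h, aux k, h1, h2]

end Monoids

/-- The laws of a total commutative monoid `(A, add, zero)` in a Cartesian restriction category. -/
structure IsTotalCommMon {C : Type u} [CartRest.{v} C] (A : C) (add : prod A A ⟶ A)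
    (zero : (one : C) ⟶ A) : Prop where
  rst_add : rst add = 𝟙 (prod A A)
  rst_zero : rst zero = 𝟙 one
  zero_add : lift (bang A ≫ zero) (𝟙 A) ≫ add = 𝟙 A
  add_comm : lift (snd A A) (fst A A) ≫ add = add
  add_assoc : lift (fst (prod A A) A ≫ add) (snd (prod A A) A) ≫ add =
    lift (fst (prod A A) A ≫ fst A A)
      (lift (fst (prod A A) A ≫ snd A A) (snd (prod A A) A) ≫ add) ≫ add

/-- A total commutative monoid `(A, +, 0)` in a Cartesian restriction category. -/
structure TotalCommMon (C : Type u) [CartRest.{v} C] where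
  carrier : C
  add : prod carrier carrier ⟶ carrier
  zero : (one : C) ⟶ carrier
  isMon : IsTotalCommMon carrier add zero

namespace TotalCommMon

variable {C : Type u} [CartRest.{v} C]

/-- `f + g := ⟨f, g⟩ +` -/
instance homAdd (A : TotalCommMon C) (T : C) : Add (T ⟶ A.carrier) := ⟨fun f g => lift f g ≫ A.add⟩

/-- `0 := ! 0` -/
instance homZero (A : TotalCommMon C) (T : C) : Zero (T ⟶ A.carrier) := ⟨bang T ≫ A.zero⟩

theorem hom_add_def (A : TotalCommMon C) {T : C} (f g : T ⟶ A.carrier) :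
    f + g = lift f g ≫ A.add := rfl

theorem hom_zero_def (A : TotalCommMon C) (T : C) : (0 : T ⟶ A.carrier) = bang T ≫ A.zero := rfl

theorem hom_zero_add (A : TotalCommMon C) {T : C} (f : T ⟶ A.carrier) : 0 + f = f := by
  have h : f ≫ lift (bang A.carrier ≫ A.zero) (𝟙 A.carrier) ≫ A.add = f := by
    rw [A.isMon.zero_add, Category.comp_id]
  rw [← Category.assoc, comp_lift, ← Category.assoc f, comp_bang, Category.comp_id,
    Category.assoc, rst_lift_left, ← rst_lift_right, rst_comp_self] at h
  exact h

theorem hom_add_comm (A : TotalCommMon C) {T : C} (f g : T ⟶ A.carrier) : f + g = g + f := by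
  have h : lift g f ≫ lift (snd _ _) (fst _ _) ≫ A.add = lift g f ≫ A.add := by
    rw [A.isMon.add_comm]
  rw [← Category.assoc, comp_lift, lift_snd, lift_fst, rst_lift_left, rst_lift_right,
    ← Category.assoc (rst g), rst_comm g f, ← rst_lift, rst_comp_self] at h
  exact h

theorem hom_add_assoc (A : TotalCommMon C) {T : C} (f g k : T ⟶ A.carrier) :
    f + g + k = f + (g + k) := by
  have absl : ∀ {X Y : C} (a : T ⟶ X) (b : T ⟶ Y), rst a ≫ lift a b = lift a b := by
    intro X Y a b
    rw [← rst_lift_left, rst_comp_self]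
  have absr : ∀ {X Y : C} (a : T ⟶ X) (b : T ⟶ Y), rst b ≫ lift a b = lift a b := by
    intro X Y a b
    rw [← rst_lift_right, rst_comp_self]
  have ra : ∀ a b : T ⟶ A.carrier, rst (lift a b) = rst (lift a b ≫ A.add) :=
    fun a b => (rst_total_comp _ _ A.isMon.rst_add).symm
  have h : lift (lift f g) k ≫ lift (fst (prod A.carrier A.carrier) A.carrier ≫ A.add)
      (snd (prod A.carrier A.carrier) A.carrier) ≫ A.add = lift (lift f g) k ≫
      lift (fst (prod A.carrier A.carrier) A.carrier ≫ fst A.carrier A.carrier)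
      (lift (fst (prod A.carrier A.carrier) A.carrier ≫ snd A.carrier A.carrier)
        (snd (prod A.carrier A.carrier) A.carrier) ≫ A.add) ≫ A.add := by
    rw [A.isMon.add_assoc]
  have hL : lift (lift f g) k ≫ lift (fst (prod A.carrier A.carrier) A.carrier ≫ A.add)
      (snd (prod A.carrier A.carrier) A.carrier) = lift (lift f g ≫ A.add) k := by
    rw [comp_lift, ← Category.assoc, lift_fst, lift_snd, Category.assoc, rst_lift_left,
      rst_lift_right, ra, absl, absr]
  have hR : lift (lift f g) k ≫ lift
      (fst (prod A.carrier A.carrier) A.carrier ≫ fst A.carrier A.carrier)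
      (lift (fst (prod A.carrier A.carrier) A.carrier ≫ snd A.carrier A.carrier)
        (snd (prod A.carrier A.carrier) A.carrier) ≫ A.add) = lift f (lift g k ≫ A.add) := by
    have p1 : lift (lift f g) k ≫ fst (prod A.carrier A.carrier) A.carrier ≫
        fst A.carrier A.carrier = rst k ≫ rst g ≫ f := by
      rw [← Category.assoc, lift_fst, Category.assoc, lift_fst]
    have p2 : lift (lift f g) k ≫ fst (prod A.carrier A.carrier) A.carrier ≫
        snd A.carrier A.carrier = rst k ≫ rst f ≫ g := by
      rw [← Category.assoc, lift_fst, Category.assoc, lift_snd]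
    have e1 : lift (rst k ≫ rst f ≫ g) (rst (lift f g) ≫ k) = rst f ≫ lift g k := by
      rw [rst_lift_left, rst_lift_left, rst_lift_right, rst_lift, Category.assoc, absl,
        ← Category.assoc (rst f), rst_idem, ← Category.assoc, rst_comm, Category.assoc, absr]
    rw [comp_lift, p1, ← Category.assoc _ _ A.add, comp_lift, p2, lift_snd, e1, Category.assoc,
      rst_lift_right, rst_lift_left, rst_lift_left, ← Category.assoc (rst k), rst_comm k g,
      ← rst_lift, ra, absr, absl]
  rw [← Category.assoc, hL, ← Category.assoc, hR] at h
  exact h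

/-- The commutative monoid structure on the maps `T ⟶ A`. -/
instance homMonoid (A : TotalCommMon C) (T : C) : AddCommMonoid (T ⟶ A.carrier) where
  add_assoc := A.hom_add_assoc
  zero_add := A.hom_zero_add
  add_zero f := by rw [A.hom_add_comm, A.hom_zero_add]
  add_comm := A.hom_add_comm
  nsmul := nsmulRec

/-- The trivial monoid on the terminal object. -/
def unit (C : Type u) [CartRest.{v} C] : TotalCommMon C where
  carrier := one
  add := bang _
  zero := 𝟙 one
  isMon :=
    { rst_add := rst_bang _
      rst_zero := by simpa using rst_comp_self (𝟙 (one : C))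
      zero_add := by
        rw [comp_bang, bang_one, rst_lift, Category.comp_id, Category.comp_id, ← bang_one,
          rst_bang, bang_one, Category.comp_id]
      add_comm := by rw [comp_bang, rst_lift, rst_snd, rst_fst, Category.id_comp, Category.id_comp]
      add_assoc := by
        have t : ∀ {X Y : C} (f : X ⟶ Y), rst f = 𝟙 X → f ≫ bang Y = bang X := fun f hf => by
          rw [comp_bang, hf, Category.id_comp]
        rw [t _ (by rw [rst_lift, t _ (rst_fst _ _), rst_bang, rst_snd, Category.id_comp]), t]
        simp only [rst_lift, rst_total_comp _ _ (rst_bang _), rst_total_comp _ _ (rst_fst _ _),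
          rst_total_comp _ _ (rst_snd _ _), rst_fst, rst_snd, Category.id_comp] }

/-- The product monoid `(A × B, ex(+ × +), (0, 0))`. -/
def prodAdd (A B : TotalCommMon C) :
    prod (prod A.carrier B.carrier) (prod A.carrier B.carrier) ⟶ prod A.carrier B.carrier :=
  lift (lift (fst _ _ ≫ fst _ _) (snd _ _ ≫ fst _ _) ≫ A.add)
    (lift (fst _ _ ≫ snd _ _) (snd _ _ ≫ snd _ _) ≫ B.add)

theorem rst_prodAdd (A B : TotalCommMon C) : rst (prodAdd A B) = 𝟙 _ := by
  simp only [prodAdd, rst_lift, rst_total_comp _ _ A.isMon.rst_add,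
    rst_total_comp _ _ B.isMon.rst_add, rst_total_comp _ _ (rst_fst _ _),
    rst_total_comp _ _ (rst_snd _ _), rst_fst, rst_snd, Category.id_comp]

theorem rst_comp_lift {T X Y : C} (a : T ⟶ X) (b : T ⟶ Y) {Z W : C} (p : X ⟶ Z) (q : Y ⟶ W)
    (hp : rst p = 𝟙 X) (hq : rst q = 𝟙 Y) :
    lift (rst b ≫ a ≫ p) (rst a ≫ b ≫ q) = lift (a ≫ p) (b ≫ q) := by
  rw [← rst_total_comp a p hp, ← rst_total_comp b q hq, rst_lift_left, rst_lift_right,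
    ← rst_lift_left, rst_comp_self, ← rst_lift_right, rst_comp_self]

theorem comp_prodAdd_fst (A B : TotalCommMon C) {T : C} (a b : T ⟶ prod A.carrier B.carrier) :
    (lift a b ≫ prodAdd A B) ≫ fst _ _ = a ≫ fst _ _ + b ≫ fst _ _ := by
  have ht : rst (lift (fst _ _ ≫ snd _ _) (snd _ _ ≫ snd _ _) ≫ B.add : prod (prod A.carrier
      B.carrier) (prod A.carrier B.carrier) ⟶ _) = 𝟙 _ := by
    simp only [rst_lift, rst_total_comp _ _ B.isMon.rst_add, rst_total_comp _ _ (rst_snd _ _),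
      rst_fst, rst_snd, Category.id_comp]
  rw [hom_add_def, prodAdd, Category.assoc, lift_fst, ht, Category.id_comp, ← Category.assoc,
    comp_lift, ← Category.assoc, ← Category.assoc, lift_fst, lift_snd, Category.assoc,
    Category.assoc, rst_comp_lift _ _ _ _ (rst_fst _ _) (rst_fst _ _)]

theorem comp_prodAdd_snd (A B : TotalCommMon C) {T : C} (a b : T ⟶ prod A.carrier B.carrier) :
    (lift a b ≫ prodAdd A B) ≫ snd _ _ = a ≫ snd _ _ + b ≫ snd _ _ := by
  have ht : rst (lift (fst _ _ ≫ fst _ _) (snd _ _ ≫ fst _ _) ≫ A.add : prod (prod A.carrier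
      B.carrier) (prod A.carrier B.carrier) ⟶ _) = 𝟙 _ := by
    simp only [rst_lift, rst_total_comp _ _ A.isMon.rst_add, rst_total_comp _ _ (rst_fst _ _),
      rst_fst, rst_snd, Category.id_comp]
  rw [hom_add_def, prodAdd, Category.assoc, lift_snd, ht, Category.id_comp, ← Category.assoc,
    comp_lift, ← Category.assoc, ← Category.assoc, lift_fst, lift_snd, Category.assoc,
    Category.assoc, rst_comp_lift _ _ _ _ (rst_snd _ _) (rst_snd _ _)]

theorem total_lift_fst {T X Y : C} (f : T ⟶ X) (g : T ⟶ Y) (hg : rst g = 𝟙 T) :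
    lift f g ≫ fst X Y = f := by
  rw [lift_fst, hg, Category.id_comp]

theorem total_lift_snd {T X Y : C} (f : T ⟶ X) (g : T ⟶ Y) (hf : rst f = 𝟙 T) :
    lift f g ≫ snd X Y = g := by
  rw [lift_snd, hf, Category.id_comp]

def prod (A B : TotalCommMon C) : TotalCommMon C where
  carrier := CRStruct.prod A.carrier B.carrier
  add := prodAdd A B
  zero := lift A.zero B.zero
  isMon :=
    { rst_add := rst_prodAdd A B
      rst_zero := by rw [rst_lift, A.isMon.rst_zero, B.isMon.rst_zero, Category.id_comp]
      zero_add := by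
        apply hom_ext
        · rw [comp_prodAdd_fst, Category.id_comp, Category.assoc,
            total_lift_fst _ _ B.isMon.rst_zero, ← hom_zero_def, hom_zero_add]
        · rw [comp_prodAdd_snd, Category.id_comp, Category.assoc,
            total_lift_snd _ _ A.isMon.rst_zero, ← hom_zero_def, hom_zero_add]
      add_comm := by
        have h : prodAdd A B = lift (fst _ _) (snd _ _) ≫ prodAdd A B := by
          rw [← lift_unique (fst _ _) (snd _ _) (𝟙 _), Category.id_comp]
          · rw [rst_snd]
          · rw [rst_fst]
        rw [h, ← Category.assoc, comp_lift, total_lift_fst _ _ (rst_fst _ _),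
          total_lift_snd _ _ (rst_snd _ _)]
        apply hom_ext
        · rw [comp_prodAdd_fst, comp_prodAdd_fst, hom_add_comm]
        · rw [comp_prodAdd_snd, comp_prodAdd_snd, hom_add_comm]
      add_assoc := by
        have h : prodAdd A B = lift (fst _ _) (snd _ _) ≫ prodAdd A B := by
          rw [← lift_unique (fst _ _) (snd _ _) (𝟙 _), Category.id_comp]
          · rw [rst_snd]
          · rw [rst_fst]
        apply hom_ext
        · rw [comp_prodAdd_fst, comp_prodAdd_fst, comp_prodAdd_fst, ← hom_add_assoc]
          congr 1
          conv_lhs => rw [h, ← Category.assoc, comp_lift]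
          rw [comp_prodAdd_fst]
        · rw [comp_prodAdd_snd, comp_prodAdd_snd, comp_prodAdd_snd, ← hom_add_assoc]
          congr 1
          conv_lhs => rw [h, ← Category.assoc, comp_lift]
          rw [comp_prodAdd_snd] }

end TotalCommMon

/-! ### Strict functors act on monoids -/

namespace StrictFunctor

variable {C : Type u} [CartRest.{v} C] {D : Type u'} [CartRest.{v'} D] (F : StrictFunctor C D)

theorem map_lift {T X Y : C} (f : T ⟶ X) (g : T ⟶ Y) :
    F.map (lift f g) = lift (F.map f) (F.map g) ≫ eqToHom (F.obj_prod X Y).symm := by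
  have h : F.map (lift f g) ≫ eqToHom (F.obj_prod X Y) = lift (F.map f) (F.map g) := by
    apply lift_unique
    · rw [Category.assoc, ← F.map_fst, ← F.map_comp, lift_fst, F.map_comp, F.map_rst]
    · rw [Category.assoc, ← F.map_snd, ← F.map_comp, lift_snd, F.map_comp, F.map_rst]
  rw [← h]; simp

theorem map_bang (X : C) : F.map (bang X) = bang (F.obj X) ≫ eqToHom F.obj_one.symm := by
  have h : F.map (bang X) ≫ eqToHom F.obj_one = bang (F.obj X) := by
    have h1 := comp_bang (F.map (bang X) ≫ eqToHom F.obj_one)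
    have h2 : rst (F.map (bang X) ≫ eqToHom F.obj_one) = 𝟙 (F.obj X) := by
      have h3 : ∀ {A B : D} (e : A = B), rst (eqToHom e) = 𝟙 A := by
        intro A B e; subst e; simpa using rst_comp_self (𝟙 A)
      rw [rst_total_comp _ _ (h3 _), ← F.map_rst, rst_bang, F.map_id]
    rw [h2, bang_one, Category.id_comp, Category.comp_id] at h1
    exact h1
  rw [← h]; simp

/-- The monoid `(F A, F +, F 0)`. -/
def mapMon (A : TotalCommMon C) : TotalCommMon D where
  carrier := F.obj A.carrier
  add := eqToHom (F.obj_prod _ _).symm ≫ F.map A.add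
  zero := eqToHom F.obj_one.symm ≫ F.map A.zero
  isMon := by
    have tot : ∀ {X X' Y : D} (e : X' = X) (g : X ⟶ Y), rst g = 𝟙 X →
        rst (eqToHom e ≫ g) = 𝟙 X' := by
      intro X X' Y e g hg; subst e; simpa using hg
    have hl : ∀ {T : C} (f g : T ⟶ A.carrier), lift (F.map f) (F.map g) ≫
        eqToHom (F.obj_prod _ _).symm ≫ F.map A.add = F.map (lift f g ≫ A.add) := by
      intro T f g
      rw [F.map_comp, F.map_lift, Category.assoc]
    have hc : ∀ {X X' Y Z : D} (e : X = X') (f : X ⟶ Y) (g : X ⟶ Z),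
        lift (eqToHom e.symm ≫ f) (eqToHom e.symm ≫ g) = eqToHom e.symm ≫ lift f g := by
      intro X X' Y Z e f g; subst e; simp
    have mf : ∀ X Y : C, fst (F.obj X) (F.obj Y) =
        eqToHom (F.obj_prod X Y).symm ≫ F.map (fst X Y) := by
      intro X Y; rw [F.map_fst]; simp
    have ms : ∀ X Y : C, snd (F.obj X) (F.obj Y) =
        eqToHom (F.obj_prod X Y).symm ≫ F.map (snd X Y) := by
      intro X Y; rw [F.map_snd]; simp
    refine ⟨tot _ _ ?_, tot _ _ ?_, ?_, ?_, ?_⟩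
    · rw [← F.map_rst, A.isMon.rst_add, F.map_id]
    · rw [← F.map_rst, A.isMon.rst_zero, F.map_id]
    · have h : bang (F.obj A.carrier) ≫ eqToHom F.obj_one.symm ≫ F.map A.zero =
          F.map (bang A.carrier ≫ A.zero) := by
        rw [F.map_comp, F.map_bang, Category.assoc]
      rw [h, ← F.map_id, hl, A.isMon.zero_add]
    · rw [mf, ms, hc (F.obj_prod _ _), Category.assoc, hl, A.isMon.add_comm]
    · have gen : ∀ {P : D} (e : F.obj (prod A.carrier A.carrier) = P),
          ∃ e' : F.obj (prod (prod A.carrier A.carrier) A.carrier) = prod P (F.obj A.carrier),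
          fst P (F.obj A.carrier) = eqToHom e'.symm ≫
            F.map (fst (prod A.carrier A.carrier) A.carrier) ≫ eqToHom e ∧
          snd P (F.obj A.carrier) = eqToHom e'.symm ≫
            F.map (snd (prod A.carrier A.carrier) A.carrier) := by
        intro P e
        subst e
        exact ⟨F.obj_prod _ _, by rw [mf]; simp, ms _ _⟩
      obtain ⟨e', k1, k2⟩ := gen (F.obj_prod _ _)
      have ee : ∀ {X Y Z : D} (e : X = Y) (f : X ⟶ Z),
          eqToHom e ≫ eqToHom e.symm ≫ f = f := by
        intro X Y Z e f; subst e; simp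
      rw [k1, k2, mf, ms]
      simp only [Category.assoc, ee, ← F.map_comp]
      rw [hc e', hc e', Category.assoc, Category.assoc, hl, hl, hc e', Category.assoc, hl,
        A.isMon.add_assoc]

end StrictFunctor

/-! ### Powers -/

section Powers

variable {C : Type u} [CartRest.{v} C]

/-- The object `A^n × X = A × (A × ⋯ × (A × X))`. -/
def pow (A X : C) : ℕ → C
  | 0 => X
  | n + 1 => prod A (pow A X n)

/-- The projections `π_i : A^n × X ⟶ A`, `0 ≤ i < n`. -/
def proj (A X : C) : ∀ (n : ℕ), Fin n → (pow A X n ⟶ A)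
  | 0, i => i.elim0
  | n + 1, i => Fin.cases (motive := fun _ => (pow A X (n + 1) ⟶ A)) (fst A (pow A X n))
      (fun j => snd A (pow A X n) ≫ proj A X n j) i

/-- The last projection `π_n : A^n × X ⟶ X`. -/
def last (A X : C) : ∀ n : ℕ, pow A X n ⟶ X
  | 0 => 𝟙 X
  | n + 1 => snd A (pow A X n) ≫ last A X n

/-- The map `⟨a_0, …, a_{n-1}, x⟩ : T ⟶ A^n × X`. -/
def tuple {T A X : C} : ∀ {n : ℕ}, (Fin n → (T ⟶ A)) → (T ⟶ X) → (T ⟶ pow A X n)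
  | 0, _, x => x
  | _ + 1, a, x => lift (a 0) (tuple (fun i => a i.succ) x)

theorem StrictFunctor.obj_pow {D : Type u'} [CartRest.{v'} D] (F : StrictFunctor C D) (A X : C) :
    ∀ n : ℕ, F.obj (pow A X n) = pow (F.obj A) (F.obj X) n
  | 0 => rfl
  | n + 1 => (F.obj_prod A (pow A X n)).trans
      (congrArg (prod (F.obj A)) (F.obj_pow A X n))

/-- `h : A^n × X ⟶ B` is additive in each of its first `n` variables; as usual for partial maps,
substituting `0` for a variable gives the restriction of `0` to the domain of definition. -/
def IsAdditive (A : TotalCommMon C) (X : C) (B : TotalCommMon C) (n : ℕ)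
    (h : pow A.carrier X n ⟶ B.carrier) : Prop :=
  ∀ (T : C) (a : Fin n → (T ⟶ A.carrier)) (x : T ⟶ X) (i : Fin n),
    (∀ b c : T ⟶ A.carrier, tuple (Function.update a i (b + c)) x ≫ h =
      tuple (Function.update a i b) x ≫ h + tuple (Function.update a i c) x ≫ h) ∧
    tuple (Function.update a i 0) x ≫ h = rst (tuple (Function.update a i 0) x ≫ h) ≫ 0

/-- `h : A^n × X ⟶ B` is symmetric in its first `n` variables. -/
def IsSymm (A X B : C) (n : ℕ) (h : pow A X n ⟶ B) : Prop :=
  ∀ (T : C) (a : Fin n → (T ⟶ A)) (x : T ⟶ X) (σ : Equiv.Perm (Fin n)),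
    tuple (fun i => a (σ i)) x ≫ h = tuple a x ≫ h

end Powers

/-! ### The category `Faà(C)` -/

/-- Objects of `Faà(C)`: pairs `((A, +, 0), X)`. -/
structure FaaObj (C : Type u) [CartRest.{v} C] where
  mon : TotalCommMon C
  pt : C

section Faa

variable {C : Type u} [CartRest.{v} C]

/-- The object `A^n × X` of `C` attached to an object `(A, X)` of `Faà(C)`. -/
abbrev FaaObj.dom (P : FaaObj C) (n : ℕ) : C := pow P.mon.carrier P.pt n

/-- Morphisms `((A, +, 0), X) ⟶ ((B, +, 0), Y)` of `Faà(C)`: sequences `(f_*, f_1, f_2, …)`. -/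
@[ext]
structure FaaHom (P Q : FaaObj C) where
  star : P.pt ⟶ Q.pt
  d : ∀ n : ℕ+, P.dom n ⟶ Q.mon.carrier
  rst_d : ∀ n : ℕ+, rst (d n) = rst (last P.mon.carrier P.pt n ≫ star)
  additive : ∀ n : ℕ+, IsAdditive P.mon P.pt Q.mon n (d n)
  symm : ∀ n : ℕ+, IsSymm P.mon.carrier P.pt Q.mon.carrier n (d n)

def FaaObj.unit (C : Type u) [CartRest.{v} C] : FaaObj C := ⟨TotalCommMon.unit C, one⟩

def FaaObj.prod (P Q : FaaObj C) : FaaObj C := ⟨P.mon.prod Q.mon, CRStruct.prod P.pt Q.pt⟩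

/-- `f = (h, π_0 k, 0, 0, …)` -/
def FaaHom.IsLinear {P Q : FaaObj C} (f : FaaHom P Q) (h : P.pt ⟶ Q.pt)
    (k : P.mon.carrier ⟶ Q.mon.carrier) : Prop :=
  f.star = h ∧ f.d 1 = proj P.mon.carrier P.pt 1 0 ≫ k ∧ ∀ n : ℕ+, n ≠ 1 → f.d n = 0

/-- The `n`-th component of a composite: the sum, over all partitions of the `n` variables into
blocks `β_1, …, β_k`, of `⟨p_1 f_{|β_1|}, …, p_k f_{|β_k|}, π_n f_*⟩ g_k`, where `p_i` selects the
variables that lie in `β_i`, together with the last one. -/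
noncomputable def compD {P Q R : FaaObj C} (f : FaaHom P Q) (g : FaaHom Q R) (n : ℕ+) :
    P.dom n ⟶ R.mon.carrier :=
  ∑ c : OrderedFinpartition n,
    (tuple (fun i : Fin c.length =>
        (tuple (fun j : Fin (c.partSize i) => proj P.mon.carrier P.pt n (c.emb i j))
          (last P.mon.carrier P.pt n) : P.dom n ⟶ P.dom (c.partSize i)) ≫
          f.d ⟨c.partSize i, c.partSize_pos i⟩)
      (last P.mon.carrier P.pt n ≫ f.star) : P.dom n ⟶ Q.dom c.length) ≫
      g.d ⟨c.length, c.length_pos n.pos⟩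

/-- The operations of `Faà(C)`.  Since a morphism is determined by its components, there is at
most one such collection of operations; an element exists when the sequences of maps that are
prescribed here are morphisms of `Faà(C)`. -/
structure FaaOps (C : Type u) [CartRest.{v} C] where
  id : ∀ P : FaaObj C, FaaHom P P
  isLinear_id : ∀ P, (id P).IsLinear (𝟙 P.pt) (𝟙 P.mon.carrier)
  comp : ∀ {P Q R : FaaObj C}, FaaHom P Q → FaaHom Q R → FaaHom P R
  comp_star : ∀ {P Q R : FaaObj C} (f : FaaHom P Q) (g : FaaHom Q R),
    (comp f g).star = f.star ≫ g.star
  comp_d : ∀ {P Q R : FaaObj C} (f : FaaHom P Q) (g : FaaHom Q R) (n : ℕ+),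
    (comp f g).d n = compD f g n
  rst : ∀ {P Q : FaaObj C}, FaaHom P Q → FaaHom P P
  rst_star : ∀ {P Q : FaaObj C} (f : FaaHom P Q), (rst f).star = CRStruct.rst f.star
  rst_d_one : ∀ {P Q : FaaObj C} (f : FaaHom P Q), (rst f).d 1 =
    CRStruct.rst (last P.mon.carrier P.pt 1 ≫ f.star) ≫ proj P.mon.carrier P.pt 1 0
  rst_d : ∀ {P Q : FaaObj C} (f : FaaHom P Q) (n : ℕ+), n ≠ 1 →
    (rst f).d n = CRStruct.rst (last P.mon.carrier P.pt n ≫ f.star) ≫ 0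
  bang : ∀ P : FaaObj C, FaaHom P (FaaObj.unit C)
  isLinear_bang : ∀ P, (bang P).IsLinear (CRStruct.bang P.pt) (CRStruct.bang P.mon.carrier)
  fst : ∀ P Q : FaaObj C, FaaHom (P.prod Q) P
  isLinear_fst : ∀ P Q, (fst P Q).IsLinear (CRStruct.fst P.pt Q.pt)
    (CRStruct.fst P.mon.carrier Q.mon.carrier)
  snd : ∀ P Q : FaaObj C, FaaHom (P.prod Q) Q
  isLinear_snd : ∀ P Q, (snd P Q).IsLinear (CRStruct.snd P.pt Q.pt)
    (CRStruct.snd P.mon.carrier Q.mon.carrier)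
  lift : ∀ {P Q R : FaaObj C}, FaaHom P Q → FaaHom P R → FaaHom P (Q.prod R)
  lift_star : ∀ {P Q R : FaaObj C} (f : FaaHom P Q) (g : FaaHom P R),
    (lift f g).star = CRStruct.lift f.star g.star
  lift_d : ∀ {P Q R : FaaObj C} (f : FaaHom P Q) (g : FaaHom P R) (n : ℕ+),
    (lift f g).d n = CRStruct.lift (f.d n) (g.d n)

@[reducible]
def FaaOps.toCRStruct (S : FaaOps C) : CRStruct.{v} (FaaObj C) where
  Hom := FaaHom
  id := S.id
  comp := S.comp
  rst := S.rst
  one := FaaObj.unit C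
  bang := S.bang
  prod := FaaObj.prod
  fst := S.fst
  snd := S.snd
  lift := S.lift

/-- The Cartesian restriction category structure of `Faà(C)`: the operations above exist and
satisfy the axioms. -/
structure FaaStr (C : Type u) [CartRest.{v} C] extends FaaOps C where
  isCartesianRestriction : @IsCartesianRestriction (FaaObj C) toFaaOps.toCRStruct

/-- `Faà(C)`, as a type equipped with its Cartesian restriction structure. -/
def FaaStr.Cat (_ : FaaStr C) : Type (max u v) := FaaObj C

instance (S : FaaStr C) : CartRest.{v} S.Cat where
  toCRStruct := S.toFaaOps.toCRStruct
  toIsCartesianRestriction := S.isCartesianRestriction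

/-- `Faà(C)` as an object of the category of Cartesian restriction categories. -/
def FaaStr.toCartRestCat (S : FaaStr C) : CartRestCat.{v, max u v} := ⟨S.Cat⟩

/-! ### `Faà` on functors, the counit and the comultiplication -/

/-- `Faà(F)((A, +, 0), X) = ((F A, F +, F 0), F X)` -/
def StrictFunctor.mapObj {D : Type u'} [CartRest.{v'} D] (F : StrictFunctor C D)
    (P : FaaObj C) : FaaObj D := ⟨F.mapMon P.mon, F.obj P.pt⟩

/-- The strict functor `Φ : Faà(C) ⟶ Faà(D)` is `Faà(F)`, that is,
`Φ((A, +, 0), X) = ((F A, F +, F 0), F X)` and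
`Φ(f_*, f_1, f_2, …) = (F f_*, F f_1, F f_2, …)`. -/
def IsFaaMap {D : Type u} [CartRest.{v} D] (S : FaaStr C) (S' : FaaStr D)
    (F : StrictFunctor C D) (Φ : StrictFunctor S.Cat S'.Cat) : Prop :=
  ∃ m : ∀ {P Q : FaaObj C}, FaaHom P Q → FaaHom (F.mapObj P) (F.mapObj Q),
    (∀ {P Q : FaaObj C} (f : FaaHom P Q), (m f).star = F.map f.star ∧
      ∀ n : ℕ+, (m f).d n =
        eqToHom (F.obj_pow P.mon.carrier P.pt n).symm ≫ F.map (f.d n)) ∧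
    Φ.toPrefunctor = { obj := F.mapObj, map := m }

/-- The strict functor `E : Faà(C) ⟶ C` is the counit: `E((A, +, 0), X) = X` and
`E(f_*, f_1, f_2, …) = f_*`. -/
def IsCounit (S : FaaStr C) (E : StrictFunctor S.Cat C) : Prop :=
  E.toPrefunctor = { obj := FaaObj.pt, map := FaaHom.star }

/-- The commutative monoid `(((A, +, 0), A), (+, π_0 +, 0, …), (0, π_0 0, 0, …))` in `Faà(C)`
attached to a commutative monoid `(A, +, 0)` in `C`. -/
structure LinearMonoid (S : FaaStr C) (A : TotalCommMon C) where
  add : FaaHom (FaaObj.prod ⟨A, A.carrier⟩ ⟨A, A.carrier⟩) ⟨A, A.carrier⟩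
  isLinear_add : add.IsLinear A.add A.add
  zero : FaaHom (FaaObj.unit C) ⟨A, A.carrier⟩
  isLinear_zero : zero.IsLinear A.zero A.zero
  isMon : IsTotalCommMon (C := S.Cat) (⟨A, A.carrier⟩ : FaaObj C) add zero

def LinearMonoid.toMon {S : FaaStr C} {A : TotalCommMon C} (L : LinearMonoid S A) :
    TotalCommMon S.Cat where
  carrier := (⟨A, A.carrier⟩ : FaaObj C)
  add := L.add
  zero := L.zero
  isMon := L.isMon

/-- `δ((A, +, 0), X) =
((((A, +, 0), A), (+, π_0 +, 0, …), (0, π_0 0, 0, …)), ((A, +, 0), X))` -/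
def comultObj (S : FaaStr C) (L : ∀ A : TotalCommMon C, LinearMonoid S A) (P : FaaObj C) :
    FaaObj S.Cat where
  mon := (L P.mon).toMon
  pt := P

section Coordinates

/-! For objects `P = (A, X)` and `Q = (B, Y)` of `Faà(C)`, the object `P^r × Q` of `Faà(C)` is the
pair `(A^r × B, X^r × Y)`; here are the projections of its two parts. -/

abbrev FaaStr.Cat.pt {S : FaaStr C} (P : S.Cat) : C := FaaObj.pt (C := C) P

abbrev FaaStr.Cat.vec {S : FaaStr C} (P : S.Cat) : C := (FaaObj.mon (C := C) P).carrier

variable {S : FaaStr C} (P Q : S.Cat)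

def ptProj : ∀ r : ℕ, Fin r → ((pow P Q r).pt ⟶ P.pt)
  | 0, i => i.elim0
  | r + 1, i => Fin.cases (motive := fun _ => ((pow P Q (r + 1)).pt ⟶ P.pt))
      (fst P.pt (pow P Q r).pt) (fun j => snd P.pt (pow P Q r).pt ≫ ptProj r j) i

def ptLast : ∀ r : ℕ, (pow P Q r).pt ⟶ Q.pt
  | 0 => 𝟙 Q.pt
  | r + 1 => snd P.pt (pow P Q r).pt ≫ ptLast r

def vecProj : ∀ r : ℕ, Fin r → ((pow P Q r).vec ⟶ P.vec)
  | 0, i => i.elim0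
  | r + 1, i => Fin.cases (motive := fun _ => ((pow P Q (r + 1)).vec ⟶ P.vec))
      (fst P.vec (pow P Q r).vec) (fun j => snd P.vec (pow P Q r).vec ≫ vecProj r j) i

def vecLast : ∀ r : ℕ, (pow P Q r).vec ⟶ Q.vec
  | 0 => 𝟙 Q.vec
  | r + 1 => snd P.vec (pow P Q r).vec ≫ vecLast r

end Coordinates

/-- Given `f : (A, X) ⟶ (B, Y)` in `Faà(C)`, the value of `(δ(f)_r)_s` at vectors
`(a_{j,1}, …, a_{j,r}, b_j)`, `j = 1, …, s`, and at the point `(c_1, …, c_r, x)`.  It is the sum,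
over all partial injections from `{1, …, s}` to `{1, …, r}`, of
`f_{r+s-t}(e_1, …, e_r, b_{j_1}, …, b_{j_{s-t}}, x)`, where `t` is the number of indices `j` at which
the injection is defined, `e_i` is `a_{j,i}` if `j` is sent to `i` and is `c_i` if no `j` is sent to
`i`, and `j_1 < ⋯ < j_{s-t}` are the indices at which the injection is undefined.

A partial injection is encoded by the function `φ` that takes `i` to its preimage, if any. -/
noncomputable def comultSum {P Q : FaaObj C} (f : FaaHom P Q) (r : ℕ+) (s : ℕ) {T : C}
    (a : Fin s → Fin r → (T ⟶ P.mon.carrier)) (b : Fin s → (T ⟶ P.mon.carrier))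
    (c : Fin r → (T ⟶ P.mon.carrier)) (x : T ⟶ P.pt) : T ⟶ Q.mon.carrier :=
  ∑ φ : {φ : Fin r → Option (Fin s) // ∀ i i' j, φ i = some j → φ i' = some j → i = i'},
    let U : Finset (Fin s) := {j | ∀ i, φ.1 i ≠ some j}
    (tuple (Fin.append
        (fun i => match φ.1 i with
          | some j => a j i
          | none => c i)
        (fun k => b (U.orderEmbOfFin rfl k))) x : T ⟶ P.dom (r + U.card)) ≫
      f.d ⟨r + U.card, Nat.add_pos_left r.pos _⟩

/-- For `P = ((A, +, 0), X)` and `Q = ((B, +, 0), Y)`, the morphism `g` of `Faà(C)` from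
`((A, +, 0), A)^r × P` to `((B, +, 0), B)` is `δ(f)_r`: its component `g_*` is `f_r`, and its components `g_s` are given by `comultSum`. -/
def IsComultComponent {S : FaaStr C} {L : ∀ A : TotalCommMon C, LinearMonoid S A} {P Q : FaaObj C}
    (f : FaaHom P Q) (r : ℕ+)
    (g : FaaHom (C := C) ((comultObj S L P).dom r) ⟨Q.mon, Q.mon.carrier⟩) : Prop :=
  let A : S.Cat := (⟨P.mon, P.mon.carrier⟩ : FaaObj C)
  let V : C := (pow (C := S.Cat) A P r).vec
  let X : C := (pow (C := S.Cat) A P r).pt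
  g.star = (tuple (fun i => ptProj A P r i) (ptLast A P r) : X ⟶ P.dom r) ≫ f.d r ∧
  ∀ s : ℕ+, g.d s = comultSum f r s
    (fun j i => proj V X s j ≫ vecProj A P r i)
    (fun j => proj V X s j ≫ vecLast A P r)
    (fun i => last V X s ≫ ptProj A P r i)
    (last V X s ≫ ptLast A P r)

/-- The strict functor `Δ : Faà(C) ⟶ Faà(Faà(C))` is the comultiplication: it is given on objects
by `comultObj`, and on morphisms by `δ(f)_* = f` and by the components `δ(f)_r`. -/
def IsComult (S : FaaStr C) (S₂ : FaaStr S.Cat) (L : ∀ A : TotalCommMon C, LinearMonoid S A)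
    (Δ : StrictFunctor S.Cat S₂.Cat) : Prop :=
  ∃ m : ∀ {P Q : FaaObj C}, FaaHom P Q → FaaHom (comultObj S L P) (comultObj S L Q),
    (∀ {P Q : FaaObj C} (f : FaaHom P Q), (m f).star = f ∧
      ∀ r : ℕ+, IsComultComponent (L := L) f r ((m f).d r)) ∧
    Δ.toPrefunctor = { obj := comultObj S L, map := m }

end Faa

set_option linter.checkUnivs false in
/-- The endofunctor `Faà` on the category of Cartesian restriction categories: the Cartesian
restriction categories `Faà(X)` exist, the formulas for `Faà(F)` define strict functors, and these
respect identities and composition.  (All data are determined by the stated formulas; morphisms of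
`CartRestCat` are strict functors, so they preserve restrictions and products.) -/
structure FaaEndofunctor where
  str : ∀ X : CartRestCat.{v, max u v}, FaaStr X
  map : ∀ {X Y : CartRestCat.{v, max u v}} (_ : X ⟶ Y),
    (str X).toCartRestCat ⟶ (str Y).toCartRestCat
  isFaaMap : ∀ {X Y : CartRestCat.{v, max u v}} (F : X ⟶ Y), IsFaaMap (str X) (str Y) F (map F)
  map_id : ∀ X : CartRestCat.{v, max u v}, map (𝟙 X) = 𝟙 (str X).toCartRestCat
  map_comp : ∀ {X Y Z : CartRestCat.{v, max u v}} (F : X ⟶ Y) (G : Y ⟶ Z),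
    map (F ≫ G) = map F ≫ map G

def FaaEndofunctor.functor (T : FaaEndofunctor.{v, u}) :
    CartRestCat.{v, max u v} ⥤ CartRestCat.{v, max u v} where
  obj X := (T.str X).toCartRestCat
  map F := T.map F
  map_id := T.map_id
  map_comp := T.map_comp

end FaaRes

open CategoryTheory

set_option linter.unusedSectionVars false

/-! Two reductions turn everything into the combinatorics of finite multisets.

The first removes partiality. Maps into a total commutative monoid do form a commutative monoid, but
its zero is total, so a partial additive map only preserves zero up to restriction. A `Stage` fixes
a restriction idempotent `e`; the maps with domain exactly `e` form a commutative monoid `Stage.Vec`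
with zero `e 0`, and over it additivity is honest. At a point `x` of a stage lying in the domain of
`f_*`, the components of `f` become one multiadditive function of multisets of vectors,
`FaaHom.germ`; symmetry is what allows multisets. A morphism is determined by `f_*` and its germs
(`FaaHom.ext_germ`), because the coordinates of `A^n × X`, cut down to the domain of `f_n`, form a
universal stage. Conversely, additivity and symmetry need only be verified over stages
(`additive_symm_of_stage`).

The second describes the operations on germs. Composition becomes `pcomp`: sum over the partitions
of a multiset, with the inner function applied to each block and the outer one to the multiset of
values. It is associative (`pcomp_assoc`), since a partition of the blocks of a partition is a
partition refined inside each of its blocks. Identities, restrictions and projections have germs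
supported on one vector, and composing with such a germ on either side is immediate
(`pcomp_of_isLin_right`, `pcomp_of_isLin_left`). All axioms of a Cartesian restriction category
follow by comparing base maps and germs.

For the comultiplication, vectors over a stage of `Faà(C)` are themselves morphisms of `Faà(C)` and
are evaluated a second time over stages of `C`. For morphisms into `(A, A)` the base map also takes
values in `A`, so it can serve as the value at the empty family (`FaaHom.full`), and one formula
then covers `(δ(f)_r)_*` and all `(δ(f)_r)_s`. A germ of `δ(f)` at a family `m`, evaluated at a
family `N`, is `bcomp`: the sum over partitions of `m`, partitions of `N` and partial matchings
between their blocks. Such triples are exactly the partitions of the disjoint union of `m` and `N`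
(`msum_parts_sum`), so `bcomp` is `pcomp` on a disjoint union and functoriality of `δ` is again
associativity (`bcomp_assoc`). Only the partial injections of the formula for `δ` contribute,
because a block with more than one vector of `m` has value zero.

Coassociativity compares two ways of matching three families: the rows, the outer vectors and the
blocks of inner vectors. They agree by `msum_matchings_assoc`. The counit laws amount to `δ(f)_* =
f` and `(δ(f)_r)_* = f_r`. Naturality holds because a strict functor preserves sums, tuples and
projections, hence the defining formula. The remaining work is transport: strict functors agree only
when their values are equal objects, so equalities of monoids are derived from identity maps being
homomorphisms, and coordinates are compared up to `eqToHom`. -/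

namespace FaaRes

/-! ### Sums over multisets, partitions and matchings -/

section Combinatorics

open Multiset

variable {α β γ : Type*} {M N : Type*} [AddCommMonoid M] [AddCommMonoid N]

/-- The sum of `F x` over the elements `x` of a multiset, counted with multiplicity. -/
def msum (s : Multiset α) (F : α → M) : M := (s.map F).sum

@[simp] theorem msum_zero (F : α → M) : msum 0 F = 0 := rfl

@[simp] theorem msum_cons (a : α) (s : Multiset α) (F : α → M) :
    msum (a ::ₘ s) F = F a + msum s F := by simp [msum]

@[simp] theorem msum_singleton (a : α) (F : α → M) : msum {a} F = F a := by simp [msum]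

@[simp] theorem msum_add_left (s t : Multiset α) (F : α → M) :
    msum (s + t) F = msum s F + msum t F := by simp [msum]

@[simp] theorem msum_map (s : Multiset α) (g : α → β) (F : β → M) :
    msum (s.map g) F = msum s (fun x => F (g x)) := by simp [msum]

@[simp] theorem msum_bind (s : Multiset α) (g : α → Multiset β) (F : β → M) :
    msum (s.bind g) F = msum s (fun x => msum (g x) F) := by
  induction s using Multiset.induction_on with
  | empty => simp
  | cons a s ih => simp [ih]

theorem msum_add (s : Multiset α) (F G : α → M) :
    msum s (fun x => F x + G x) = msum s F + msum s G := by simp [msum]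

theorem msum_const_zero (s : Multiset α) : msum s (fun _ => (0 : M)) = 0 := by simp [msum]

theorem msum_congr {s : Multiset α} {F G : α → M} (h : ∀ x ∈ s, F x = G x) :
    msum s F = msum s G := by
  rw [msum, msum, Multiset.map_congr rfl h]

theorem msum_eq_zero {s : Multiset α} {F : α → M} (h : ∀ x ∈ s, F x = 0) : msum s F = 0 := by
  rw [msum_congr h, msum_const_zero]

theorem msum_comm (s : Multiset α) (t : Multiset β) (F : α → β → M) :
    msum s (fun x => msum t (F x)) = msum t (fun y => msum s (fun x => F x y)) := by
  induction s using Multiset.induction_on with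
  | empty => simp [msum_const_zero]
  | cons a s ih => simp [ih, msum_add]

/-! ### Choosing at most one element of a multiset -/

section Pointed

variable [Zero α] [Zero β]

open Classical in
/-- All ways to choose at most one element of `s`, together with the remaining elements; the value
`0` stands for no choice. -/
noncomputable def pointed (s : Multiset α) : Multiset (α × Multiset α) :=
  (0, s) ::ₘ s.map fun x => (x, s.erase x)

@[simp] theorem pointed_zero : pointed (0 : Multiset α) = {(0, 0)} := by simp [pointed]

theorem pointed_cons (a : α) (s : Multiset α) :
    pointed (a ::ₘ s) = (a, s) ::ₘ (pointed s).map fun p => (p.1, a ::ₘ p.2) := by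
  classical
  simp only [pointed, map_cons, map_map, erase_cons_head, Function.comp_def]
  rw [cons_swap]
  congr 2
  refine map_congr rfl fun x hx => ?_
  -- If the chosen element equals the head, the two copies are interchangeable.
  by_cases h : x = a
  · subst h
    rw [erase_cons_head, cons_erase hx]
  · rw [erase_cons_tail _ (Ne.symm h)]

theorem eq_of_mem_pointed {s : Multiset α} {p : α × Multiset α} (h : p ∈ pointed s) :
    p.1 = 0 ∧ p.2 = s ∨ p.1 ::ₘ p.2 = s := by
  classical
  simp only [pointed, mem_cons, mem_map] at h
  rcases h with rfl | ⟨x, hx, rfl⟩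
  · simp
  · exact Or.inr (cons_erase hx)

@[simp] theorem msum_pointed_cons (a : α) (s : Multiset α) (F : α × Multiset α → M) :
    msum (pointed (a ::ₘ s)) F = F (a, s) + msum (pointed s) (fun p => F (p.1, a ::ₘ p.2)) := by
  rw [pointed_cons, msum_cons, msum_map]

/-- Two successive optional choices may be made in either order. This exchange law makes the
insertion steps of `parts` and of `matchings` commute, so that folding them over an unordered
multiset is legitimate. -/
theorem msum_pointed_comm (s : Multiset α) (F : α → α → Multiset α → M) :
    msum (pointed s) (fun p => msum (pointed p.2) fun q => F p.1 q.1 q.2) =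
      msum (pointed s) (fun p => msum (pointed p.2) fun q => F q.1 p.1 q.2) := by
  induction s using Multiset.induction_on generalizing F with
  | empty => simp
  | cons a s ih =>
    simp only [msum_pointed_cons, msum_add]
    rw [ih fun x y t => F x y (a ::ₘ t)]
    abel

theorem msum_pointed_map (g : α → β) (hg : g 0 = 0) (s : Multiset α) (F : β × Multiset β → M) :
    msum (pointed (s.map g)) F = msum (pointed s) fun p => F (g p.1, p.2.map g) := by
  induction s using Multiset.induction_on generalizing F with
  | empty => simp [hg]
  | cons a s ih => simp [ih]

end Pointed

/-! ### Partitions of a multiset -/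

/-- The partitions of a multiset into nonempty blocks. -/
noncomputable def parts (s : Multiset α) : Multiset (Multiset (Multiset α)) :=
  haveI : LeftCommutative fun (a : α) (P : Multiset (Multiset (Multiset α))) =>
      P.bind fun π => (pointed π).map fun p => (a ::ₘ p.1) ::ₘ p.2 := ⟨fun a b P => by
    simp only [bind_assoc, bind_map, pointed_cons, map_cons, map_map, Function.comp_def]
    refine bind_congr fun π _ => ?_
    simp only [bind_cons, cons_swap b a]
    congr 1
    -- Multisets are an additive monoid in which `msum` is `bind`, so the exchange law applies with
    -- singleton multisets as values. The choice `0` opens a new block for the inserted element.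
    have := msum_pointed_comm π fun x y t => ({(a ::ₘ y) ::ₘ (b ::ₘ x) ::ₘ t} : Multiset _)
    simp only [cons_swap (b ::ₘ _), ← bind_singleton]
    exact this⟩
  s.foldr (fun a P => P.bind fun π => (pointed π).map fun p => (a ::ₘ p.1) ::ₘ p.2) {0}

@[simp] theorem parts_zero : parts (0 : Multiset α) = {0} := rfl

theorem parts_cons' (a : α) (s : Multiset α) :
    parts (a ::ₘ s) = (parts s).bind fun π => (pointed π).map fun p => (a ::ₘ p.1) ::ₘ p.2 := by
  rw [parts, foldr_cons]; rfl

theorem msum_parts_cons' (a : α) (s : Multiset α) (F : Multiset (Multiset α) → M) :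
    msum (parts (a ::ₘ s)) F =
      msum (parts s) fun π => msum (pointed π) fun p => F ((a ::ₘ p.1) ::ₘ p.2) := by
  simp [parts_cons']

theorem msum_antidiagonal_cons (a : α) (s : Multiset α) (F : Multiset α × Multiset α → M) :
    msum (antidiagonal (a ::ₘ s)) F = msum (antidiagonal s) (fun p => F (p.1, a ::ₘ p.2)) +
      msum (antidiagonal s) fun p => F (a ::ₘ p.1, p.2) := by
  simp [antidiagonal_cons, Prod.map]

theorem msum_antidiagonal_add (s t : Multiset α) (F : Multiset α × Multiset α → M) :
    msum (antidiagonal (s + t)) F = msum (antidiagonal s) fun p =>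
      msum (antidiagonal t) fun q => F (p.1 + q.1, p.2 + q.2) := by
  simp [antidiagonal_add]

theorem msum_antidiagonal_map (g : α → β) (s : Multiset α) (F : Multiset β × Multiset β → M) :
    msum (antidiagonal (s.map g)) F =
      msum (antidiagonal s) fun p => F (p.1.map g, p.2.map g) := by
  induction s using Multiset.induction_on generalizing F with
  | empty => simp
  | cons a s ih => simp only [msum_antidiagonal_cons, Multiset.map_cons, ih]

/-- Both sides run over the colourings of the elements with three colours. -/
theorem msum_antidiagonal_assoc (s : Multiset α)
    (F : Multiset α → Multiset α → Multiset α → M) :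
    msum (antidiagonal s) (fun p => msum (antidiagonal p.1) fun q => F q.1 q.2 p.2) =
      msum (antidiagonal s) (fun p => msum (antidiagonal p.2) fun q => F p.1 q.1 q.2) := by
  induction s using Multiset.induction_on generalizing F with
  | empty => simp
  | cons a s ih =>
    have h1 := ih fun x y z => F (a ::ₘ x) y z
    have h2 := ih fun x y z => F x (a ::ₘ y) z
    have h3 := ih fun x y z => F x y (a ::ₘ z)
    simp only [msum_antidiagonal_cons, msum_add, h1, h2, h3]
    abel

theorem msum_antidiagonal_of_fst (s : Multiset α) (F : Multiset α × Multiset α → M)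
    (h : ∀ p, p.1 ≠ 0 → F p = 0) : msum (antidiagonal s) F = F (0, s) := by
  induction s using Multiset.induction_on generalizing F with
  | empty => simp
  | cons a s ih =>
    rw [msum_antidiagonal_cons, ih (fun p => F (p.1, a ::ₘ p.2)) fun p hp => h _ hp]
    rw [msum_eq_zero fun p _ => h _ (by simp), add_zero]

theorem msum_antidiagonal_of_snd (s : Multiset α) (F : Multiset α × Multiset α → M)
    (h : ∀ p, p.2 ≠ 0 → F p = 0) : msum (antidiagonal s) F = F (s, 0) := by
  induction s using Multiset.induction_on generalizing F with
  | empty => simp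
  | cons a s ih =>
    rw [msum_antidiagonal_cons, ih (fun p => F (a ::ₘ p.1, p.2)) fun p hp => h _ hp]
    rw [msum_eq_zero fun p _ => h _ (by simp), zero_add]

/-- A partition with at most one marked block is a submultiset, the possibly empty marked block,
with a partition of its complement. This converts insertion of one element into an existing
partition into the recursion on the block containing it, on which the later inductions run. -/
theorem msum_parts_pointed (s : Multiset α) (F : Multiset α → Multiset (Multiset α) → M) :
    msum (parts s) (fun π => msum (pointed π) fun p => F p.1 p.2) =
      msum (antidiagonal s) fun q => msum (parts q.2) fun π => F q.1 π := by
  induction s using Multiset.induction_on generalizing F with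
  | empty => simp
  | cons a s ih =>
    have h1 := ih fun x π => F (a ::ₘ x) π
    have h2 := ih fun y π => msum (pointed π) fun q => F y ((a ::ₘ q.1) ::ₘ q.2)
    simp only [msum_parts_cons', msum_antidiagonal_cons, msum_pointed_cons, msum_add]
    rw [h1, add_comm, ← h2]
    congr 1
    exact msum_congr fun π _ => msum_pointed_comm π fun x y t => F y ((a ::ₘ x) ::ₘ t)

/-- Here `a ::ₘ q.1` is the block containing `a`. -/
theorem msum_parts_cons (a : α) (s : Multiset α) (F : Multiset (Multiset α) → M) :
    msum (parts (a ::ₘ s)) F =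
      msum (antidiagonal s) fun q => msum (parts q.2) fun π => F ((a ::ₘ q.1) ::ₘ π) := by
  rw [msum_parts_cons', msum_parts_pointed s fun x π => F ((a ::ₘ x) ::ₘ π)]

theorem msum_parts_map (g : α → β) (s : Multiset α) (F : Multiset (Multiset β) → M) :
    msum (parts (s.map g)) F = msum (parts s) fun π => F (π.map (Multiset.map g)) := by
  induction s using Multiset.induction_on generalizing F with
  | empty => simp
  | cons a s ih =>
    simp only [Multiset.map_cons, msum_parts_cons', ih]
    refine msum_congr fun π _ => ?_
    rw [msum_pointed_map _ (by simp)]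

theorem sum_of_mem_parts {s : Multiset α} {π : Multiset (Multiset α)} (h : π ∈ parts s) :
    π.sum = s := by
  induction s using Multiset.induction_on generalizing π with
  | empty => simp_all
  | cons a s ih =>
    simp only [parts_cons', mem_bind, mem_map] at h
    obtain ⟨ρ, hρ, p, hp, rfl⟩ := h
    rcases eq_of_mem_pointed hp with ⟨h1, h2⟩ | h
    · simp [h1, h2, ih hρ]
    · rw [← ih hρ, ← h, sum_cons, sum_cons, cons_add]

theorem ne_zero_of_mem_parts {s : Multiset α} {π : Multiset (Multiset α)} (h : π ∈ parts s) :
    ∀ b ∈ π, b ≠ 0 := by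
  induction s using Multiset.induction_on generalizing π with
  | empty => simp_all
  | cons a s ih =>
    simp only [parts_cons', mem_bind, mem_map] at h
    obtain ⟨ρ, hρ, p, hp, rfl⟩ := h
    intro b hb
    rcases mem_cons.1 hb with rfl | hb
    · simp
    · rcases eq_of_mem_pointed hp with ⟨h1, h2⟩ | h
      · exact ih hρ b (h2 ▸ hb)
      · exact ih hρ b (h ▸ mem_cons_of_mem hb)

/-! ### Partial matchings between two multisets -/

section Matchings

variable [Zero β] [Zero γ]

/-- The partial matchings between two multisets, as multisets of pairs; unmatched elements are
paired with `0`. -/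
noncomputable def matchings (s : Multiset α) (t : Multiset β) [Zero α] :
    Multiset (Multiset (α × β)) :=
  -- The fold runs over functions of the second multiset: each left element takes a partner, or
  -- none, from what is still available, and the leftovers are paired with `0` at the end.
  haveI : LeftCommutative fun (a : α) (P : Multiset β → Multiset (Multiset (α × β)))
      (t : Multiset β) => (pointed t).bind fun p => (P p.2).map fun π => (a, p.1) ::ₘ π :=
    ⟨fun a b P => by
      funext t
      simp only [map_bind, map_map, Function.comp_def]
      have := msum_pointed_comm t fun x y t => (P t).map fun π => (a, x) ::ₘ (b, y) ::ₘ π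
      simp only [cons_swap (b, _)]
      exact this⟩
  s.foldr (fun a P t => (pointed t).bind fun p => (P p.2).map fun π => (a, p.1) ::ₘ π)
    (fun t => {t.map fun y => (0, y)}) t

variable [Zero α]

@[simp] theorem matchings_zero_left (t : Multiset β) :
    matchings (0 : Multiset α) t = {t.map fun y => (0, y)} := rfl

theorem matchings_cons (a : α) (s : Multiset α) (t : Multiset β) :
    matchings (a ::ₘ s) t =
      (pointed t).bind fun p => (matchings s p.2).map fun π => (a, p.1) ::ₘ π := by
  rw [matchings, foldr_cons]; rfl

theorem msum_matchings_cons (a : α) (s : Multiset α) (t : Multiset β)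
    (F : Multiset (α × β) → M) :
    msum (matchings (a ::ₘ s) t) F =
      msum (pointed t) fun p => msum (matchings s p.2) fun π => F ((a, p.1) ::ₘ π) := by
  simp [matchings_cons]

/-- The definition recurses on the left multiset, but the partner of a right element may also be
selected first: unless `a` and `b` are partners of each other, their choices concern different
multisets and are independent. -/
theorem msum_matchings_cons_right (s : Multiset α) (b : β) (t : Multiset β)
    (F : Multiset (α × β) → M) :
    msum (matchings s (b ::ₘ t)) F =
      msum (pointed s) fun p => msum (matchings p.2 t) fun π => F ((p.1, b) ::ₘ π) := by
  induction s using Multiset.induction_on generalizing t F with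
  | empty => simp
  | cons a s ih =>
    simp only [msum_matchings_cons, msum_pointed_cons, ih]
    congr 1
    rw [msum_comm]
    refine msum_congr fun p _ => msum_congr fun q _ => msum_congr fun π _ => ?_
    rw [cons_swap]

theorem matchings_zero_right (s : Multiset α) :
    matchings s (0 : Multiset β) = {s.map fun x => (x, 0)} := by
  induction s using Multiset.induction_on with
  | empty => simp
  | cons a s ih => simp [matchings_cons, ih]

theorem msum_matchings_map {α' β' : Type*} [Zero α'] [Zero β'] (f : α → α') (g : β → β')
    (hf : f 0 = 0) (hg : g 0 = 0) (s : Multiset α) (t : Multiset β)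
    (F : Multiset (α' × β') → M) :
    msum (matchings (s.map f) (t.map g)) F =
      msum (matchings s t) fun π => F (π.map (Prod.map f g)) := by
  induction s using Multiset.induction_on generalizing t F with
  | empty => simp [hf]
  | cons a s ih => simp [msum_matchings_cons, ih, msum_pointed_map g hg]

/-- Marking at most one pair of a matching amounts to marking at most one element on either side and
matching the rest; `(0, 0)` stands for no marked pair. -/
theorem msum_matchings_pointed (s : Multiset α) (t : Multiset β)
    (F : α × β → Multiset (α × β) → M) :
    msum (matchings s t) (fun π => msum (pointed π) fun p => F p.1 p.2) =
      msum (pointed s) fun p => msum (pointed t) fun q =>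
        msum (matchings p.2 q.2) fun π => F (p.1, q.1) π := by
  induction s using Multiset.induction_on generalizing t F with
  | empty =>
    simp only [matchings_zero_left, msum_singleton, pointed_zero]
    rw [msum_pointed_map (fun y => ((0 : α), y)) rfl]
  | cons a s ih =>
    simp only [msum_matchings_cons, msum_pointed_cons, msum_add]
    congr 1
    rw [msum_congr fun q _ => ih q.2 fun x π => F x ((a, q.1) ::ₘ π), msum_comm]
    refine msum_congr fun p _ => ?_
    exact msum_pointed_comm t fun x y t =>
      msum (matchings p.2 t) fun π => F (p.1, y) ((a, x) ::ₘ π)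

/-- Partial matchings between three multisets may be built in two ways. -/
theorem msum_matchings_assoc (s : Multiset α) (t : Multiset β) (w : Multiset γ)
    (F : Multiset (α × β × γ) → M) :
    msum (matchings s t) (fun π => msum (matchings π w) fun ρ =>
        F (ρ.map fun p => (p.1.1, p.1.2, p.2))) =
      msum (matchings t w) fun π => msum (matchings s π) F := by
  induction s using Multiset.induction_on generalizing t w F with
  | empty =>
    simp only [matchings_zero_left, msum_singleton]
    rw [← Multiset.map_id w, msum_matchings_map (fun y => ((0 : α), y)) id rfl rfl]
    simp
  | cons a s ih =>
    simp only [msum_matchings_cons, Multiset.map_cons]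
    -- On one side `a` takes a partner in `t` and the resulting pair one in `w`; on the other side
    -- `a` takes at most one pair of a matching of `t` and `w`, which is split into these two
    -- choices.
    rw [msum_matchings_pointed t w fun x π => msum (matchings s π) fun ρ => F ((a, x) ::ₘ ρ)]
    refine msum_congr fun p _ => ?_
    rw [msum_comm]
    refine msum_congr fun q _ => ?_
    exact ih p.2 q.2 fun ρ => F ((a, p.1, q.1) ::ₘ ρ)

end Matchings

/-- A partition of a disjoint union amounts to partitions of both parts and a partial matching
between their blocks. -/
theorem msum_parts_sum (s : Multiset α) (t : Multiset β)
    (F : Multiset (Multiset (α ⊕ β)) → M) :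
    msum (parts (s.map Sum.inl + t.map Sum.inr)) F =
      msum (parts s) fun π => msum (parts t) fun ρ => msum (matchings π ρ) fun μ =>
        F (μ.map fun p => p.1.map Sum.inl + p.2.map Sum.inr) := by
  -- The recursion on the block of `a` passes to an arbitrary complement, not to the tail, hence
  -- strong induction on the cardinality; the induction below serves only as a case distinction.
  induction hn : card s using Nat.strong_induction_on generalizing s t F with
  | _ n ih =>
  subst hn
  induction s using Multiset.induction_on with
  | empty => simp [msum_parts_map, Function.comp_def]
  | cons a s _ =>
    simp only [Multiset.map_cons, cons_add, msum_parts_cons, msum_antidiagonal_add,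
      msum_antidiagonal_map, msum_matchings_cons]
    refine msum_congr fun p hp => ?_
    -- The block of `a` in the union consists of a part of `s` and a part of `t`; the latter is the
    -- block of the partition of `t` matched with the former, or empty.
    have h := fun π => msum_parts_pointed t fun x ρ => msum (matchings π ρ) fun μ =>
      F (((a ::ₘ p.1, x) ::ₘ μ).map fun p => p.1.map Sum.inl + p.2.map Sum.inr)
    simp only [Multiset.map_cons, cons_add] at h
    simp only [h]
    rw [msum_comm]
    refine msum_congr fun q _ => ?_
    rw [ih (card p.2) _ p.2 q.2 _ rfl]
    rw [← mem_antidiagonal.1 hp]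
    simp only [card_cons, card_add]
    lia

end Combinatorics

/-! ### Symmetric functions of multisets and their composition along partitions -/

section Series

open Multiset

variable {α β γ A B : Type*} {M N : Type*} [AddCommMonoid M] [AddCommMonoid A] [AddCommMonoid B]

/-- `Ψ`, a function of multisets of vectors, is additive in each vector. -/
structure MultiAdditive (Ψ : Multiset A → M) : Prop where
  add : ∀ a b s, Ψ ((a + b) ::ₘ s) = Ψ (a ::ₘ s) + Ψ (b ::ₘ s)
  zero : ∀ s, Ψ (0 ::ₘ s) = 0

theorem MultiAdditive.msum_cons {Ψ : Multiset A → M} (h : MultiAdditive Ψ) (t : Multiset α)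
    (F : α → A) (s : Multiset A) : Ψ (msum t F ::ₘ s) = msum t fun x => Ψ (F x ::ₘ s) := by
  induction t using Multiset.induction_on with
  | empty => simp [h.zero]
  | cons a t ih => simp [h.add, ih]

theorem MultiAdditive.cons {Ψ : Multiset A → M} (h : MultiAdditive Ψ) (c : A) :
    MultiAdditive fun s => Ψ (c ::ₘ s) where
  add a b s := by simp only [cons_swap c, h.add]
  zero s := by simp only [cons_swap c, h.zero]

/-- The composite of two sequences of symmetric functions, the sum being over all partitions. -/
noncomputable def pcomp (Ψ : Multiset A → M) (Φ : Multiset α → A) (s : Multiset α) : M :=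
  msum (parts s) fun π => Ψ (π.map Φ)

@[simp] theorem pcomp_zero (Ψ : Multiset A → M) (Φ : Multiset α → A) : pcomp Ψ Φ 0 = Ψ 0 := by
  simp [pcomp]

/-- The value of the block containing `a` is absorbed into the outer function, which is why
inductions along this recursion keep the outer function general. -/
theorem pcomp_cons (Ψ : Multiset A → M) (Φ : Multiset α → A) (a : α) (s : Multiset α) :
    pcomp Ψ Φ (a ::ₘ s) =
      msum (antidiagonal s) fun p => pcomp (fun t => Ψ (Φ (a ::ₘ p.1) ::ₘ t)) Φ p.2 := by
  simp [pcomp, msum_parts_cons]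

theorem pcomp_msum (t : Multiset β) (Ψ : β → Multiset A → M) (Φ : Multiset α → A)
    (s : Multiset α) :
    pcomp (fun x => msum t fun y => Ψ y x) Φ s = msum t fun y => pcomp (Ψ y) Φ s :=
  msum_comm _ _ _

theorem msum_antidiagonal_left_comm (s : Multiset α)
    (F : Multiset α → Multiset α → Multiset α → M) :
    msum (antidiagonal s) (fun p => msum (antidiagonal p.2) fun q => F p.1 q.1 q.2) =
      msum (antidiagonal s) (fun p => msum (antidiagonal p.2) fun q => F q.1 p.1 q.2) := by
  induction s using Multiset.induction_on generalizing F with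
  | empty => simp
  | cons a s ih =>
    have h1 := ih fun x y z => F (a ::ₘ x) y z
    have h2 := ih fun x y z => F x (a ::ₘ y) z
    have h3 := ih fun x y z => F x y (a ::ₘ z)
    simp only [msum_antidiagonal_cons, msum_add, h1, h2, h3]
    abel

theorem card_snd_lt_of_mem_antidiagonal {a : α} {s : Multiset α} {p : Multiset α × Multiset α}
    (h : p ∈ antidiagonal s) : card p.2 < card (a ::ₘ s) := by
  rw [← mem_antidiagonal.1 h, card_cons, card_add]
  lia

/-- Colouring the blocks of a partition with two colours is the same as splitting the multiset in
two and partitioning both parts. -/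
theorem msum_parts_antidiagonal (s : Multiset α)
    (F : Multiset (Multiset α) × Multiset (Multiset α) → M) :
    msum (parts s) (fun π => msum (antidiagonal π) F) =
      msum (antidiagonal s) fun p => msum (parts p.1) fun π => msum (parts p.2) fun ρ =>
        F (π, ρ) := by
  induction hn : card s using Nat.strong_induction_on generalizing s F with
  | _ n ih =>
  subst hn
  induction s using Multiset.induction_on with
  | empty => simp
  | cons a s _ =>
    have h : ∀ p ∈ antidiagonal s, ∀ F : Multiset (Multiset α) × Multiset (Multiset α) → M,
        msum (parts p.2) (fun π => msum (antidiagonal π) F) =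
          msum (antidiagonal p.2) fun p => msum (parts p.1) fun π => msum (parts p.2) fun ρ =>
            F (π, ρ) :=
      fun p hp F => ih _ (card_snd_lt_of_mem_antidiagonal hp) _ _ rfl
    simp only [msum_parts_cons, msum_antidiagonal_cons, msum_add]
    rw [msum_congr fun p hp => h p hp fun q => F (q.1, (a ::ₘ p.1) ::ₘ q.2),
      msum_congr fun p hp => h p hp fun q => F ((a ::ₘ p.1) ::ₘ q.1, q.2)]
    congr 1
    · rw [msum_antidiagonal_left_comm s fun x y z => msum (parts y) fun π =>
        msum (parts z) fun ρ => F (π, (a ::ₘ x) ::ₘ ρ)]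
      exact msum_congr fun p _ => msum_comm _ _ _
    · rw [← msum_antidiagonal_assoc s fun x y z => msum (parts y) fun π =>
        msum (parts z) fun ρ => F ((a ::ₘ x) ::ₘ π, ρ)]

/-- Composition is associative. -/
theorem pcomp_assoc {Ω : Multiset B → M} (hΩ : MultiAdditive Ω) (Ψ : Multiset A → B)
    (Φ : Multiset α → A) (s : Multiset α) :
    pcomp Ω (pcomp Ψ Φ) s = pcomp (pcomp Ω Ψ) Φ s := by
  induction hn : card s using Nat.strong_induction_on generalizing s Ω with
  | _ n ih =>
  subst hn
  induction s using Multiset.induction_on with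
  | empty => simp
  | cons a s _ =>
    have h : ∀ p ∈ antidiagonal s, ∀ c, pcomp (fun t => Ω (c ::ₘ t)) (pcomp Ψ Φ) p.2 =
        pcomp (pcomp (fun t => Ω (c ::ₘ t)) Ψ) Φ p.2 :=
      fun p hp c => ih _ (card_snd_lt_of_mem_antidiagonal hp) (hΩ.cons c) _ rfl
    rw [pcomp_cons, pcomp_cons, msum_congr fun p hp => h p hp (pcomp Ψ Φ (a ::ₘ p.1))]
    -- On the right, the inner block of `a` is `a ::ₘ x`. The further inner blocks lying in the same
    -- outer block form a partition `σ` of a part of the remaining elements, and the rest is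
    -- composed recursively.
    have h1 : ∀ (x : Multiset α) (q : Multiset α),
        pcomp (fun t => pcomp Ω Ψ (Φ (a ::ₘ x) ::ₘ t)) Φ q =
          msum (antidiagonal q) fun p => msum (parts p.1) fun σ =>
            pcomp (pcomp (fun t => Ω (Ψ (Φ (a ::ₘ x) ::ₘ σ.map Φ) ::ₘ t)) Ψ) Φ p.2 := by
      intro x q
      simp only [pcomp_cons]
      rw [pcomp]
      simp only [msum_antidiagonal_map]
      rw [msum_parts_antidiagonal q fun p =>
        pcomp (fun t => Ω (Ψ (Φ (a ::ₘ x) ::ₘ p.1.map Φ) ::ₘ t)) Ψ (p.2.map Φ)]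
      rfl
    simp only [h1]
    rw [← msum_antidiagonal_assoc s fun x y z =>
      msum (parts y) fun σ =>
        pcomp (pcomp (fun t => Ω (Ψ (Φ (a ::ₘ x) ::ₘ σ.map Φ) ::ₘ t)) Ψ) Φ z]
    refine msum_congr fun p _ => ?_
    -- On the left, the outer block of `a` comes first; additivity of `Ω` pulls out the sum over the
    -- partitions of that block.
    have h2 : ∀ t, Ω (pcomp Ψ Φ (a ::ₘ p.1) ::ₘ t) = msum (antidiagonal p.1) fun q =>
        msum (parts q.2) fun σ => Ω (Ψ (Φ (a ::ₘ q.1) ::ₘ σ.map Φ) ::ₘ t) := by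
      intro t
      rw [pcomp, hΩ.msum_cons, msum_parts_cons]
      simp only [Multiset.map_cons]
    have h3 : pcomp (fun t => Ω (pcomp Ψ Φ (a ::ₘ p.1) ::ₘ t)) Ψ = fun t =>
        msum (antidiagonal p.1) fun q => msum (parts q.2) fun σ =>
          pcomp (fun t => Ω (Ψ (Φ (a ::ₘ q.1) ::ₘ σ.map Φ) ::ₘ t)) Ψ t := by
      funext t
      simp only [h2, pcomp_msum]
    rw [h3]
    simp only [pcomp_msum]

/-- The varied element lies in exactly one block of every partition, so additivity of the inner
function at that block and of the outer one at its value suffice. -/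
theorem MultiAdditive.pcomp {Ψ : Multiset A → M} {Φ : Multiset B → A} (h : MultiAdditive Ψ)
    (h' : MultiAdditive Φ) : MultiAdditive (pcomp Ψ Φ) where
  add a b s := by
    simp only [pcomp_cons, h'.add, ← msum_add]
    refine msum_congr fun p _ => ?_
    simp only [FaaRes.pcomp, h.add, msum_add]
  zero s := by
    simp only [pcomp_cons, h'.zero]
    refine msum_eq_zero fun p _ => ?_
    simp only [FaaRes.pcomp, h.zero, msum_const_zero]

/-- A sequence with at most its first component `k` different from zero. -/
structure IsLin (Φ : Multiset α → A) (k : α → A) : Prop where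
  single : ∀ a, Φ {a} = k a
  other : ∀ s, card s ≠ 1 → Φ s = 0

theorem IsLin.ext {Φ Ψ : Multiset α → A} {k : α → A} (h : IsLin Φ k) (h' : IsLin Ψ k) :
    Φ = Ψ := by
  funext s
  by_cases hs : card s = 1
  · obtain ⟨a, rfl⟩ := card_eq_one.1 hs
    rw [h.single, h'.single]
  · rw [h.other _ hs, h'.other _ hs]

/-- Only the partition into singletons survives: any larger block has value zero, which `Ω`
annihilates. -/
theorem pcomp_of_isLin_right {Ω : Multiset A → M} (hΩ : ∀ s, Ω (0 ::ₘ s) = 0)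
    {Φ : Multiset α → A} {k : α → A} (hΦ : IsLin Φ k) (s : Multiset α) :
    pcomp Ω Φ s = Ω (s.map k) := by
  induction s using Multiset.induction_on generalizing Ω with
  | empty => simp
  | cons a s ih =>
    rw [pcomp_cons, msum_antidiagonal_of_fst]
    · have h1 : ∀ a, Φ (a ::ₘ 0) = k a := hΦ.single
      rw [h1, ih]
      · simp
      · intro s
        rw [cons_swap, hΩ]
    · intro p hp
      rw [hΦ.other]
      · exact msum_eq_zero fun π _ => hΩ _
      · simpa using hp

/-- Only the partition with one block survives. The empty multiset has no such partition and must be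
excluded: there the left side is `Ω 0`, unrelated to `k (Φ 0)`. -/
theorem pcomp_of_isLin_left {Ω : Multiset A → M} {k : A → M} (hΩ : IsLin Ω k)
    (Φ : Multiset α → A) {s : Multiset α} (hs : s ≠ 0) : pcomp Ω Φ s = k (Φ s) := by
  induction s using Multiset.induction_on with
  | empty => exact absurd rfl hs
  | cons a s _ =>
    rw [pcomp_cons, msum_antidiagonal_of_snd]
    · rw [pcomp_zero]
      exact hΩ.single _
    · rintro ⟨x, y⟩ hp
      refine msum_eq_zero fun π hπ => hΩ.other _ ?_
      have : π ≠ 0 := by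
        rintro rfl
        exact hp (sum_of_mem_parts hπ).symm
      simpa using this

/-! ### Sums over partial matchings -/

/-- `u` vanishes on all pairs with an entry of more than one element. -/
def IsGrid (u : Multiset α × Multiset β → A) : Prop :=
  ∀ p, 1 < card p.1 ∨ 1 < card p.2 → u p = 0

/-- The sum of `Φ` over the partial matchings of `s` and `t`, where `u` tells what to insert for
each pair. -/
noncomputable def gridSum (Φ : Multiset A → M) (u : Multiset α × Multiset β → A)
    (s : Multiset α) (t : Multiset β) : M :=
  msum (matchings (s.map singleton) (t.map singleton)) fun μ => Φ (μ.map u)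

theorem msum_parts_of_card (s : Multiset α) (G : Multiset (Multiset α) → M)
    (h : ∀ b π, 1 < card b → G (b ::ₘ π) = 0) : msum (parts s) G = G (s.map singleton) := by
  induction s using Multiset.induction_on generalizing G with
  | empty => simp
  | cons a s ih =>
    rw [msum_parts_cons, msum_antidiagonal_of_fst]
    · rw [ih]
      · simp
      · intro b π hb
        rw [cons_swap, h _ _ hb]
    · intro p hp
      refine msum_eq_zero fun π _ => h _ _ ?_
      rw [card_cons]
      have := card_pos.2 hp
      lia

/-! ### Comparison with sums over index types -/

theorem univ_val_map_succ {n : ℕ} (f : Fin (n + 1) → α) :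
    (Finset.univ : Finset (Fin (n + 1))).val.map f =
      f 0 ::ₘ (Finset.univ : Finset (Fin n)).val.map fun i => f i.succ := by
  simp only [Fin.univ_val_map, List.ofFn_succ, ← cons_coe]

theorem val_map_erase [DecidableEq α] [DecidableEq γ] (s : Finset α) (f : α → γ) {a : α}
    (ha : a ∈ s) : (s.val.map f).erase (f a) = (s.erase a).val.map f := by
  have h : s.val = a ::ₘ (s.erase a).val := by
    rw [Finset.erase_val, cons_erase ha]
  rw [h, Multiset.map_cons, erase_cons_head]

theorem msum_pointed_val_map [Zero γ] [DecidableEq α] (s : Finset α) (f : α → γ)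
    (F : γ × Multiset γ → M) :
    msum (pointed (s.val.map f)) F =
      F (0, s.val.map f) + ∑ a ∈ s, F (f a, (s.erase a).val.map f) := by
  classical
  rw [pointed, msum_cons, msum_map, msum_map]
  congr 1
  exact msum_congr fun a ha => by rw [← val_map_erase s f ha]

theorem univ_val_map_update {n : ℕ} (f : Fin n → γ) (k : Fin n) (y : γ) :
    (Finset.univ : Finset (Fin n)).val.map (Function.update f k y) =
      y ::ₘ (Finset.univ.erase k).val.map f := by
  have h : (Finset.univ : Finset (Fin n)).val = k ::ₘ (Finset.univ.erase k).val := by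
    rw [Finset.erase_val, cons_erase (Finset.mem_univ k)]
  rw [h, Multiset.map_cons, Function.update_self]
  congr 1
  refine map_congr rfl fun i hi => ?_
  have hi' : i ∈ Finset.univ.erase k := hi
  rw [Function.update_of_ne (Finset.ne_of_mem_erase hi')]

theorem univ_val_map_cast {m n : ℕ} (h : m = n) (f : Fin n → γ) :
    (Finset.univ : Finset (Fin m)).val.map (fun i => f (Fin.cast h i)) =
      (Finset.univ : Finset (Fin n)).val.map f := by
  subst h; rfl

/-- The blocks of an ordered partition, as multisets of the entries `a j`. -/
def blocks {n : ℕ} (a : Fin n → α) (c : OrderedFinpartition n) : Multiset (Multiset α) :=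
  Finset.univ.val.map fun i => Finset.univ.val.map fun j => a (c.emb i j)

theorem blocks_extendLeft {n : ℕ} (a : Fin (n + 1) → α) (c : OrderedFinpartition n) :
    blocks a c.extendLeft = {a 0} ::ₘ blocks (fun i => a i.succ) c := by
  unfold blocks
  refine (univ_val_map_succ (n := c.length) fun i => Finset.univ.val.map
    fun j => a (c.extendLeft.emb i j)).trans ?_
  rfl

/-- The part `k` grows by one, so part sizes agree only propositionally; `univ_val_map_cast` absorbs
the casts. -/
theorem blocks_extendMiddle {n : ℕ} (a : Fin (n + 1) → α) (c : OrderedFinpartition n)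
    (k : Fin c.length) :
    blocks a (c.extendMiddle k) = (a 0 ::ₘ Finset.univ.val.map fun j => a (c.emb k j).succ) ::ₘ
      (Finset.univ.erase k).val.map fun i => Finset.univ.val.map fun j => a (c.emb i j).succ := by
  rw [← univ_val_map_update]
  refine Multiset.map_congr rfl fun (i : Fin c.length) _ => ?_
  by_cases h : i = k
  · have e : (c.extendMiddle k).partSize k = c.partSize k + 1 := by simp
    rw [h, Function.update_self]
    have := univ_val_map_cast e fun j =>
      a (Fin.cases (motive := fun _ => Fin (n + 1)) 0 (Fin.succ ∘ c.emb k) j)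
    rw [univ_val_map_succ] at this
    simp only [Fin.cases_zero, Fin.cases_succ, Function.comp_apply] at this
    refine Eq.trans (Multiset.map_congr rfl fun j _ => ?_) this
    simp only [OrderedFinpartition.extendMiddle, ↓reduceDIte]
    rfl
  · have e : (c.extendMiddle k).partSize i = c.partSize i := by simp [h]
    rw [Function.update_of_ne h]
    refine Eq.trans ?_ (univ_val_map_cast e fun j => a (c.emb i j).succ)
    refine Multiset.map_congr rfl fun j _ => ?_
    simp only [OrderedFinpartition.extendMiddle, h, ↓reduceDIte]
    rfl

/-- A sum over ordered partitions of `{0, …, n - 1}` as a sum over partitions of a multiset. -/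
theorem sum_orderedFinpartition {n : ℕ} (a : Fin n → α) (F : Multiset (Multiset α) → M) :
    ∑ c : OrderedFinpartition n, F (blocks a c) = msum (parts (Finset.univ.val.map a)) F := by
  induction n generalizing F with
  | zero =>
    rw [Fintype.sum_unique]
    rw [show blocks a (default : OrderedFinpartition 0) = 0 from rfl]
    simp
  | succ n ih =>
    -- `extendEquiv` encodes an ordered partition of `n + 1` indices by one of `n` indices and an
    -- optional block receiving the new index, which is the insertion recursion of `parts`; `none`
    -- corresponds to the choice `0` of `pointed`.
    rw [univ_val_map_succ, msum_parts_cons', ← ih,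
      ← (OrderedFinpartition.extendEquiv n).sum_comp, Fintype.sum_sigma]
    refine Finset.sum_congr rfl fun c _ => ?_
    rw [Fintype.sum_option]
    have h := msum_pointed_val_map (Finset.univ : Finset (Fin c.length))
      (fun i => Finset.univ.val.map fun j => a (c.emb i j).succ) fun p => F ((a 0 ::ₘ p.1) ::ₘ p.2)
    refine Eq.trans ?_ h.symm
    congr 1
    · exact congrArg F (blocks_extendLeft a c)
    · exact Finset.sum_congr rfl fun k _ => congrArg F (blocks_extendMiddle a c k)

/-- A sum over partial injections, as a sum over partial matchings. -/
theorem sum_partialInjections [Zero α] [Zero β] {r s : ℕ} (a : Fin r → α) (b : Fin s → β)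
    (S : Finset (Fin s)) (F : Multiset (α × β) → M) :
    (∑ φ : Fin r → Option (Fin s), open Classical in
      if (∀ i i' j, φ i = some j → φ i' = some j → i = i') ∧ (∀ i j, φ i = some j → j ∈ S) then
        F (Finset.univ.val.map (fun i => (a i, (φ i).elim 0 b)) +
          (S.filter fun j => ∀ i, φ i ≠ some j).val.map fun j => (0, b j)) else 0) =
      msum (matchings (Finset.univ.val.map a) (S.val.map b)) F := by
  classical
  -- `S` is the set of right indices still free. Once the first left index is matched to `j`, the
  -- induction continues with `S.erase j`.
  induction r generalizing S F with
  | zero => simp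
  | succ r ih =>
    rw [univ_val_map_succ, msum_matchings_cons, msum_pointed_val_map,
      ← (Fin.consEquiv fun _ => Option (Fin s)).sum_comp, Fintype.sum_prod_type,
      Fintype.sum_option]
    simp only [← ih]
    congr 1
    · refine Finset.sum_congr rfl fun φ _ => ?_
      rw [univ_val_map_succ]
      simp [Fin.consEquiv, Fin.forall_fin_succ, -Fin.univ_val_map]
    · rw [← Finset.sum_subset (Finset.subset_univ S)]
      · refine Finset.sum_congr rfl fun j hj => Finset.sum_congr rfl fun φ _ => ?_
        have h1 : ((∀ i i' k, (Fin.consEquiv fun _ => Option (Fin s)) (some j, φ) i = some k →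
            (Fin.consEquiv fun _ => Option (Fin s)) (some j, φ) i' = some k → i = i') ∧
            ∀ i k, (Fin.consEquiv fun _ => Option (Fin s)) (some j, φ) i = some k → k ∈ S) ↔
            ((∀ i i' k, φ i = some k → φ i' = some k → i = i') ∧
              ∀ i k, φ i = some k → k ∈ S.erase j) := by
          simp only [Fin.consEquiv, Equiv.coe_fn_mk, Fin.forall_fin_succ, Fin.cons_zero,
            Fin.cons_succ, Option.some.injEq, Finset.mem_erase]
          grind
        refine if_congr h1 ?_ rfl
        rw [univ_val_map_succ, cons_add]
        congr 2
        refine congrArg₂ (· + ·) rfl (congrArg (fun U : Finset (Fin s) => U.val.map _) (Finset.ext fun k => ?_))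
        simp only [Fin.consEquiv, Equiv.coe_fn_mk, Fin.forall_fin_succ, Fin.cons_zero,
            Fin.cons_succ, Finset.mem_erase, Finset.mem_filter]
        grind
      · intro j _ hj
        refine Finset.sum_eq_zero fun φ _ => if_neg fun h => hj (h.2 0 j rfl)

end Series

open CRStruct IsCartesianRestriction
-- Equal multisets of values mean fibres of equal size, and bijections between the fibres assemble
-- to a permutation.
theorem exists_perm_of_map_eq {α : Type*} {n : ℕ} {a b : Fin n → α}
    (h : (Finset.univ : Finset (Fin n)).val.map a = (Finset.univ : Finset (Fin n)).val.map b) :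
    ∃ σ : Equiv.Perm (Fin n), ∀ i, a (σ i) = b i := by
  classical
  have key : ∀ y, Fintype.card {i // b i = y} = Fintype.card {i // a i = y} := fun y => by
    have := congrArg (Multiset.count y) h
    rw [Multiset.count_map, Multiset.count_map] at this
    rw [Fintype.card_subtype, Fintype.card_subtype]
    simp only [eq_comm (a := y)] at this
    exact this.symm
  have e : ∀ y, {i // b i = y} ≃ {i // a i = y} := fun y =>
    Classical.choice (Fintype.card_eq.1 (key y))
  exact ⟨Equiv.ofFiberEquiv e, fun i => Equiv.ofFiberEquiv_map e i⟩

/-! ### Restrictions and tuples of partial maps -/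

section Restriction

variable {C : Type u} [CartRest.{v} C]

theorem rst_id (X : C) : rst (𝟙 X) = 𝟙 X := by simpa using rst_comp_self (𝟙 X)

theorem rst_comp_rst {X Y Z : C} (f : X ⟶ Y) (g : Y ⟶ Z) : rst (f ≫ rst g) = rst (f ≫ g) := by
  rw [comp_rst, rst_rst_comp]
  rw [rst_comm, ← rst_rst_comp, ← Category.assoc, rst_comp_self]

theorem rst_comp_rst_left {X Y Z : C} (f : X ⟶ Y) (g : Y ⟶ Z) :
    rst (f ≫ g) ≫ rst f = rst (f ≫ g) := by
  rw [rst_comm, ← rst_rst_comp, ← Category.assoc, rst_comp_self]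

/-- Antisymmetry of the restriction order: each of the two maps is a restriction of the other. -/
theorem eq_of_rst_comp_eq {X Y : C} {f g : X ⟶ Y} (h1 : rst f ≫ g = f) (h2 : rst g ≫ f = g) :
    f = g := by
  calc f = rst f ≫ rst g ≫ f := by rw [h2, h1]
    _ = rst g ≫ f := by rw [← Category.assoc, rst_comm, Category.assoc, rst_comp_self]
    _ = g := h2

theorem lift_fst_snd (X Y : C) : lift (fst X Y) (snd X Y) = 𝟙 _ := by
  symm
  apply lift_unique
  · rw [rst_snd]
  · rw [rst_fst]

theorem lift_eta {T X Y : C} (f : T ⟶ prod X Y) : lift (f ≫ fst X Y) (f ≫ snd X Y) = f := by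
  rw [← comp_lift, lift_fst_snd, Category.comp_id]

theorem comp_tuple {S T A X : C} (k : S ⟶ T) {n : ℕ} (a : Fin n → (T ⟶ A)) (x : T ⟶ X) :
    k ≫ tuple a x = tuple (fun i => k ≫ a i) (k ≫ x) := by
  induction n with
  | zero => rfl
  | succ n ih => exact (comp_lift k _ _).trans (congrArg (lift (k ≫ a 0)) (ih _))

theorem rst_proj (A X : C) (n : ℕ) (i : Fin n) : rst (proj A X n i) = 𝟙 _ := by
  induction n with
  | zero => exact i.elim0
  | succ n ih =>
    refine Fin.cases (rst_fst _ _) (fun j => ?_) i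
    change rst (snd A (pow A X n) ≫ proj A X n j) = _
    exact (rst_total_comp _ _ (ih j)).trans (rst_snd _ _)

theorem rst_last (A X : C) (n : ℕ) : rst (last A X n) = 𝟙 _ := by
  induction n with
  | zero => exact rst_id _
  | succ n ih => exact (rst_total_comp _ _ ih).trans (rst_snd _ _)

theorem tuple_proj_last (A X : C) (n : ℕ) : tuple (proj A X n) (last A X n) = 𝟙 _ := by
  induction n with
  | zero => rfl
  | succ n ih =>
    have h : tuple (proj A X (n + 1)) (last A X (n + 1)) =
        lift (fst A (pow A X n)) (tuple (fun i => snd A (pow A X n) ≫ proj A X n i)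
          (snd A (pow A X n) ≫ last A X n)) := rfl
    rw [h, ← comp_tuple, ih, Category.comp_id]
    exact lift_fst_snd _ _

theorem rst_tuple_comp_self {T A X : C} {n : ℕ} (a : Fin n → (T ⟶ A)) (x : T ⟶ X) :
    rst (tuple a x) ≫ rst x = rst (tuple a x) := by
  induction n with
  | zero => exact FaaRes.rst_idem _
  | succ n ih =>
    have h : rst (tuple a x) = rst (a 0) ≫ rst (tuple (fun i => a i.succ) x) := rst_lift _ _
    rw [h, Category.assoc, ih]

theorem rst_tuple_comp {T A X : C} {n : ℕ} (a : Fin n → (T ⟶ A)) (x : T ⟶ X) (i : Fin n) :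
    rst (tuple a x) ≫ rst (a i) = rst (tuple a x) := by
  induction n with
  | zero => exact i.elim0
  | succ n ih =>
    have h : rst (tuple a x) = rst (a 0) ≫ rst (tuple (fun i => a i.succ) x) := rst_lift _ _
    rw [h, Category.assoc]
    refine Fin.cases ?_ (fun j => ?_) i
    · rw [rst_comm, ← Category.assoc, FaaRes.rst_idem]
    · rw [ih (fun i => a i.succ) j]

theorem tuple_last {T A X : C} {n : ℕ} (a : Fin n → (T ⟶ A)) (x : T ⟶ X) :
    tuple a x ≫ last A X n = rst (tuple a x) ≫ x := by
  induction n with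
  | zero => exact (Category.comp_id _).trans (rst_comp_self x).symm
  | succ n ih =>
    have h : rst (tuple a x) = rst (a 0) ≫ rst (tuple (fun i => a i.succ) x) := rst_lift _ _
    have h' : tuple a x ≫ last A X (n + 1) = (lift (a 0) (tuple (fun i => a i.succ) x) ≫
      snd A (pow A X n)) ≫ last A X n := (Category.assoc _ _ _).symm
    rw [h, h', lift_snd, Category.assoc, ih, Category.assoc]

theorem tuple_proj {T A X : C} {n : ℕ} (a : Fin n → (T ⟶ A)) (x : T ⟶ X) (i : Fin n) :
    tuple a x ≫ proj A X n i = rst (tuple a x) ≫ a i := by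
  induction n with
  | zero => exact i.elim0
  | succ n ih =>
    have h : rst (tuple a x) = rst (a 0) ≫ rst (tuple (fun i => a i.succ) x) := rst_lift _ _
    rw [h]
    refine Fin.cases ?_ (fun j => ?_) i
    · refine (lift_fst (a 0) (tuple (fun i => a i.succ) x)).trans ?_
      rw [rst_comm, Category.assoc, rst_comp_self]
    · have h' : tuple a x ≫ proj A X (n + 1) j.succ = (lift (a 0) (tuple (fun i => a i.succ) x) ≫
        snd A (pow A X n)) ≫ proj A X n j := (Category.assoc _ _ _).symm
      rw [h', lift_snd, Category.assoc, ih (fun i => a i.succ) j, Category.assoc]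

theorem rst_tuple {T A X : C} {n : ℕ} {a : Fin n → (T ⟶ A)} {x : T ⟶ X} {e : T ⟶ T}
    (ha : ∀ i, rst (a i) = e) (hx : rst x = e) : rst (tuple a x) = e := by
  induction n with
  | zero => exact hx
  | succ n ih =>
    have h : rst (tuple a x) = rst (a 0) ≫ rst (tuple (fun i => a i.succ) x) := rst_lift _ _
    rw [h, ih fun i => ha _, ha, ← hx, FaaRes.rst_idem]

/-- The domain of `h` is determined by the last coordinate, as it is for components of morphisms of
`Faà(C)`; beyond the domains of the entries, the vectors therefore impose no condition. -/
theorem rst_tuple_comp_of_rst {T A X Y B : C} {n : ℕ} (a : Fin n → (T ⟶ A)) (x : T ⟶ X)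
    {h : pow A X n ⟶ B} {k : X ⟶ Y} (hk : rst h = rst (last A X n ≫ k)) :
    rst (tuple a x ≫ h) = rst (tuple a x) ≫ rst (x ≫ k) := by
  rw [← rst_comp_rst, hk, rst_comp_rst, ← Category.assoc, tuple_last, Category.assoc,
    rst_rst_comp]

theorem rst_rst_comp_of {T X Y : C} {h : T ⟶ Y} {a : T ⟶ X} (H : rst h ≫ rst a = rst h) :
    rst (rst h ≫ a) = rst h := by rw [rst_rst_comp, H]

theorem TotalCommMon.comp_add {S T : C} (A : TotalCommMon C) (k : S ⟶ T) (f g : T ⟶ A.carrier) :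
    k ≫ (f + g) = k ≫ f + k ≫ g := by
  rw [A.hom_add_def, A.hom_add_def, ← Category.assoc, comp_lift]

theorem TotalCommMon.comp_zero {S T : C} (A : TotalCommMon C) (k : S ⟶ T) :
    k ≫ (0 : T ⟶ A.carrier) = rst k ≫ 0 := by
  rw [A.hom_zero_def, A.hom_zero_def, ← Category.assoc, comp_bang, Category.assoc]

theorem TotalCommMon.rst_add {T : C} (A : TotalCommMon C) (f g : T ⟶ A.carrier) :
    rst (f + g) = rst f ≫ rst g := by
  rw [A.hom_add_def, rst_total_comp _ _ A.isMon.rst_add, rst_lift]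

theorem TotalCommMon.rst_zero (A : TotalCommMon C) (T : C) :
    rst (0 : T ⟶ A.carrier) = 𝟙 T := by
  rw [A.hom_zero_def, rst_total_comp _ _ A.isMon.rst_zero, rst_bang]

end Restriction

/-! ### Vectors over a stage -/

section Stage

variable {C : Type u} [CartRest.{v} C]

variable (C) in
/-- An object together with a restriction idempotent on it. -/
structure Stage where
  obj : C
  idem : obj ⟶ obj
  rst_idem : rst idem = idem

/-- The maps into `A` whose domain of definition is given by the idempotent of `s`. -/
@[ext]
structure Stage.Vec (s : Stage C) (A : TotalCommMon C) where
  val : s.obj ⟶ A.carrier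
  rst_val : rst val = s.idem

theorem Stage.idem_comp (s : Stage C) {Y : C} {f : s.obj ⟶ Y} (h : rst f = s.idem) :
    s.idem ≫ f = f := by
  rw [← h, rst_comp_self]

theorem Stage.idem_idem (s : Stage C) : s.idem ≫ s.idem = s.idem := s.idem_comp s.rst_idem

namespace Stage

variable (s : Stage C) (A : TotalCommMon C)

/-- Zero is cut down to the stage. With this zero, the weak zero law for partial additive maps
becomes an honest equation. -/
instance : Zero (s.Vec A) :=
  ⟨⟨s.idem ≫ 0, by rw [rst_total_comp _ _ (A.rst_zero _), s.rst_idem]⟩⟩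

instance : Add (s.Vec A) :=
  ⟨fun a b => ⟨a.1 + b.1, by rw [A.rst_add, a.rst_val, b.rst_val, s.idem_idem]⟩⟩

variable {s A}

theorem Vec.val_add (a b : s.Vec A) : (a + b).val = a.val + b.val := rfl

theorem Vec.val_zero : (0 : s.Vec A).val = s.idem ≫ 0 := rfl

theorem Vec.idem_comp (a : s.Vec A) : s.idem ≫ a.val = a.val := s.idem_comp a.rst_val

theorem Vec.add_comm (a b : s.Vec A) : a + b = b + a := Vec.ext (_root_.add_comm a.val b.val)

theorem Vec.zero_add (a : s.Vec A) : 0 + a = a := by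
  apply Vec.ext
  have h : s.idem ≫ a.val = a.val := a.idem_comp
  rw [Vec.val_add, Vec.val_zero, A.hom_add_def, ← s.rst_idem, rst_lift_left, ← rst_lift_right,
    s.rst_idem, h, ← A.hom_add_def, _root_.zero_add]

instance : AddCommMonoid (s.Vec A) where
  zero_add := Vec.zero_add
  add_zero a := by rw [Vec.add_comm, Vec.zero_add]
  add_assoc a b c := Vec.ext (_root_.add_assoc _ _ _)
  add_comm := Vec.add_comm
  nsmul := nsmulRec

end Stage

/-- A total map preserving the monoid structures. -/
structure IsMonHom (A B : TotalCommMon C) (k : A.carrier ⟶ B.carrier) : Prop where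
  total : rst k = 𝟙 _
  map_add : ∀ {T : C} (a b : T ⟶ A.carrier), (a + b) ≫ k = a ≫ k + b ≫ k
  map_zero : ∀ T : C, (0 : T ⟶ A.carrier) ≫ k = 0

def Stage.Vec.map {s : Stage C} {A B : TotalCommMon C} {k : A.carrier ⟶ B.carrier}
    (hk : IsMonHom A B k) (a : s.Vec A) : s.Vec B :=
  ⟨a.val ≫ k, by rw [rst_total_comp _ _ hk.total, a.rst_val]⟩

theorem Stage.Vec.map_add {s : Stage C} {A B : TotalCommMon C} {k : A.carrier ⟶ B.carrier}
    (hk : IsMonHom A B k) (a b : s.Vec A) : (a + b).map hk = a.map hk + b.map hk :=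
  Stage.Vec.ext (hk.map_add _ _)

theorem Stage.Vec.map_zero {s : Stage C} {A B : TotalCommMon C} {k : A.carrier ⟶ B.carrier}
    (hk : IsMonHom A B k) : (0 : s.Vec A).map hk = 0 := by
  apply Stage.Vec.ext
  change (s.idem ≫ 0) ≫ k = s.idem ≫ 0
  rw [Category.assoc, hk.map_zero]

/-- Additivity and symmetry may be checked over stages. -/
theorem additive_symm_of_stage {A B : TotalCommMon C} {X Y : C} {n : ℕ}
    {h : pow A.carrier X n ⟶ B.carrier} {k : X ⟶ Y} (hk : rst h = rst (last A.carrier X n ≫ k))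
    (H : ∀ (s : Stage C) (x : s.obj ⟶ X), rst x = s.idem → rst (x ≫ k) = s.idem →
      ∃ Φ : Multiset (s.Vec A) → s.Vec B, MultiAdditive Φ ∧ ∀ a : Fin n → s.Vec A,
        tuple (fun i => (a i).val) x ≫ h = (Φ (Finset.univ.val.map a)).val) :
    IsAdditive A X B n h ∧ IsSymm A.carrier X B.carrier n h := by
  have R : ∀ {T : C} (a : Fin n → (T ⟶ A.carrier)) (x : T ⟶ X),
      rst (tuple a x ≫ h) = rst (tuple a x) ≫ rst (x ≫ k) := fun a x =>
    rst_tuple_comp_of_rst a x hk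
  have Rx : ∀ {T : C} (a : Fin n → (T ⟶ A.carrier)) (x : T ⟶ X),
      rst (tuple a x ≫ h) ≫ rst x = rst (tuple a x ≫ h) := fun a x => by
    rw [R, rst_comm (tuple a x), Category.assoc, rst_tuple_comp_self]
  have Rk : ∀ {T : C} (a : Fin n → (T ⟶ A.carrier)) (x : T ⟶ X),
      rst (tuple a x ≫ h) ≫ rst (x ≫ k) = rst (tuple a x ≫ h) := fun a x => by
    rw [R, Category.assoc, FaaRes.rst_idem]
  have Ra : ∀ {T : C} (a : Fin n → (T ⟶ A.carrier)) (x : T ⟶ X) (i : Fin n),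
      rst (tuple a x ≫ h) ≫ rst (a i) = rst (tuple a x ≫ h) := fun a x i => by
    rw [R, rst_comm (tuple a x), Category.assoc, rst_tuple_comp]
  -- evaluation after restriction to an idempotent
  have ev : ∀ {T : C} (x : T ⟶ X) {Z : C} (w : T ⟶ Z), rst w ≫ rst x = rst w →
      rst w ≫ rst (x ≫ k) = rst w → ∃ Φ : Multiset (Stage.Vec ⟨T, rst w, rst_rst w⟩ A) →
        Stage.Vec ⟨T, rst w, rst_rst w⟩ B, MultiAdditive Φ ∧
          ∀ (a : Fin n → (T ⟶ A.carrier)) (ha : ∀ i, rst w ≫ rst (a i) = rst w),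
            rst w ≫ tuple a x ≫ h =
              (Φ (Finset.univ.val.map fun i => ⟨rst w ≫ a i, rst_rst_comp_of (ha i)⟩)).val := by
    intro T x Z w h1 h2
    obtain ⟨Φ, hΦ, e⟩ := H ⟨T, rst w, rst_rst w⟩ (rst w ≫ x) (rst_rst_comp_of h1)
      (by rw [Category.assoc]; exact rst_rst_comp_of h2)
    refine ⟨Φ, hΦ, fun a ha => ?_⟩
    rw [← e, ← Category.assoc, comp_tuple]
  refine ⟨fun T a x i => ⟨fun b c => ?_, ?_⟩, fun T a x σ => ?_⟩
  -- The two sides agree after restriction to the domain of any `w` on which all entries are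
  -- defined. Taking for `w` each side in turn shows that each is a restriction of the other.
  · have key : ∀ {Z : C} (w : T ⟶ Z), (∀ j, j ≠ i → rst w ≫ rst (a j) = rst w) →
        rst w ≫ rst b = rst w → rst w ≫ rst c = rst w → rst w ≫ rst x = rst w →
        rst w ≫ rst (x ≫ k) = rst w →
        rst w ≫ tuple (Function.update a i (b + c)) x ≫ h =
          rst w ≫ (tuple (Function.update a i b) x ≫ h +
            tuple (Function.update a i c) x ≫ h) := by
      intro Z w ha hb hc hx hxk
      obtain ⟨Φ, hΦ, e⟩ := ev x w hx hxk
      have hu : ∀ {y : T ⟶ A.carrier}, rst w ≫ rst y = rst w →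
          ∀ j, rst w ≫ rst (Function.update a i y j) = rst w := by
        intro y hy j
        by_cases hj : j = i
        · subst hj; rwa [Function.update_self]
        · rw [Function.update_of_ne hj, ha j hj]
      have hbc : rst w ≫ rst (b + c) = rst w := by
        rw [A.rst_add, ← Category.assoc, hb, hc]
      have fu : ∀ {y : T ⟶ A.carrier} (hy : rst w ≫ rst y = rst w),
          (fun j => (⟨rst w ≫ Function.update a i y j, rst_rst_comp_of (hu hy j)⟩ :
            Stage.Vec ⟨T, rst w, rst_rst w⟩ A)) = Function.update
              (fun j => (⟨rst w ≫ Function.update a i b j, rst_rst_comp_of (hu hb j)⟩ :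
                Stage.Vec ⟨T, rst w, rst_rst w⟩ A)) i ⟨rst w ≫ y, rst_rst_comp_of hy⟩ := by
        intro y hy
        funext j
        refine Stage.Vec.ext ?_
        by_cases hj : j = i
        · subst hj
          simp only [Function.update_self]
        · simp only [Function.update_of_ne hj]
      rw [B.comp_add, e _ (hu hbc), e _ (hu hb), e _ (hu hc), fu hbc, fu hc,
        univ_val_map_update, univ_val_map_update]
      have hsum : (⟨rst w ≫ (b + c), rst_rst_comp_of hbc⟩ : Stage.Vec ⟨T, rst w, rst_rst w⟩ A) =
          ⟨rst w ≫ b, rst_rst_comp_of hb⟩ + ⟨rst w ≫ c, rst_rst_comp_of hc⟩ :=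
        Stage.Vec.ext (A.comp_add _ _ _)
      rw [hsum, hΦ.add, Stage.Vec.val_add, ← univ_val_map_update, ← univ_val_map_update, ← fu hb]
    have hj : ∀ {y : T ⟶ A.carrier} (j : Fin n), j ≠ i →
        rst (tuple (Function.update a i y) x ≫ h) ≫ rst (a j) =
          rst (tuple (Function.update a i y) x ≫ h) := by
      intro y j hj
      have := Ra (Function.update a i y) x j
      rwa [Function.update_of_ne hj] at this
    have hi : ∀ {y : T ⟶ A.carrier},
        rst (tuple (Function.update a i y) x ≫ h) ≫ rst y =
          rst (tuple (Function.update a i y) x ≫ h) := by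
      intro y
      have := Ra (Function.update a i y) x i
      rwa [Function.update_self] at this
    have tr : ∀ {Y₁ Y₂ Y₃ : C} {p : T ⟶ Y₁} {q : T ⟶ Y₂} {t : T ⟶ Y₃}, rst q ≫ rst t = rst q →
        (rst p ≫ rst q) ≫ rst t = rst p ≫ rst q ∧ (rst q ≫ rst p) ≫ rst t = rst q ≫ rst p := by
      intro Y₁ Y₂ Y₃ p q t hq
      constructor
      · rw [Category.assoc, hq]
      · rw [rst_comm q p, Category.assoc, hq]
    apply eq_of_rst_comp_eq
    · rw [← key (tuple (Function.update a i (b + c)) x ≫ h) (fun j => hj j) ?_ ?_ (Rx _ _) (Rk _ _),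
        rst_comp_self]
      · rw [← hi, A.rst_add, rst_comm b c, Category.assoc, Category.assoc, FaaRes.rst_idem]
      · rw [← hi, A.rst_add, Category.assoc, Category.assoc, FaaRes.rst_idem]
    · rw [key (tuple (Function.update a i b) x ≫ h + tuple (Function.update a i c) x ≫ h),
        rst_comp_self]
      · intro j hj'
        rw [B.rst_add]
        exact (tr (hj j hj')).1
      · rw [B.rst_add]
        exact (tr hi).2
      · rw [B.rst_add]
        exact (tr hi).1
      · rw [B.rst_add]
        exact (tr (Rx _ _)).1
      · rw [B.rst_add]
        exact (tr (Rk _ _)).1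
  -- Over the stage given by the domain of the left side, the entry `0` becomes the zero vector, and
  -- the zero of the target is the restricted zero that is asked for.
  · obtain ⟨Φ, hΦ, e⟩ := ev x (tuple (Function.update a i 0) x ≫ h) (Rx _ _) (Rk _ _)
    have h0 := e (Function.update a i 0) (Ra _ _)
    have hm : (fun j => (⟨rst (tuple (Function.update a i 0) x ≫ h) ≫ Function.update a i 0 j,
        rst_rst_comp_of (Ra _ _ j)⟩ :
          Stage.Vec ⟨T, rst (tuple (Function.update a i 0) x ≫ h), rst_rst _⟩ A)) =
        Function.update (fun j => ⟨rst (tuple (Function.update a i 0) x ≫ h) ≫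
          Function.update a i 0 j, rst_rst_comp_of (Ra _ _ j)⟩) i 0 := by
      funext j
      refine Stage.Vec.ext ?_
      by_cases hj : j = i
      · subst hj
        simp only [Function.update_self]
        rfl
      · simp only [Function.update_of_ne hj]
    rw [rst_comp_self, hm, univ_val_map_update, hΦ.zero] at h0
    exact h0
  · have key : ∀ (a : Fin n → (T ⟶ A.carrier)) (σ : Equiv.Perm (Fin n)),
        rst (tuple a x ≫ h) ≫ tuple (fun i => a (σ i)) x ≫ h = tuple a x ≫ h := by
      intro a σ
      obtain ⟨Φ, hΦ, e⟩ := ev x (tuple a x ≫ h) (Rx _ _) (Rk _ _)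
      rw [e _ fun i => Ra _ _ (σ i)]
      have h0 := e a (Ra _ _)
      rw [rst_comp_self] at h0
      refine Eq.trans ?_ h0.symm
      congr 2
      conv_rhs => rw [← Multiset.map_univ_val_equiv σ, Multiset.map_map]
      rfl
    apply eq_of_rst_comp_eq
    · have := key (fun i => a (σ i)) σ⁻¹
      simpa using this
    · exact key a σ

end Stage

/-! ### Germs: morphisms evaluated at a point of a stage -/

section Germs

variable {C : Type u} [CartRest.{v} C] {P Q R : FaaObj C}

/-- The point `x` over the stage `s` lies in the domain of `k`. -/
structure Stage.Defined (s : Stage C) {X Y : C} (x : s.obj ⟶ X) (k : X ⟶ Y) : Prop where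
  rst_left : rst x = s.idem
  rst_comp : rst (x ≫ k) = s.idem

theorem Stage.defined_comp {s : Stage C} {X Y Z : C} {x : s.obj ⟶ X} {k : X ⟶ Y} {l : Y ⟶ Z} :
    s.Defined x (k ≫ l) ↔ s.Defined x k ∧ s.Defined (x ≫ k) l := by
  constructor
  · rintro ⟨h1, h2⟩
    have h3 : rst (x ≫ k) = s.idem := by
      have h4 := rst_comp_rst_left x k
      have h5 := rst_comp_rst_left (x ≫ k) l
      rw [Category.assoc, h2] at h5
      rw [h1] at h4
      rw [← h4, ← s.rst_idem, rst_comm, s.rst_idem, h5]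
    exact ⟨⟨h1, h3⟩, h3, by rw [Category.assoc, h2]⟩
  · rintro ⟨⟨h1, h2⟩, -, h3⟩
    exact ⟨h1, by rw [← Category.assoc, h3]⟩

theorem Stage.Defined.of_total {s : Stage C} {X Y : C} {x : s.obj ⟶ X} {k : X ⟶ Y}
    (hx : rst x = s.idem) (hk : rst k = 𝟙 X) : s.Defined x k :=
  ⟨hx, by rw [rst_total_comp _ _ hk, hx]⟩

theorem Stage.Defined.comp_rst {s : Stage C} {X Y : C} {x : s.obj ⟶ X} {k : X ⟶ Y}
    (h : s.Defined x k) : x ≫ rst k = x := by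
  rw [IsCartesianRestriction.comp_rst, h.rst_comp, s.idem_comp h.rst_left]

theorem Stage.defined_rst {s : Stage C} {X Y : C} {x : s.obj ⟶ X} {k : X ⟶ Y} :
    s.Defined x (rst k) ↔ s.Defined x k := by
  constructor
  · rintro ⟨h1, h2⟩
    exact ⟨h1, by rwa [rst_comp_rst] at h2⟩
  · rintro ⟨h1, h2⟩
    exact ⟨h1, by rwa [rst_comp_rst]⟩

theorem Stage.defined_lift {s : Stage C} {X Y Z : C} {x : s.obj ⟶ X} {k : X ⟶ Y} {l : X ⟶ Z} :
    s.Defined x (lift k l) ↔ s.Defined x k ∧ s.Defined x l := by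
  constructor
  · intro h
    have h1 : s.Defined x (lift k l ≫ fst Y Z) :=
      ⟨h.1, by rw [← Category.assoc, rst_total_comp _ _ (rst_fst _ _), h.2]⟩
    have h2 : s.Defined x (lift k l ≫ snd Y Z) :=
      ⟨h.1, by rw [← Category.assoc, rst_total_comp _ _ (rst_snd _ _), h.2]⟩
    rw [lift_fst, Stage.defined_comp] at h1
    rw [lift_snd, Stage.defined_comp] at h2
    exact ⟨Stage.defined_rst.1 h2.1, Stage.defined_rst.1 h1.1⟩
  · rintro ⟨h1, h2⟩
    exact ⟨h1.1, by rw [comp_lift, rst_lift, h1.2, h2.2, s.idem_idem]⟩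

namespace FaaHom

/-- The components of `f`, extended by `0` at the index `0`. -/
def comps (f : FaaHom P Q) : ∀ n : ℕ, P.dom n ⟶ Q.mon.carrier
  | 0 => rst (last P.mon.carrier P.pt 0 ≫ f.star) ≫ 0
  | n + 1 => f.d ⟨n + 1, n.succ_pos⟩

theorem d_mk (f : FaaHom P Q) (n : ℕ) (hn : 0 < n) : f.d ⟨n, hn⟩ = f.comps n := by
  cases n with
  | zero => exact absurd hn (lt_irrefl 0)
  | succ n => rfl

theorem comps_coe (f : FaaHom P Q) (n : ℕ+) : f.comps n = f.d n := by
  exact (f.d_mk n n.pos).symm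

theorem rst_comps (f : FaaHom P Q) (n : ℕ) :
    rst (f.comps n) = rst (last P.mon.carrier P.pt n ≫ f.star) := by
  cases n with
  | zero => rw [comps, rst_total_comp _ _ (TotalCommMon.rst_zero _ _), rst_rst]
  | succ n => exact f.rst_d ⟨n + 1, n.succ_pos⟩

/-- The value of a component of `f` at a multiset of vectors. -/
noncomputable def eval (f : FaaHom P Q) {T : C} (x : T ⟶ P.pt)
    (m : Multiset (T ⟶ P.mon.carrier)) : T ⟶ Q.mon.carrier :=
  tuple (fun i : Fin m.toList.length => m.toList.get i) x ≫ f.comps m.toList.length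

/-- Symmetry, in the form that the value depends only on the multiset of vectors; it makes `eval`
independent of the enumeration chosen in its definition. -/
theorem tuple_comp_eq_of_map_eq (f : FaaHom P Q) {T : C} (x : T ⟶ P.pt) {m n : ℕ}
    {a : Fin m → (T ⟶ P.mon.carrier)} {b : Fin n → (T ⟶ P.mon.carrier)}
    (h : (Finset.univ : Finset (Fin m)).val.map a = (Finset.univ : Finset (Fin n)).val.map b) :
    tuple a x ≫ f.comps m = tuple b x ≫ f.comps n := by
  have hmn : m = n := by simpa using congrArg Multiset.card h
  subst hmn
  obtain ⟨σ, hσ⟩ := exists_perm_of_map_eq h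
  have hb : b = fun i => a (σ i) := funext fun i => (hσ i).symm
  cases m with
  | zero => rw [Subsingleton.elim a b]
  | succ m => rw [hb]; exact (f.symm ⟨m + 1, m.succ_pos⟩ _ a x σ).symm

theorem tuple_comp_comps (f : FaaHom P Q) {T : C} (x : T ⟶ P.pt) {n : ℕ}
    (a : Fin n → (T ⟶ P.mon.carrier)) :
    tuple a x ≫ f.comps n = f.eval x (Finset.univ.val.map a) := by
  apply tuple_comp_eq_of_map_eq
  conv_lhs => rw [← Multiset.coe_toList (Multiset.map a Finset.univ.val)]
  exact (congrArg _ (List.ofFn_get _).symm).trans (Fin.univ_val_map _).symm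

theorem exists_fin_eq {α : Type*} (m : Multiset α) :
    ∃ a : Fin (Multiset.card m) → α, m = Finset.univ.val.map a := by
  refine ⟨fun i => m.toList.get (Fin.cast (Multiset.length_toList m).symm i), ?_⟩
  rw [univ_val_map_cast (Multiset.length_toList m).symm fun i => m.toList.get i, Fin.univ_val_map,
    List.ofFn_get, Multiset.coe_toList]

theorem rst_eval (f : FaaHom P Q) {s : Stage C} {x : s.obj ⟶ P.pt} (h : s.Defined x f.star)
    (m : Multiset (s.Vec P.mon)) : rst (f.eval x (m.map Stage.Vec.val)) = s.idem := by
  obtain ⟨a, ha⟩ := exists_fin_eq m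
  rw [ha, Multiset.map_map, ← tuple_comp_comps, rst_tuple_comp_of_rst _ _ (f.rst_comps _),
    h.rst_comp, rst_tuple (a := Stage.Vec.val ∘ a) (fun i => (a i).rst_val) h.rst_left,
    s.idem_idem]

theorem eval_map_comp (f : FaaHom P Q) {S T : C} (k : S ⟶ T) (x : T ⟶ P.pt)
    (m : Multiset (T ⟶ P.mon.carrier)) :
    k ≫ f.eval x m = f.eval (k ≫ x) (m.map fun a => k ≫ a) := by
  obtain ⟨a, ha⟩ := exists_fin_eq m
  rw [ha, ← tuple_comp_comps, ← Category.assoc, comp_tuple, Multiset.map_map]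
  exact tuple_comp_comps _ _ _

open Classical in
/-- The values of the components of `f` at the point `x` over the stage `s`; they are `0` unless
`f` is defined at `x`. -/
noncomputable def germ (f : FaaHom P Q) (s : Stage C) (x : s.obj ⟶ P.pt)
    (m : Multiset (s.Vec P.mon)) : s.Vec Q.mon :=
  if h : s.Defined x f.star ∧ m ≠ 0 then ⟨f.eval x (m.map Stage.Vec.val), f.rst_eval h.1 m⟩ else 0

theorem germ_empty (f : FaaHom P Q) (s : Stage C) (x : s.obj ⟶ P.pt) : f.germ s x 0 = 0 :=
  dif_neg (by simp)

theorem val_germ (f : FaaHom P Q) {s : Stage C} {x : s.obj ⟶ P.pt} (h : s.Defined x f.star)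
    {m : Multiset (s.Vec P.mon)} (hm : m ≠ 0) :
    (f.germ s x m).val = f.eval x (m.map Stage.Vec.val) := by
  rw [germ, dif_pos ⟨h, hm⟩]

theorem univ_map_ne_zero {α : Type*} {n : ℕ} (hn : n ≠ 0) (a : Fin n → α) :
    (Finset.univ : Finset (Fin n)).val.map a ≠ 0 := by
  intro h
  exact hn (by simpa using congrArg Multiset.card h)

theorem tuple_comp_comps_eq_germ (f : FaaHom P Q) {s : Stage C} {x : s.obj ⟶ P.pt}
    (h : s.Defined x f.star) {n : ℕ} (hn : n ≠ 0) (a : Fin n → s.Vec P.mon) :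
    tuple (fun i => (a i).val) x ≫ f.comps n = (f.germ s x (Finset.univ.val.map a)).val := by
  rw [val_germ f h (univ_map_ne_zero hn a), tuple_comp_comps, Multiset.map_map]
  rfl

theorem tuple_comp_d_eq_germ (f : FaaHom P Q) {s : Stage C} {x : s.obj ⟶ P.pt}
    (h : s.Defined x f.star) {n : ℕ+} (a : Fin n → s.Vec P.mon) :
    tuple (fun i => (a i).val) x ≫ f.d n = (f.germ s x (Finset.univ.val.map a)).val := by
  rw [← comps_coe, tuple_comp_comps_eq_germ f h n.ne_zero]

/-- At a point of the domain, this is additivity of the component in the slot that holds the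
distinguished vector. Elsewhere the germ is constantly zero. -/
theorem multiAdditive_germ (f : FaaHom P Q) (s : Stage C) (x : s.obj ⟶ P.pt) :
    MultiAdditive (f.germ s x) := by
  by_cases h : s.Defined x f.star
  · have key : ∀ (b : s.Vec P.mon) (m : Multiset (s.Vec P.mon)), ∃ (n : ℕ+)
        (a : Fin n → (s.obj ⟶ P.mon.carrier)) (i : Fin n), ∀ b : s.Vec P.mon,
          (f.germ s x (b ::ₘ m)).val = tuple (Function.update a i b.val) x ≫ f.d n := by
      intro b m
      obtain ⟨a, ha⟩ := exists_fin_eq m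
      let a' : Fin (Multiset.card m + 1) → s.Vec P.mon := Fin.cons b a
      have key : ∀ b : s.Vec P.mon, (f.germ s x (b ::ₘ m)).val =
          tuple (Function.update (fun i => (a' i).val) 0 b.val) x ≫
            f.comps (Multiset.card m + 1) := by
        intro b
        rw [val_germ f h Multiset.cons_ne_zero, tuple_comp_comps]
        congr 1
        rw [univ_val_map_succ, Function.update_self, Multiset.map_cons]
        congr 1
        conv_lhs => rw [ha, Multiset.map_map]
        rfl
      exact ⟨⟨Multiset.card m + 1, Nat.succ_pos _⟩, fun i => (a' i).val, (0 : Fin (_ + 1)), key⟩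
    refine ⟨fun b c m => ?_, fun m => ?_⟩
    · obtain ⟨n, a, i, e⟩ := key b m
      apply Stage.Vec.ext
      rw [Stage.Vec.val_add, e, e, e]
      exact (f.additive n _ a x i).1 _ _
    · obtain ⟨n, a, i, e⟩ := key 0 m
      have h1 := (f.additive n _ (Function.update a i (0 : s.Vec P.mon).val) x i).1 0 0
      have h2 := (f.additive n _ a x i).2
      have h3 : f.germ s x (0 ::ₘ m) = f.germ s x (0 ::ₘ m) + f.germ s x (0 ::ₘ m) := by
        apply Stage.Vec.ext
        rw [Stage.Vec.val_add, e, ← (f.additive n _ a x i).1]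
        congr 3
        exact (congrArg Stage.Vec.val (add_zero (0 : s.Vec P.mon))).symm
      apply Stage.Vec.ext
      -- The zero law for components speaks of the total zero, the zero vector is its restriction to
      -- the stage; precomposing with the idempotent identifies them.
      have h4 : s.idem ≫ tuple (Function.update a i 0) x ≫ f.d n =
          tuple (Function.update a i (0 : s.Vec P.mon).val) x ≫ f.d n := by
        rw [← e, ← Stage.Vec.idem_comp, e, ← Category.assoc, ← Category.assoc, comp_tuple,
          comp_tuple]
        congr 2
        funext j
        by_cases hj : j = i
        · subst hj
          rw [Function.update_self, Function.update_self, Stage.Vec.val_zero, ← Category.assoc,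
            s.idem_idem]
        · rw [Function.update_of_ne hj, Function.update_of_ne hj]
      have h5 : rst (s.idem ≫ tuple (Function.update a i 0) x ≫ f.d n) = s.idem := by
        rw [h4, ← e, Stage.Vec.rst_val]
      rw [e, ← h4, h2, ← Category.assoc]
      rw [← s.rst_idem, rst_rst_comp, s.rst_idem] at h5
      rw [h5]
      rfl
  · have h0 : f.germ s x = fun _ => 0 := funext fun m => dif_neg fun h' => h h'.1
    rw [h0]
    exact ⟨fun _ _ _ => (add_zero _).symm, fun _ => rfl⟩

/-- Morphisms with the same base map and the same germs are equal. -/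
theorem ext_germ {f g : FaaHom P Q} (h : f.star = g.star)
    (H : ∀ (s : Stage C) (x : s.obj ⟶ P.pt), s.Defined x f.star → ∀ m, m ≠ 0 →
      f.germ s x m = g.germ s x m) : f = g := by
  refine FaaHom.ext h (funext fun n => ?_)
  -- The universal stage: `A^n × X` cut down to the domain of the component, with the coordinates as
  -- vectors and point.
  let s : Stage C := ⟨P.dom n, rst (last P.mon.carrier P.pt n ≫ f.star), rst_rst _⟩
  have hl : rst (s.idem ≫ last P.mon.carrier P.pt n) = s.idem := by
    rw [rst_total_comp _ _ (rst_last _ _ _), s.rst_idem]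
  have hp : ∀ i, rst (s.idem ≫ proj P.mon.carrier P.pt n i) = s.idem := fun i => by
    rw [rst_total_comp _ _ (rst_proj _ _ _ _), s.rst_idem]
  have hd : s.Defined (s.idem ≫ last P.mon.carrier P.pt n) f.star :=
    ⟨hl, by rw [Category.assoc]; exact rst_rst_comp_of (FaaRes.rst_idem _)⟩
  have key : ∀ g : FaaHom P Q, f.star = g.star → g.d n = (g.germ s
      (s.idem ≫ last P.mon.carrier P.pt n)
      (Finset.univ.val.map fun i => ⟨s.idem ≫ proj P.mon.carrier P.pt n i, hp i⟩)).val := by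
    intro g hg
    rw [← tuple_comp_d_eq_germ _ (hg ▸ hd), ← comp_tuple, tuple_proj_last]
    have h1 : rst (g.d n) = s.idem := by rw [g.rst_d, ← hg]
    rw [← h1, Category.comp_id, rst_comp_self]
  rw [key f rfl, key g h, H _ _ hd _ (univ_map_ne_zero n.ne_zero _)]

/-- Germs are determined by their values on families of vectors. -/
theorem germ_eq_of_forall {f : FaaHom P Q} {s : Stage C} {x : s.obj ⟶ P.pt}
    (h : s.Defined x f.star) {Φ : Multiset (s.Vec P.mon) → s.Vec Q.mon}
    (H : ∀ (n : ℕ+) (a : Fin n → s.Vec P.mon),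
      tuple (fun i => (a i).val) x ≫ f.d n = (Φ (Finset.univ.val.map a)).val)
    {m : Multiset (s.Vec P.mon)} (hm : m ≠ 0) : f.germ s x m = Φ m := by
  obtain ⟨a, ha⟩ := exists_fin_eq m
  have h1 := H ⟨Multiset.card m, Multiset.card_pos.2 hm⟩ a
  have h2 := tuple_comp_d_eq_germ f h (n := ⟨Multiset.card m, Multiset.card_pos.2 hm⟩) a
  rw [ha]
  exact Stage.Vec.ext (h2.symm.trans h1)

end FaaHom

/-! ### Composition -/

theorem Stage.val_sum_of_comp {s : Stage C} {A : TotalCommMon C} {T : C} {ι : Type*}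
    (S : Finset ι) (k : s.obj ⟶ T) (hk : rst k = s.idem) (F : ι → (T ⟶ A.carrier))
    (G : ι → s.Vec A) (h : ∀ i ∈ S, k ≫ F i = (G i).val) :
    k ≫ ∑ i ∈ S, F i = (∑ i ∈ S, G i).val := by
  classical
  induction S using Finset.induction_on with
  | empty => rw [Finset.sum_empty, Finset.sum_empty, A.comp_zero, hk]; rfl
  | insert i S hi ih =>
    rw [Finset.sum_insert hi, Finset.sum_insert hi, A.comp_add, Stage.Vec.val_add,
      h i (Finset.mem_insert_self _ _), ih fun j hj => h j (Finset.mem_insert_of_mem hj)]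

/-- Indexing the components by `ℕ` removes the positivity proofs from the summands. -/
theorem compD_eq (f : FaaHom P Q) (g : FaaHom Q R) (n : ℕ+) :
    compD f g n = ∑ c : OrderedFinpartition n,
      tuple (fun i : Fin c.length => tuple (fun j : Fin (c.partSize i) =>
          proj P.mon.carrier P.pt n (c.emb i j)) (last P.mon.carrier P.pt n) ≫
            f.comps (c.partSize i))
        (last P.mon.carrier P.pt n ≫ f.star) ≫ g.comps c.length := by
  refine Finset.sum_congr rfl fun c _ => ?_
  have h1 := g.d_mk c.length (c.length_pos n.pos)
  have h2 := fun i => f.d_mk (c.partSize i) (c.partSize_pos i)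
  refine Eq.trans (congrArg (fun t => _ ≫ t) h1) (congrArg (fun t => tuple t _ ≫ _) ?_)
  exact funext fun i => congrArg (fun t => _ ≫ t) (h2 i)

/-- Over a stage, every summand is a germ of `g` at the germs of `f` on the blocks, and
`sum_orderedFinpartition` turns the sum over index partitions into one over partitions of the
multiset. -/
theorem tuple_comp_compD (f : FaaHom P Q) (g : FaaHom Q R) {s : Stage C} {x : s.obj ⟶ P.pt}
    (h : s.Defined x (f.star ≫ g.star)) {n : ℕ+} (a : Fin n → s.Vec P.mon) :
    tuple (fun i => (a i).val) x ≫ compD f g n =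
      (pcomp (g.germ s (x ≫ f.star)) (f.germ s x) (Finset.univ.val.map a)).val := by
  obtain ⟨hf, hg⟩ := Stage.defined_comp.1 h
  have ht : rst (tuple (fun i => (a i).val) x) = s.idem :=
    rst_tuple (fun i => (a i).rst_val) h.rst_left
  have hp : ∀ i, tuple (fun i => (a i).val) x ≫ proj P.mon.carrier P.pt n i = (a i).val := by
    intro i
    rw [tuple_proj, ht, Stage.Vec.idem_comp]
  have hl : tuple (fun i => (a i).val) x ≫ last P.mon.carrier P.pt n = x := by
    rw [tuple_last, ht, s.idem_comp h.rst_left]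
  rw [pcomp, ← sum_orderedFinpartition, compD_eq]
  refine Stage.val_sum_of_comp _ _ ht _ _ fun c _ => ?_
  have h1 : ∀ i : Fin c.length, tuple (fun i => (a i).val) x ≫
      tuple (fun j : Fin (c.partSize i) => proj P.mon.carrier P.pt n (c.emb i j))
        (last P.mon.carrier P.pt n) ≫ f.comps (c.partSize i) =
      (f.germ s x (Finset.univ.val.map fun j => a (c.emb i j))).val := by
    intro i
    rw [← Category.assoc, comp_tuple, hl]
    simp only [hp]
    exact FaaHom.tuple_comp_comps_eq_germ f hf (c.partSize_pos i).ne' fun j => a (c.emb i j)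
  rw [← Category.assoc, comp_tuple]
  simp only [h1]
  rw [← Category.assoc, hl, blocks, Multiset.map_map]
  exact FaaHom.tuple_comp_comps_eq_germ g hg (c.length_pos n.pos).ne' _

/-- Nonemptiness matters: the empty sum is the total zero. -/
theorem rst_sum_of_forall {T Y : C} {A : TotalCommMon C} {ι : Type*} {S : Finset ι}
    (hS : S.Nonempty) {F : ι → (T ⟶ A.carrier)} {k : T ⟶ Y} (h : ∀ i ∈ S, rst (F i) = rst k) :
    rst (∑ i ∈ S, F i) = rst k := by
  classical
  induction hS using Finset.Nonempty.cons_induction with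
  | singleton i => rw [Finset.sum_singleton, h i (Finset.mem_singleton_self i)]
  | cons i S hi hS ih =>
    rw [Finset.sum_cons, A.rst_add, h i (Finset.mem_cons_self i S),
      ih fun j hj => h j (Finset.mem_cons_of_mem hj), FaaRes.rst_idem]

theorem rst_tuple_total {T A X : C} {n : ℕ} {a : Fin n → (T ⟶ A)} {x : T ⟶ X}
    (ha : ∀ i, rst (a i) = 𝟙 T) (hx : rst x = 𝟙 T) : rst (tuple a x) = 𝟙 T := rst_tuple ha hx

/-- All summands have the same domain, and there is at least one partition. -/
theorem rst_compD (f : FaaHom P Q) (g : FaaHom Q R) (n : ℕ+) :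
    rst (compD f g n) = rst (last P.mon.carrier P.pt n ≫ f.star ≫ g.star) := by
  have : Nonempty (OrderedFinpartition n) := ⟨default⟩
  rw [compD_eq]
  refine rst_sum_of_forall Finset.univ_nonempty fun c _ => ?_
  have h1 : ∀ i : Fin c.length, rst (tuple (fun j : Fin (c.partSize i) =>
      proj P.mon.carrier P.pt n (c.emb i j)) (last P.mon.carrier P.pt n) ≫
        f.comps (c.partSize i)) = rst (last P.mon.carrier P.pt n ≫ f.star) := by
    intro i
    rw [rst_tuple_comp_of_rst _ _ (f.rst_comps _),
      rst_tuple_total (fun i => rst_proj _ _ _ _) (rst_last _ _ _), Category.id_comp]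
  rw [rst_tuple_comp_of_rst _ _ (g.rst_comps _), rst_tuple h1 rfl, Category.assoc, ← rst_rst_comp,
    ← Category.assoc (last _ _ _), ← Category.assoc, rst_comp_self]

/-- The composite of `Faà(C)`. -/
noncomputable def FaaHom.comp (f : FaaHom P Q) (g : FaaHom Q R) : FaaHom P R :=
  have H := fun n : ℕ+ => additive_symm_of_stage (rst_compD f g n) fun s x h1 h2 =>
    ⟨pcomp (g.germ s (x ≫ f.star)) (f.germ s x),
      (g.multiAdditive_germ s _).pcomp (f.multiAdditive_germ s x),
      fun a => tuple_comp_compD f g ⟨h1, h2⟩ a⟩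
  { star := f.star ≫ g.star
    d := compD f g
    rst_d := rst_compD f g
    additive := fun n => (H n).1
    symm := fun n => (H n).2 }

/-- The germs of a composite. -/
theorem germ_of_compD {f : FaaHom P Q} {g : FaaHom Q R} {k : FaaHom P R}
    (h1 : k.star = f.star ≫ g.star) (h2 : ∀ n, k.d n = compD f g n) {s : Stage C}
    {x : s.obj ⟶ P.pt} (h : s.Defined x k.star) (m : Multiset (s.Vec P.mon)) :
    k.germ s x m = pcomp (g.germ s (x ≫ f.star)) (f.germ s x) m := by
  by_cases hm : m = 0
  · subst hm
    rw [FaaHom.germ_empty, pcomp_zero, FaaHom.germ_empty]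
  · refine FaaHom.germ_eq_of_forall h (fun n a => ?_) hm
    rw [h2]
    exact tuple_comp_compD f g (h1 ▸ h) a

end Germs

/-! ### Linear morphisms -/

section Linear

variable {C : Type u} [CartRest.{v} C] {P Q R : FaaObj C}

theorem IsMonHom.id (A : TotalCommMon C) : IsMonHom A A (𝟙 A.carrier) where
  total := rst_id _
  map_add a b := by simp
  map_zero T := by simp

theorem IsMonHom.comp {A B D : TotalCommMon C} {k : A.carrier ⟶ B.carrier}
    {l : B.carrier ⟶ D.carrier} (hk : IsMonHom A B k) (hl : IsMonHom B D l) :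
    IsMonHom A D (k ≫ l) where
  total := by rw [rst_total_comp _ _ hl.total, hk.total]
  map_add a b := by rw [← Category.assoc, hk.map_add, hl.map_add, Category.assoc, Category.assoc]
  map_zero T := by rw [← Category.assoc, hk.map_zero, hl.map_zero]

/-- The first component `π_0 k` of a linear morphism, extended by `0`. -/
def linPart {A B : TotalCommMon C} (X : C) (k : A.carrier ⟶ B.carrier) :
    ∀ n : ℕ, pow A.carrier X n ⟶ B.carrier
  | 0 => 0
  | 1 => proj A.carrier X 1 0 ≫ k
  | _ + 2 => 0

theorem linPart_of_ne {A B : TotalCommMon C} (X : C) (k : A.carrier ⟶ B.carrier) {n : ℕ}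
    (hn : n ≠ 1) : linPart X k n = 0 := by
  match n, hn with
  | 0, _ => rfl
  | n + 2, _ => rfl

theorem rst_linPart {A B : TotalCommMon C} (X : C) {k : A.carrier ⟶ B.carrier}
    (hk : rst k = 𝟙 _) (n : ℕ) : rst (linPart X k n) = 𝟙 _ := by
  match n with
  | 0 => exact B.rst_zero _
  | 1 => exact (rst_total_comp _ _ hk).trans (rst_proj _ _ _ _)
  | n + 2 => exact B.rst_zero _

open Classical in
/-- The family of maps given by `k` on one vector and by `0` otherwise. -/
noncomputable def linMap {α B : Type*} [AddCommMonoid B] (k : α → B) (m : Multiset α) : B :=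
  if Multiset.card m = 1 then msum m k else 0

theorem isLin_linMap {α B : Type*} [AddCommMonoid B] (k : α → B) : IsLin (linMap k) k :=
  ⟨fun a => by simp [linMap], fun s hs => if_neg hs⟩

theorem IsLin.multiAdditive {A B : Type*} [AddCommMonoid A] [AddCommMonoid B]
    {Φ : Multiset A → B} {k : A → B} (h : IsLin Φ k) (hadd : ∀ a b, k (a + b) = k a + k b)
    (h0 : k 0 = 0) : MultiAdditive Φ := by
  have h1 : ∀ (s : Multiset A) (a : A), s ≠ 0 → Φ (a ::ₘ s) = 0 := fun s a hs =>
    h.other _ (by rw [Multiset.card_cons]; have := Multiset.card_pos.2 hs; omega)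
  refine ⟨fun a b s => ?_, fun s => ?_⟩
  · by_cases hs : s = 0
    · subst hs
      have := h.single
      simp only [← Multiset.cons_zero] at this
      rw [this, this, this, hadd]
    · rw [h1 s _ hs, h1 s _ hs, h1 s _ hs, add_zero]
  · by_cases hs : s = 0
    · subst hs
      exact (h.single 0).trans h0
    · exact h1 s _ hs

theorem tuple_comp_linPart {A B : TotalCommMon C} {X : C} {k : A.carrier ⟶ B.carrier}
    (hk : IsMonHom A B k) {s : Stage C} {x : s.obj ⟶ X} (hx : rst x = s.idem) {n : ℕ}
    (a : Fin n → s.Vec A) : tuple (fun i => (a i).val) x ≫ linPart X k n =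
      (linMap (Stage.Vec.map hk) (Finset.univ.val.map a)).val := by
  have ht : rst (tuple (fun i => (a i).val) x) = s.idem :=
    rst_tuple (fun i => (a i).rst_val) hx
  by_cases hn : n = 1
  · subst hn
    have h : linPart X k 1 = proj A.carrier X 1 0 ≫ k := rfl
    have h1 : (Finset.univ : Finset (Fin 1)).val.map a = {a 0} := rfl
    rw [h, ← Category.assoc, tuple_proj, ht, Stage.Vec.idem_comp, h1, (isLin_linMap _).single]
    rfl
  · rw [linPart_of_ne _ _ hn, (isLin_linMap _).other _ (by simpa using hn), B.comp_zero, ht]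
    rfl

/-- `f = (h, \overline{π_1 h} π_0 k, \overline{π_2 h} 0, …)` -/
structure FaaHom.IsLinearOn (f : FaaHom P Q) (h : P.pt ⟶ Q.pt)
    (k : P.mon.carrier ⟶ Q.mon.carrier) : Prop where
  star : f.star = h
  d : ∀ n : ℕ+, f.d n = rst (last P.mon.carrier P.pt n ≫ h) ≫ linPart P.pt k n

/-- The morphism `(h, \overline{π_1 h} π_0 k, \overline{π_2 h} 0, …)` -/
noncomputable def FaaHom.linear (h : P.pt ⟶ Q.pt) {k : P.mon.carrier ⟶ Q.mon.carrier}
    (hk : IsMonHom P.mon Q.mon k) : FaaHom P Q :=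
  have R := fun n : ℕ => show rst (rst (last P.mon.carrier P.pt n ≫ h) ≫ linPart P.pt k n) =
    rst (last P.mon.carrier P.pt n ≫ h) by
      rw [rst_total_comp _ _ (rst_linPart P.pt hk.total n), rst_rst]
  have H := fun n : ℕ => additive_symm_of_stage (R n) fun s x h1 h2 =>
    ⟨linMap (Stage.Vec.map hk),
      (isLin_linMap _).multiAdditive (Stage.Vec.map_add hk) (Stage.Vec.map_zero hk), fun a => by
        have ht : rst (tuple (fun i => (a i).val) x) = s.idem :=
          rst_tuple (fun i => (a i).rst_val) h1
        rw [← tuple_comp_linPart hk h1, ← Category.assoc, IsCartesianRestriction.comp_rst,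
          ← Category.assoc, tuple_last, ht, s.idem_comp h1, h2, s.idem_comp ht]⟩
  { star := h
    d := fun n => rst (last P.mon.carrier P.pt n ≫ h) ≫ linPart P.pt k n
    rst_d := fun n => R n
    additive := fun n => (H n).1
    symm := fun n => (H n).2 }

theorem FaaHom.isLinearOn_linear (h : P.pt ⟶ Q.pt) {k : P.mon.carrier ⟶ Q.mon.carrier}
    (hk : IsMonHom P.mon Q.mon k) : (FaaHom.linear h hk).IsLinearOn h k := ⟨rfl, fun _ => rfl⟩

theorem FaaHom.isLinearOn_iff_isLinear {f : FaaHom P Q} {h : P.pt ⟶ Q.pt}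
    {k : P.mon.carrier ⟶ Q.mon.carrier} (hh : rst h = 𝟙 _) :
    f.IsLinearOn h k ↔ f.IsLinear h k := by
  have e : ∀ n : ℕ, rst (last P.mon.carrier P.pt n ≫ h) ≫ linPart P.pt k n =
      linPart P.pt k n := fun n => by
    rw [rst_total_comp _ _ hh, rst_last, Category.id_comp]
  constructor
  · rintro ⟨h1, h2⟩
    refine ⟨h1, (h2 1).trans (e 1), fun n hn => ?_⟩
    rw [h2, e, linPart_of_ne _ _ fun h => hn (PNat.coe_eq_one_iff.1 h)]
  · rintro ⟨h1, h2, h3⟩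
    refine ⟨h1, fun n => ?_⟩
    rw [e]
    by_cases hn : n = 1
    · subst hn; exact h2
    · rw [h3 n hn, linPart_of_ne _ _ fun h => hn (PNat.coe_eq_one_iff.1 h)]

/-- At a point where `h` is defined the restriction factors act as identities, and only `π_0 k`
remains. -/
theorem FaaHom.IsLinearOn.isLin_germ {f : FaaHom P Q} {h : P.pt ⟶ Q.pt}
    {k : P.mon.carrier ⟶ Q.mon.carrier} (hf : f.IsLinearOn h k) (hk : IsMonHom P.mon Q.mon k)
    {s : Stage C} {x : s.obj ⟶ P.pt} (hx : s.Defined x f.star) :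
    IsLin (f.germ s x) (Stage.Vec.map hk) := by
  have key : f.germ s x = linMap (Stage.Vec.map hk) := by
    funext m
    by_cases hm : m = 0
    · subst hm
      rw [FaaHom.germ_empty, (isLin_linMap _).other _ (by simp)]
    · refine FaaHom.germ_eq_of_forall hx (fun n a => ?_) hm
      have ht : rst (tuple (fun i => (a i).val) x) = s.idem :=
        rst_tuple (fun i => (a i).rst_val) hx.1
      rw [hf.d, ← tuple_comp_linPart hk hx.1, ← Category.assoc, IsCartesianRestriction.comp_rst,
        ← Category.assoc, tuple_last, ht, s.idem_comp hx.1, ← hf.star, hx.2, s.idem_comp ht]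
  rw [key]
  exact isLin_linMap _

theorem Stage.Vec.map_id {s : Stage C} {A : TotalCommMon C} (a : s.Vec A) :
    a.map (IsMonHom.id A) = a := Stage.Vec.ext (Category.comp_id _)

theorem Stage.Vec.multiset_map_id {s : Stage C} {A : TotalCommMon C} (m : Multiset (s.Vec A)) :
    m.map (Stage.Vec.map (IsMonHom.id A)) = m := by
  rw [Multiset.map_congr rfl fun a _ => Stage.Vec.map_id a, Multiset.map_id']

theorem Stage.Vec.map_comp {s : Stage C} {A B D : TotalCommMon C} {k : A.carrier ⟶ B.carrier}
    {l : B.carrier ⟶ D.carrier} (hk : IsMonHom A B k) (hl : IsMonHom B D l) (a : s.Vec A) :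
    a.map (hk.comp hl) = (a.map hk).map hl := Stage.Vec.ext (Category.assoc _ _ _).symm

theorem isMonHom_bang (A : TotalCommMon C) : IsMonHom A (TotalCommMon.unit C) (bang A.carrier) where
  total := rst_bang _
  map_add {T} a b := by
    have h : (a + b) ≫ bang A.carrier = lift (a ≫ bang _) (b ≫ bang _) ≫ bang _ := by
      rw [comp_bang, comp_bang (lift _ _), A.rst_add, rst_lift, rst_total_comp _ _ (rst_bang _),
        rst_total_comp _ _ (rst_bang _)]
    exact h
  map_zero T := by
    have h : (0 : T ⟶ A.carrier) ≫ bang A.carrier = bang T ≫ 𝟙 one := by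
      rw [comp_bang, A.rst_zero, Category.id_comp, Category.comp_id]
    exact h

theorem isMonHom_fst (A B : TotalCommMon C) :
    IsMonHom (A.prod B) A (fst A.carrier B.carrier) where
  total := rst_fst _ _
  map_add a b := TotalCommMon.comp_prodAdd_fst A B a b
  map_zero T := by
    change (bang T ≫ lift A.zero B.zero) ≫ _ = bang T ≫ A.zero
    rw [Category.assoc, lift_fst, B.isMon.rst_zero, Category.id_comp]

theorem isMonHom_snd (A B : TotalCommMon C) :
    IsMonHom (A.prod B) B (snd A.carrier B.carrier) where
  total := rst_snd _ _
  map_add a b := TotalCommMon.comp_prodAdd_snd A B a b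
  map_zero T := by
    change (bang T ≫ lift A.zero B.zero) ≫ _ = bang T ≫ B.zero
    rw [Category.assoc, lift_snd, A.isMon.rst_zero, Category.id_comp]

/-- The restriction of `Faà(C)`. -/
noncomputable def FaaHom.rst (f : FaaHom P Q) : FaaHom P P :=
  FaaHom.linear (CRStruct.rst f.star) (IsMonHom.id P.mon)

end Linear

/-! ### Pairing of vectors and of morphisms -/

section Pairing

variable {C : Type u} [CartRest.{v} C] {P Q R : FaaObj C}

namespace Stage.Vec

variable {s : Stage C} {A B : TotalCommMon C}

def pair (a : s.Vec A) (b : s.Vec B) : s.Vec (A.prod B) :=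
  ⟨lift a.val b.val, by
    have h := rst_lift a.val b.val
    rw [a.rst_val, b.rst_val, s.idem_idem] at h
    exact h⟩

def fst (a : s.Vec (A.prod B)) : s.Vec A := a.map (isMonHom_fst A B)

def snd (a : s.Vec (A.prod B)) : s.Vec B := a.map (isMonHom_snd A B)

theorem fst_add (a b : s.Vec (A.prod B)) : (a + b).fst = a.fst + b.fst := Stage.Vec.map_add _ _ _

theorem snd_add (a b : s.Vec (A.prod B)) : (a + b).snd = a.snd + b.snd := Stage.Vec.map_add _ _ _

theorem fst_zero : (0 : s.Vec (A.prod B)).fst = 0 := Stage.Vec.map_zero _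

theorem snd_zero : (0 : s.Vec (A.prod B)).snd = 0 := Stage.Vec.map_zero _

theorem fst_pair (a : s.Vec A) (b : s.Vec B) : (a.pair b).fst = a := by
  apply Stage.Vec.ext
  have h := lift_fst a.val b.val
  rw [b.rst_val, a.idem_comp] at h
  exact h

theorem snd_pair (a : s.Vec A) (b : s.Vec B) : (a.pair b).snd = b := by
  apply Stage.Vec.ext
  have h := lift_snd a.val b.val
  rw [a.rst_val, b.idem_comp] at h
  exact h

theorem prod_ext {a b : s.Vec (A.prod B)} (h1 : a.fst = b.fst) (h2 : a.snd = b.snd) : a = b :=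
  Stage.Vec.ext (hom_ext (congrArg Stage.Vec.val h1) (congrArg Stage.Vec.val h2))

theorem pair_add (a a' : s.Vec A) (b b' : s.Vec B) :
    (a + a').pair (b + b') = a.pair b + a'.pair b' := by
  apply prod_ext
  · rw [fst_add, fst_pair, fst_pair, fst_pair]
  · rw [snd_add, snd_pair, snd_pair, snd_pair]

theorem pair_zero : (0 : s.Vec A).pair (0 : s.Vec B) = 0 := by
  apply prod_ext
  · rw [fst_zero, fst_pair]
  · rw [snd_zero, snd_pair]

theorem unit_ext (a b : s.Vec (TotalCommMon.unit C)) : a = b := by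
  have key : ∀ a : s.Vec (TotalCommMon.unit C), a.val = s.idem ≫ bang s.obj := fun a => by
    have h : a.val ≫ bang one = rst a.val ≫ bang s.obj := comp_bang a.val
    rw [bang_one, a.rst_val] at h
    exact (Category.comp_id _).symm.trans h
  exact Stage.Vec.ext ((key a).trans (key b).symm)

end Stage.Vec

theorem tuple_comp_lift (f : FaaHom P Q) (g : FaaHom P R) {s : Stage C} {x : s.obj ⟶ P.pt}
    (hf : s.Defined x f.star) (hg : s.Defined x g.star) {n : ℕ+} (a : Fin n → s.Vec P.mon) :
    tuple (fun i => (a i).val) x ≫ lift (f.d n) (g.d n) =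
      ((f.germ s x (Finset.univ.val.map a)).pair (g.germ s x (Finset.univ.val.map a))).val := by
  rw [comp_lift, f.tuple_comp_d_eq_germ hf, g.tuple_comp_d_eq_germ hg]
  rfl

theorem rst_lift_d (f : FaaHom P Q) (g : FaaHom P R) (n : ℕ+) :
    rst (lift (f.d n) (g.d n)) = rst (last P.mon.carrier P.pt n ≫ lift f.star g.star) := by
  rw [comp_lift, rst_lift, rst_lift, f.rst_d, g.rst_d]

/-- The pairing of `Faà(C)`. -/
noncomputable def FaaHom.lift (f : FaaHom P Q) (g : FaaHom P R) : FaaHom P (Q.prod R) :=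
  have H := fun n : ℕ+ => additive_symm_of_stage (B := Q.mon.prod R.mon) (rst_lift_d f g n)
    fun s x h1 h2 =>
    have h := Stage.defined_lift.1 ⟨h1, h2⟩
    ⟨fun m => (f.germ s x m).pair (g.germ s x m),
      ⟨fun a b m => by
        rw [(f.multiAdditive_germ s x).add, (g.multiAdditive_germ s x).add,
          Stage.Vec.pair_add],
        fun m => by
          rw [(f.multiAdditive_germ s x).zero, (g.multiAdditive_germ s x).zero,
            Stage.Vec.pair_zero]⟩,
      fun a => tuple_comp_lift f g h.1 h.2 a⟩
  { star := CRStruct.lift f.star g.star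
    d := fun n => CRStruct.lift (f.d n) (g.d n)
    rst_d := rst_lift_d f g
    additive := fun n => (H n).1
    symm := fun n => (H n).2 }

theorem germ_of_lift {f : FaaHom P Q} {g : FaaHom P R} {k : FaaHom P (Q.prod R)}
    (h1 : k.star = lift f.star g.star) (h2 : ∀ n, k.d n = lift (f.d n) (g.d n)) {s : Stage C}
    {x : s.obj ⟶ P.pt} (h : s.Defined x k.star) (m : Multiset (s.Vec P.mon)) :
    k.germ s x m = (f.germ s x m).pair (g.germ s x m) := by
  by_cases hm : m = 0
  · subst hm
    rw [FaaHom.germ_empty, FaaHom.germ_empty, FaaHom.germ_empty, Stage.Vec.pair_zero]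
    rfl
  · have hl := Stage.defined_lift.1 (h1 ▸ h)
    exact FaaHom.germ_eq_of_forall (Φ := fun m => (f.germ s x m).pair (g.germ s x m)) h
      (fun n a => (congrArg (fun t => _ ≫ t) (h2 n)).trans (tuple_comp_lift f g hl.1 hl.2 a)) hm

end Pairing

/-! ### The axioms -/

section Axioms

variable {C : Type u} [CartRest.{v} C]

/-- A morphism whose germs are linear is determined by its base map and its linear part. -/
theorem ext_isLinearOn {P Q : FaaObj C} {f g : FaaHom P Q} {h : P.pt ⟶ Q.pt}
    {k : P.mon.carrier ⟶ Q.mon.carrier} (hf : f.IsLinearOn h k) (hg : g.IsLinearOn h k) :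
    f = g :=
  FaaHom.ext (hf.star.trans hg.star.symm) (funext fun n => (hf.d n).trans (hg.d n).symm)

namespace FaaOps

variable (S : FaaOps C) {P Q R : FaaObj C}

/-- Only the prescribed formulas for the operations are used, so the axioms below hold for every
`FaaOps`. -/
theorem germ_comp (f : FaaHom P Q) (g : FaaHom Q R) {s : Stage C} {x : s.obj ⟶ P.pt}
    (h : s.Defined x (S.comp f g).star) (m : Multiset (s.Vec P.mon)) :
    (S.comp f g).germ s x m = pcomp (g.germ s (x ≫ f.star)) (f.germ s x) m :=
  germ_of_compD (S.comp_star f g) (S.comp_d f g) h m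

theorem germ_lift (f : FaaHom P Q) (g : FaaHom P R) {s : Stage C} {x : s.obj ⟶ P.pt}
    (h : s.Defined x (S.lift f g).star) (m : Multiset (s.Vec P.mon)) :
    (S.lift f g).germ s x m = (f.germ s x m).pair (g.germ s x m) :=
  germ_of_lift (S.lift_star f g) (S.lift_d f g) h m

theorem isLinearOn_rst (f : FaaHom P Q) :
    (S.rst f).IsLinearOn (CRStruct.rst f.star) (𝟙 P.mon.carrier) := by
  refine ⟨S.rst_star f, fun n => ?_⟩
  rw [rst_comp_rst]
  by_cases hn : n = 1
  · subst hn
    rw [S.rst_d_one]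
    exact congrArg (fun t => _ ≫ t) (Category.comp_id _).symm
  · rw [S.rst_d f n hn, linPart_of_ne _ _ fun h => hn (PNat.coe_eq_one_iff.1 h)]

theorem isLinearOn_id (P : FaaObj C) : (S.id P).IsLinearOn (𝟙 P.pt) (𝟙 P.mon.carrier) :=
  (FaaHom.isLinearOn_iff_isLinear (rst_id _)).2 (S.isLinear_id P)

theorem isLinearOn_bang (P : FaaObj C) :
    (S.bang P).IsLinearOn (CRStruct.bang P.pt) (CRStruct.bang P.mon.carrier) :=
  (FaaHom.isLinearOn_iff_isLinear (rst_bang _)).2 (S.isLinear_bang P)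

theorem isLinearOn_fst (P Q : FaaObj C) :
    (S.fst P Q).IsLinearOn (CRStruct.fst P.pt Q.pt) (CRStruct.fst P.mon.carrier Q.mon.carrier) :=
  (FaaHom.isLinearOn_iff_isLinear (IsCartesianRestriction.rst_fst _ _)).2 (S.isLinear_fst P Q)

theorem isLinearOn_snd (P Q : FaaObj C) :
    (S.snd P Q).IsLinearOn (CRStruct.snd P.pt Q.pt) (CRStruct.snd P.mon.carrier Q.mon.carrier) :=
  (FaaHom.isLinearOn_iff_isLinear (IsCartesianRestriction.rst_snd _ _)).2 (S.isLinear_snd P Q)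

theorem isLin_germ_rst (f : FaaHom P Q) {s : Stage C} {x : s.obj ⟶ P.pt}
    (h : s.Defined x f.star) :
    IsLin ((S.rst f).germ s x) (Stage.Vec.map (IsMonHom.id P.mon)) :=
  (S.isLinearOn_rst f).isLin_germ (IsMonHom.id P.mon)
    (by rw [S.rst_star]; exact Stage.defined_rst.2 h)

/-- Precomposing with a linear morphism with germ `id`. -/
theorem germ_comp_of_isLin_id (f : FaaHom P P) (g : FaaHom P R) {s : Stage C} {x : s.obj ⟶ P.pt}
    (h : s.Defined x (S.comp f g).star) (hx : x ≫ f.star = x)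
    (hf : IsLin (f.germ s x) (Stage.Vec.map (IsMonHom.id P.mon))) (m : Multiset (s.Vec P.mon)) :
    (S.comp f g).germ s x m = g.germ s x m := by
  rw [S.germ_comp f g h, hx, pcomp_of_isLin_right (g.multiAdditive_germ s x).zero hf,
    Stage.Vec.multiset_map_id]

theorem germ_rst_comp (f : FaaHom P Q) (g : FaaHom P R) {s : Stage C} {x : s.obj ⟶ P.pt}
    (h : s.Defined x (S.comp (S.rst f) g).star) (m : Multiset (s.Vec P.mon)) :
    (S.comp (S.rst f) g).germ s x m = g.germ s x m := by
  have hf : s.Defined x f.star := by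
    rw [S.comp_star, S.rst_star] at h
    exact Stage.defined_rst.1 (Stage.defined_comp.1 h).1
  exact S.germ_comp_of_isLin_id _ _ h (by rw [S.rst_star, hf.comp_rst]) (S.isLin_germ_rst f hf) m

theorem id_comp (f : FaaHom P Q) : S.comp (S.id P) f = f := by
  have h1 : (S.comp (S.id P) f).star = f.star := by
    rw [S.comp_star, (S.isLinear_id P).1, Category.id_comp]
  refine FaaHom.ext_germ h1 fun s x h m _ => ?_
  refine S.germ_comp_of_isLin_id _ _ h (by rw [(S.isLinear_id P).1, Category.comp_id]) ?_ m
  refine (S.isLinearOn_id P).isLin_germ _ (Stage.Defined.of_total h.1 ?_)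
  rw [(S.isLinear_id P).1, rst_id]

/-- Postcomposing with a linear morphism. -/
theorem germ_comp_of_isLinearOn (f : FaaHom P Q) {g : FaaHom Q R} {h : Q.pt ⟶ R.pt}
    {k : Q.mon.carrier ⟶ R.mon.carrier} (hg : g.IsLinearOn h k) (hk : IsMonHom Q.mon R.mon k)
    {s : Stage C} {x : s.obj ⟶ P.pt} (hx : s.Defined x (S.comp f g).star)
    {m : Multiset (s.Vec P.mon)} (hm : m ≠ 0) :
    (S.comp f g).germ s x m = (f.germ s x m).map hk := by
  rw [S.germ_comp f g hx, pcomp_of_isLin_left (hg.isLin_germ hk ?_) _ hm]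
  rw [S.comp_star] at hx
  exact (Stage.defined_comp.1 hx).2

/-- Precomposing with a linear morphism. -/
theorem germ_isLinearOn_comp {f : FaaHom P Q} (g : FaaHom Q R) {h : P.pt ⟶ Q.pt}
    {k : P.mon.carrier ⟶ Q.mon.carrier} (hf : f.IsLinearOn h k) (hk : IsMonHom P.mon Q.mon k)
    {s : Stage C} {x : s.obj ⟶ P.pt} (hx : s.Defined x (S.comp f g).star)
    (m : Multiset (s.Vec P.mon)) :
    (S.comp f g).germ s x m = g.germ s (x ≫ f.star) (m.map (Stage.Vec.map hk)) := by
  rw [S.germ_comp f g hx, pcomp_of_isLin_right (g.multiAdditive_germ s _).zero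
    (hf.isLin_germ hk ?_)]
  rw [S.comp_star] at hx
  exact (Stage.defined_comp.1 hx).1

theorem comp_id (f : FaaHom P Q) : S.comp f (S.id Q) = f := by
  have h1 : (S.comp f (S.id Q)).star = f.star := by
    rw [S.comp_star, (S.isLinear_id Q).1, Category.comp_id]
  refine FaaHom.ext_germ h1 fun s x h m hm => ?_
  rw [S.germ_comp_of_isLinearOn f (S.isLinearOn_id Q) (IsMonHom.id _) h hm, Stage.Vec.map_id]

theorem assoc {O : FaaObj C} (f : FaaHom O P) (g : FaaHom P Q) (h : FaaHom Q R) :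
    S.comp (S.comp f g) h = S.comp f (S.comp g h) := by
  have h1 : (S.comp (S.comp f g) h).star = (S.comp f (S.comp g h)).star := by
    simp only [S.comp_star, Category.assoc]
  refine FaaHom.ext_germ h1 fun s x hx m _ => ?_
  have hx' := hx
  rw [S.comp_star] at hx'
  have hfg := (Stage.defined_comp.1 hx').1
  rw [h1, S.comp_star] at hx
  have hgh := (Stage.defined_comp.1 hx).2
  rw [S.germ_comp (S.comp f g) h (by rwa [h1, S.comp_star]),
    S.germ_comp f (S.comp g h) (by rwa [S.comp_star]),
    funext (S.germ_comp f g hfg), funext (S.germ_comp g h hgh), S.comp_star, Category.assoc]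
  exact pcomp_assoc (h.multiAdditive_germ s _) _ _ m

theorem rst_comp_self (f : FaaHom P Q) : S.comp (S.rst f) f = f := by
  have h1 : (S.comp (S.rst f) f).star = f.star := by
    rw [S.comp_star, S.rst_star, IsCartesianRestriction.rst_comp_self]
  exact FaaHom.ext_germ h1 fun s x h m _ => S.germ_rst_comp f f h m

theorem rst_comm (f : FaaHom P Q) (g : FaaHom P R) :
    S.comp (S.rst f) (S.rst g) = S.comp (S.rst g) (S.rst f) := by
  have h1 : (S.comp (S.rst f) (S.rst g)).star = (S.comp (S.rst g) (S.rst f)).star := by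
    rw [S.comp_star, S.comp_star, S.rst_star, S.rst_star, IsCartesianRestriction.rst_comm]
  refine FaaHom.ext_germ h1 fun s x h m _ => ?_
  rw [S.germ_rst_comp f _ h, S.germ_rst_comp g _ (h1 ▸ h)]
  rw [S.comp_star, S.rst_star, S.rst_star] at h
  have h2 := Stage.defined_comp.1 h
  have hf := Stage.defined_rst.1 h2.1
  have hg := Stage.defined_rst.1 h2.2
  rw [hf.comp_rst] at hg
  rw [((S.isLin_germ_rst g hg).ext (S.isLin_germ_rst f hf))]

theorem rst_rst_comp (f : FaaHom P Q) (g : FaaHom P R) :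
    S.rst (S.comp (S.rst f) g) = S.comp (S.rst f) (S.rst g) := by
  have h1 : (S.rst (S.comp (S.rst f) g)).star = (S.comp (S.rst f) (S.rst g)).star := by
    simp only [S.comp_star, S.rst_star, IsCartesianRestriction.rst_rst_comp]
  refine FaaHom.ext_germ h1 fun s x h m _ => ?_
  rw [S.germ_rst_comp f _ (h1 ▸ h)]
  have h2 : s.Defined x (S.comp (S.rst f) g).star := by
    rw [S.rst_star] at h; exact Stage.defined_rst.1 h
  have h3 := h2
  rw [S.comp_star, S.rst_star] at h3
  have hf := Stage.defined_rst.1 (Stage.defined_comp.1 h3).1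
  have hg := (Stage.defined_comp.1 h3).2
  rw [hf.comp_rst] at hg
  rw [((S.isLin_germ_rst _ h2).ext (S.isLin_germ_rst g hg))]

theorem comp_rst (f : FaaHom P Q) (g : FaaHom Q R) :
    S.comp f (S.rst g) = S.comp (S.rst (S.comp f g)) f := by
  have h1 : (S.comp f (S.rst g)).star = (S.comp (S.rst (S.comp f g)) f).star := by
    simp only [S.comp_star, S.rst_star, IsCartesianRestriction.comp_rst]
  refine FaaHom.ext_germ h1 fun s x h m hm => ?_
  rw [S.germ_comp_of_isLinearOn f (S.isLinearOn_rst g) (IsMonHom.id _) h hm, Stage.Vec.map_id,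
    S.germ_rst_comp _ _ (h1 ▸ h)]

/-- A restriction is linear with identity linear part, so its base map determines it. -/
theorem rst_eq_id {f : FaaHom P Q} (hf : CRStruct.rst f.star = 𝟙 _) : S.rst f = S.id P :=
  ext_isLinearOn (S.isLinearOn_rst f) (hf ▸ S.isLinearOn_id P)

theorem comp_bang (f : FaaHom P Q) : S.comp f (S.bang Q) = S.comp (S.rst f) (S.bang P) := by
  have h1 : (S.comp f (S.bang Q)).star = (S.comp (S.rst f) (S.bang P)).star := by
    rw [S.comp_star, S.comp_star, S.rst_star, (S.isLinear_bang P).1, (S.isLinear_bang Q).1]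
    exact IsCartesianRestriction.comp_bang f.star
  exact FaaHom.ext_germ h1 fun s x _ m _ => Stage.Vec.unit_ext _ _

theorem lift_fst (f : FaaHom P Q) (g : FaaHom P R) :
    S.comp (S.lift f g) (S.fst Q R) = S.comp (S.rst g) f := by
  have h1 : (S.comp (S.lift f g) (S.fst Q R)).star = (S.comp (S.rst g) f).star := by
    rw [S.comp_star, S.comp_star, S.rst_star, (S.isLinear_fst Q R).1, S.lift_star]
    exact IsCartesianRestriction.lift_fst f.star g.star
  refine FaaHom.ext_germ h1 fun s x h m hm => ?_
  have h2 := h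
  rw [S.comp_star] at h2
  rw [S.germ_comp_of_isLinearOn _ (S.isLinearOn_fst Q R) (isMonHom_fst _ _) h hm,
    S.germ_rst_comp _ _ (h1 ▸ h), S.germ_lift f g (Stage.defined_comp.1 h2).1]
  exact Stage.Vec.fst_pair _ _

theorem lift_snd (f : FaaHom P Q) (g : FaaHom P R) :
    S.comp (S.lift f g) (S.snd Q R) = S.comp (S.rst f) g := by
  have h1 : (S.comp (S.lift f g) (S.snd Q R)).star = (S.comp (S.rst f) g).star := by
    rw [S.comp_star, S.comp_star, S.rst_star, (S.isLinear_snd Q R).1, S.lift_star]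
    exact IsCartesianRestriction.lift_snd f.star g.star
  refine FaaHom.ext_germ h1 fun s x h m hm => ?_
  have h2 := h
  rw [S.comp_star] at h2
  rw [S.germ_comp_of_isLinearOn _ (S.isLinearOn_snd Q R) (isMonHom_snd _ _) h hm,
    S.germ_rst_comp _ _ (h1 ▸ h), S.germ_lift f g (Stage.defined_comp.1 h2).1]
  exact Stage.Vec.snd_pair _ _

theorem lift_unique (f : FaaHom P Q) (g : FaaHom P R) (h : FaaHom P (Q.prod R))
    (hf : S.comp h (S.fst Q R) = S.comp (S.rst g) f)
    (hg : S.comp h (S.snd Q R) = S.comp (S.rst f) g) : h = S.lift f g := by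
  have hf' := congrArg FaaHom.star hf
  have hg' := congrArg FaaHom.star hg
  rw [S.comp_star, S.comp_star, (S.isLinear_fst Q R).1, S.rst_star] at hf'
  rw [S.comp_star, S.comp_star, (S.isLinear_snd Q R).1, S.rst_star] at hg'
  have h1 : h.star = (S.lift f g).star := by
    rw [S.lift_star]
    exact IsCartesianRestriction.lift_unique _ _ _ hf' hg'
  refine FaaHom.ext_germ h1 fun s x hx m hm => ?_
  have hx1 : s.Defined x (S.comp h (S.fst Q R)).star := by
    rw [S.comp_star, (S.isLinear_fst Q R).1]
    refine Stage.defined_comp.2 ⟨hx, Stage.Defined.of_total ?_ (rst_fst _ _)⟩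
    exact hx.2
  have hx2 : s.Defined x (S.comp h (S.snd Q R)).star := by
    rw [S.comp_star, (S.isLinear_snd Q R).1]
    refine Stage.defined_comp.2 ⟨hx, Stage.Defined.of_total ?_ (rst_snd _ _)⟩
    exact hx.2
  rw [S.germ_lift f g (h1 ▸ hx)]
  apply Stage.Vec.prod_ext
  · rw [Stage.Vec.fst_pair, ← S.germ_rst_comp g f (hf ▸ hx1), ← hf]
    exact (S.germ_comp_of_isLinearOn _ (S.isLinearOn_fst Q R) (isMonHom_fst _ _) hx1 hm).symm
  · rw [Stage.Vec.snd_pair, ← S.germ_rst_comp f g (hg ▸ hx2), ← hg]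
    exact (S.germ_comp_of_isLinearOn _ (S.isLinearOn_snd Q R) (isMonHom_snd _ _) hx2 hm).symm

/-- `Faà(C)` is a Cartesian restriction category. -/
theorem isCartesianRestriction : @IsCartesianRestriction (FaaObj C) S.toCRStruct :=
  letI := S.toCRStruct
  { id_comp := S.id_comp
    comp_id := S.comp_id
    assoc := S.assoc
    rst_comp_self := S.rst_comp_self
    rst_comm := S.rst_comm
    rst_rst_comp := S.rst_rst_comp
    comp_rst := S.comp_rst
    rst_bang := fun P => S.rst_eq_id
      ((congrArg CRStruct.rst (S.isLinear_bang P).1).trans (rst_bang _))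
    bang_one := ext_isLinearOn (S.isLinearOn_bang (FaaObj.unit C)) (by
      have h := S.isLinearOn_id (FaaObj.unit C)
      have e : CRStruct.bang (one : C) = 𝟙 one := IsCartesianRestriction.bang_one
      exact ⟨h.star.trans e.symm, fun n => (h.d n).trans (by
        change CRStruct.rst (last one one n ≫ 𝟙 (one : C)) ≫ linPart (A := TotalCommMon.unit C)
          (B := TotalCommMon.unit C) one (𝟙 (one : C)) n = _
        rw [← e]
        rfl)⟩)
    comp_bang := S.comp_bang
    rst_fst := fun P Q => S.rst_eq_id
      ((congrArg CRStruct.rst (S.isLinear_fst P Q).1).trans (rst_fst _ _))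
    rst_snd := fun P Q => S.rst_eq_id
      ((congrArg CRStruct.rst (S.isLinear_snd P Q).1).trans (rst_snd _ _))
    lift_fst := S.lift_fst
    lift_snd := S.lift_snd
    lift_unique := S.lift_unique }

end FaaOps

variable (C) in
/-- The Cartesian restriction structure of `Faà(C)`. -/
noncomputable def faaStr : FaaStr C :=
  let S : FaaOps C :=
    { id := fun P => FaaHom.linear (𝟙 P.pt) (IsMonHom.id P.mon)
      isLinear_id := fun P =>
        (FaaHom.isLinearOn_iff_isLinear (rst_id _)).1 (FaaHom.isLinearOn_linear _ _)
      comp := FaaHom.comp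
      comp_star := fun _ _ => rfl
      comp_d := fun _ _ _ => rfl
      rst := FaaHom.rst
      rst_star := fun _ => rfl
      rst_d_one := fun {P Q} f => by
        have h : ∀ {A B : C} (k : A ⟶ B), k ≫ 𝟙 B = k := fun k => Category.comp_id k
        have h1 := rst_comp_rst (last P.mon.carrier P.pt 1) f.star
        have h2 := h (proj P.mon.carrier P.pt 1 0)
        exact (congrArg (fun t => t ≫ _) h1).trans (congrArg (fun t => _ ≫ t) h2)
      rst_d := fun {P Q} f n hn => by
        have h1 := rst_comp_rst (last P.mon.carrier P.pt n) f.star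
        have h2 := linPart_of_ne (A := P.mon) (B := P.mon) P.pt (𝟙 _)
          fun h => hn (PNat.coe_eq_one_iff.1 h)
        exact (congrArg (fun t => t ≫ _) h1).trans (congrArg (fun t => _ ≫ t) h2)
      bang := fun P => FaaHom.linear (CRStruct.bang P.pt) (isMonHom_bang P.mon)
      isLinear_bang := fun P =>
        (FaaHom.isLinearOn_iff_isLinear (rst_bang _)).1 (FaaHom.isLinearOn_linear _ _)
      fst := fun P Q => FaaHom.linear (P := P.prod Q) (CRStruct.fst P.pt Q.pt)
        (isMonHom_fst P.mon Q.mon)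
      isLinear_fst := fun P Q =>
        (FaaHom.isLinearOn_iff_isLinear (rst_fst _ _)).1 (FaaHom.isLinearOn_linear _ _)
      snd := fun P Q => FaaHom.linear (P := P.prod Q) (CRStruct.snd P.pt Q.pt)
        (isMonHom_snd P.mon Q.mon)
      isLinear_snd := fun P Q =>
        (FaaHom.isLinearOn_iff_isLinear (rst_snd _ _)).1 (FaaHom.isLinearOn_linear _ _)
      lift := FaaHom.lift
      lift_star := fun _ _ => rfl
      lift_d := fun _ _ _ => rfl }
  { toFaaOps := S
    isCartesianRestriction := S.isCartesianRestriction }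

end Axioms

/-! ### `Faà` on functors -/

section Additivity

variable {C : Type u} [CartRest.{v} C]

theorem univ_val_map_cons {α : Type*} {n : ℕ} (b : α) (a : Fin n → α) :
    (Finset.univ : Finset (Fin (n + 1))).val.map (Fin.cons b a : Fin (n + 1) → α) =
      b ::ₘ Finset.univ.val.map a := by
  rw [univ_val_map_succ]
  rfl

/-- A symmetric map that is additive in its first variable over stages is additive. -/
theorem additive_of_symm {A B : TotalCommMon C} {X Y : C} {n : ℕ}
    {h : CRStruct.prod A.carrier (pow A.carrier X n) ⟶ B.carrier} {k : X ⟶ Y}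
    (hk : rst h = rst (last A.carrier X (n + 1) ≫ k))
    (hs : IsSymm A.carrier X B.carrier (n + 1) h)
    (H : ∀ (s : Stage C) (x : s.obj ⟶ X) (a : Fin n → s.Vec A),
      rst x = s.idem → rst (x ≫ k) = s.idem →
      (∀ b c : s.Vec A, lift (b + c).val (tuple (fun i => (a i).val) x) ≫ h =
        lift b.val (tuple (fun i => (a i).val) x) ≫ h +
          lift c.val (tuple (fun i => (a i).val) x) ≫ h) ∧
      lift (0 : s.Vec A).val (tuple (fun i => (a i).val) x) ≫ h = s.idem ≫ 0) :
    IsAdditive A X B (n + 1) h := by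
  classical
  refine (additive_symm_of_stage hk fun s x hx hxk => ?_).1
  have R : ∀ a : Fin (n + 1) → s.Vec A, rst (tuple (n := n + 1) (fun i => (a i).val) x ≫ h) = s.idem := fun a => by
    have h1 := rst_tuple_comp_of_rst (n := n + 1) (fun i => (a i).val) x hk
    rw [hxk, rst_tuple (fun i => (a i).rst_val) hx, s.idem_idem] at h1
    exact h1
  -- The value at a multiset is computed from a chosen enumeration, which is harmless by symmetry;
  -- multisets of the wrong size get `0`.
  let Φ : Multiset (s.Vec A) → s.Vec B := fun m =>
    if hm : ∃ a : Fin (n + 1) → s.Vec A, Finset.univ.val.map a = m then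
      ⟨tuple (n := n + 1) (fun i => (hm.choose i).val) x ≫ h, R _⟩ else 0
  have e1 : ∀ a : Fin (n + 1) → s.Vec A,
      tuple (n := n + 1) (fun i => (a i).val) x ≫ h = (Φ (Finset.univ.val.map a)).val := by
    intro a
    have hm : ∃ a' : Fin (n + 1) → s.Vec A, Finset.univ.val.map a' = Finset.univ.val.map a := ⟨a, rfl⟩
    obtain ⟨σ, hσ⟩ := exists_perm_of_map_eq hm.choose_spec
    have hΦ : Φ (Finset.univ.val.map a) = ⟨tuple (n := n + 1) (fun i => (hm.choose i).val) x ≫ h, R _⟩ :=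
      dif_pos hm
    rw [hΦ]
    change _ = tuple (n := n + 1) (fun i => (hm.choose i).val) x ≫ h
    rw [← hs _ (fun i => (hm.choose i).val) x σ]
    simp only [hσ]
  have e2 : ∀ m : Multiset (s.Vec A), Multiset.card m ≠ n + 1 → Φ m = 0 := by
    intro m hm
    refine dif_neg ?_
    rintro ⟨a, rfl⟩
    simp at hm
  have e3 : ∀ (b : s.Vec A) (a : Fin n → s.Vec A), (Φ (b ::ₘ Finset.univ.val.map a)).val =
      lift b.val (tuple (fun i => (a i).val) x) ≫ h := by
    intro b a
    rw [← univ_val_map_cons, ← e1]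
    rfl
  refine ⟨Φ, ⟨fun b c t => ?_, fun t => ?_⟩, e1⟩
  · by_cases ht : Multiset.card t = n
    · subst ht
      obtain ⟨a, ha⟩ := FaaHom.exists_fin_eq t
      rw [ha]
      apply Stage.Vec.ext
      rw [Stage.Vec.val_add, e3, e3, e3]
      exact (H s x a hx hxk).1 b c
    · rw [e2, e2, e2, add_zero] <;> simpa using ht
  · by_cases ht : Multiset.card t = n
    · subst ht
      obtain ⟨a, ha⟩ := FaaHom.exists_fin_eq t
      rw [ha]
      apply Stage.Vec.ext
      rw [e3]
      exact (H s x a hx hxk).2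
    · rw [e2]; simpa using ht

theorem tuple_comp_reindex {T A X : C} {m n : ℕ} (φ : Fin m → Fin n) (a : Fin n → (T ⟶ A))
    (x : T ⟶ X) : tuple a x ≫ tuple (fun i => proj A X n (φ i)) (last A X n) =
      rst (tuple a x) ≫ tuple (fun i => a (φ i)) x := by
  rw [comp_tuple, comp_tuple, tuple_last]
  simp only [tuple_proj]

/-- Substituting a tuple of partial maps into the generic identity gives equality only on the domain
of the tuple. Applying this to a permutation and to its inverse bounds both sides by each other. -/
theorem isSymm_of_universal {A X B : C} {n : ℕ} {h : pow A X n ⟶ B}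
    (H : ∀ σ : Equiv.Perm (Fin n), tuple (fun i => proj A X n (σ i)) (last A X n) ≫ h = h) :
    IsSymm A X B n h := by
  intro T a x σ
  have key : ∀ (a : Fin n → (T ⟶ A)) (σ : Equiv.Perm (Fin n)),
      rst (tuple a x) ≫ tuple (fun i => a (σ i)) x ≫ h = tuple a x ≫ h := by
    intro a σ
    rw [← Category.assoc, ← tuple_comp_reindex, Category.assoc, H]
  have key' := key (fun i => a (σ i)) σ.symm
  simp only [Equiv.apply_symm_apply] at key'
  calc tuple (fun i => a (σ i)) x ≫ h
      = rst (tuple (fun i => a (σ i)) x) ≫ rst (tuple a x) ≫ tuple (fun i => a (σ i)) x ≫ h := by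
        rw [key a σ, key']
    _ = rst (tuple a x) ≫ rst (tuple (fun i => a (σ i)) x) ≫ tuple (fun i => a (σ i)) x ≫ h := by
        rw [← Category.assoc, rst_comm, Category.assoc]
    _ = tuple a x ≫ h := by
        rw [← Category.assoc (rst (tuple (fun i => a (σ i)) x)), rst_comp_self, key a σ]

end Additivity

/-! ### Strict functors and powers -/

section MapPow

variable {C : Type u} [CartRest.{v} C] {D : Type u'} [CartRest.{v'} D] (F : StrictFunctor C D)

theorem rst_eqToHom {X Y : C} (e : X = Y) : rst (eqToHom e) = 𝟙 X := by
  subst e; exact rst_id _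

theorem lift_comp_eqToHom {T X Y Y' : C} (f : T ⟶ X) (g : T ⟶ Y) (e : Y = Y') :
    lift f g ≫ eqToHom (congrArg (CRStruct.prod X) e) = lift f (g ≫ eqToHom e) := by
  subst e; simp

namespace StrictFunctor

/-- `F f`, as a map into the monoid `F A`. -/
def mapTo (A : TotalCommMon C) {T : C} (f : T ⟶ A.carrier) :
    F.obj T ⟶ (F.mapMon A).carrier := F.map f

theorem mapTo_add {A : TotalCommMon C} {T : C} (a b : T ⟶ A.carrier) :
    F.mapTo A (a + b) = F.mapTo A a + F.mapTo A b := by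
  have h : F.map (lift a b ≫ A.add) =
      lift (F.map a) (F.map b) ≫ eqToHom (F.obj_prod _ _).symm ≫ F.map A.add := by
    rw [F.map_comp, F.map_lift, Category.assoc]
  exact h

theorem mapTo_zero (A : TotalCommMon C) (T : C) : F.mapTo A (0 : T ⟶ A.carrier) = 0 := by
  have h : F.map (bang T ≫ A.zero) = bang (F.obj T) ≫ eqToHom F.obj_one.symm ≫ F.map A.zero := by
    rw [F.map_comp, F.map_bang, Category.assoc]
  exact h

theorem mapTo_rst_comp {A B : TotalCommMon C} {T : C} (f : T ⟶ A.carrier) (g : T ⟶ B.carrier) :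
    F.mapTo A (rst g ≫ f) = rst (F.mapTo B g) ≫ F.mapTo A f := by
  have h : F.map (rst g ≫ f) = rst (F.map g) ≫ F.map f := by rw [F.map_comp, F.map_rst]
  exact h

theorem map_tuple {T A X : C} {n : ℕ} (a : Fin n → (T ⟶ A)) (x : T ⟶ X) :
    F.map (tuple a x) ≫ eqToHom (F.obj_pow A X n) = tuple (fun i => F.map (a i)) (F.map x) := by
  induction n with
  | zero => exact Category.comp_id _
  | succ n ih =>
    have h1 : F.map (lift (a 0) (tuple (fun i => a i.succ) x)) ≫
        eqToHom ((F.obj_prod A (pow A X n)).trans (congrArg (CRStruct.prod (F.obj A))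
          (F.obj_pow A X n))) = lift (F.map (a 0)) (tuple (fun i => F.map (a i.succ)) (F.map x)) := by
      rw [← ih, ← lift_comp_eqToHom, F.map_lift, Category.assoc, eqToHom_trans]
    exact h1

/-- The map `A^n × X ⟶ B` in `D` obtained from `h : A^n × X ⟶ B` in `C`. -/
def mapPow {A X B : C} {n : ℕ} (h : pow A X n ⟶ B) : pow (F.obj A) (F.obj X) n ⟶ F.obj B :=
  eqToHom (F.obj_pow A X n).symm ≫ F.map h

theorem tuple_comp_mapPow {T A X B : C} {n : ℕ} (h : pow A X n ⟶ B) (a : Fin n → (T ⟶ A))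
    (x : T ⟶ X) :
    tuple (fun i => F.map (a i)) (F.map x) ≫ F.mapPow h = F.map (tuple a x ≫ h) := by
  rw [← map_tuple, mapPow, Category.assoc, ← Category.assoc (eqToHom _), eqToHom_trans,
    eqToHom_refl, Category.id_comp, F.map_comp]

theorem mapPow_tuple_comp {A X A' X' B : C} {m n : ℕ} (h : pow A' X' n ⟶ B)
    (a : Fin n → (pow A X m ⟶ A')) (x : pow A X m ⟶ X') :
    F.mapPow (tuple a x ≫ h) =
      tuple (fun i => F.mapPow (a i)) (F.mapPow x) ≫ F.mapPow h := by
  rw [mapPow, ← tuple_comp_mapPow, ← Category.assoc, comp_tuple]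
  rfl

theorem rst_mapPow {A X B Y : C} {n : ℕ} {h : pow A X n ⟶ B} {k : pow A X n ⟶ Y}
    (e : rst h = rst k) : rst (F.mapPow h) = rst (F.mapPow k) := by
  have h1 : ∀ {B : C} (h : pow A X n ⟶ B), rst (F.mapPow h) =
      rst (eqToHom (F.obj_pow A X n).symm ≫ F.map (rst h)) := fun h => by
    rw [F.map_rst, rst_comp_rst]; rfl
  rw [h1, h1, e]

theorem tuple_map_proj (A X : C) (n : ℕ) :
    tuple (fun i => F.map (proj A X n i)) (F.map (last A X n)) = eqToHom (F.obj_pow A X n) := by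
  rw [← map_tuple, tuple_proj_last, F.map_id, Category.id_comp]

theorem eqToHom_comp_proj (A X : C) (n : ℕ) (i : Fin n) :
    eqToHom (F.obj_pow A X n) ≫ proj (F.obj A) (F.obj X) n i = F.map (proj A X n i) := by
  rw [← tuple_map_proj, tuple_proj, tuple_map_proj, rst_eqToHom, Category.id_comp]

theorem eqToHom_comp_last (A X : C) (n : ℕ) :
    eqToHom (F.obj_pow A X n) ≫ last (F.obj A) (F.obj X) n = F.map (last A X n) := by
  rw [← tuple_map_proj, tuple_last, tuple_map_proj, rst_eqToHom, Category.id_comp]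

theorem mapPow_proj (A X : C) (n : ℕ) (i : Fin n) :
    F.mapPow (proj A X n i) = proj (F.obj A) (F.obj X) n i := by
  rw [mapPow, ← eqToHom_comp_proj, ← Category.assoc, eqToHom_trans, eqToHom_refl,
    Category.id_comp]

theorem mapPow_last (A X : C) (n : ℕ) :
    F.mapPow (last A X n) = last (F.obj A) (F.obj X) n := by
  rw [mapPow, ← eqToHom_comp_last, ← Category.assoc, eqToHom_trans, eqToHom_refl,
    Category.id_comp]

theorem mapPow_comp {A X B B' : C} {n : ℕ} (h : pow A X n ⟶ B) (k : B ⟶ B') :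
    F.mapPow (h ≫ k) = F.mapPow h ≫ F.map k := by
  rw [mapPow, mapPow, F.map_comp, Category.assoc]

theorem mapPow_rst_comp {A X B Y : C} {n : ℕ} (h : pow A X n ⟶ B) (k : pow A X n ⟶ Y) :
    F.mapPow (rst k ≫ h) = rst (F.mapPow k) ≫ F.mapPow h := by
  rw [mapPow, F.map_comp, F.map_rst, ← Category.assoc, IsCartesianRestriction.comp_rst,
    Category.assoc]
  rfl

/-- `F.mapPow h`, as a map into the monoid `F B`. -/
def mapPowTo {A X : C} (B : TotalCommMon C) {n : ℕ} (h : pow A X n ⟶ B.carrier) :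
    pow (F.obj A) (F.obj X) n ⟶ (F.mapMon B).carrier := F.mapPow h

theorem mapPowTo_add {A X : C} {B : TotalCommMon C} {n : ℕ} (h k : pow A X n ⟶ B.carrier) :
    F.mapPowTo B (h + k) = F.mapPowTo B h + F.mapPowTo B k :=
  (congrArg (fun t => _ ≫ t) (F.mapTo_add h k)).trans ((F.mapMon B).comp_add _ _ _)

theorem mapPowTo_zero (A X : C) (B : TotalCommMon C) (n : ℕ) :
    F.mapPowTo B (0 : pow A X n ⟶ B.carrier) = 0 := by
  have h : rst (eqToHom (F.obj_pow A X n).symm) ≫ (0 : _ ⟶ (F.mapMon B).carrier) = 0 := by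
    rw [rst_eqToHom, Category.id_comp]
  exact (congrArg (fun t => _ ≫ t) (F.mapTo_zero B _)).trans (((F.mapMon B).comp_zero _).trans h)

theorem mapPowTo_sum {A X : C} {B : TotalCommMon C} {n : ℕ} {ι : Type*} (S : Finset ι)
    (h : ι → (pow A X n ⟶ B.carrier)) :
    F.mapPowTo B (∑ i ∈ S, h i) = ∑ i ∈ S, F.mapPowTo B (h i) :=
  _root_.map_sum (⟨⟨F.mapPowTo B, F.mapPowTo_zero A X B n⟩, F.mapPowTo_add⟩ :
    (pow A X n ⟶ B.carrier) →+ (pow (F.obj A) (F.obj X) n ⟶ (F.mapMon B).carrier)) h S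

/-- Tuples in `D` need not come from `C`, but the generic tuple of projections does. -/
theorem isSymm_mapPow {A X B : C} {n : ℕ} {h : pow A X n ⟶ B} (hh : IsSymm A X B n h) :
    IsSymm (F.obj A) (F.obj X) (F.obj B) n (F.mapPow h) := by
  refine isSymm_of_universal fun σ => ?_
  have h1 := hh _ (proj A X n) (last A X n) σ
  rw [tuple_proj_last, Category.id_comp] at h1
  have h2 := F.mapPow_tuple_comp h (fun i => proj A X n (σ i)) (last A X n)
  simp only [mapPow_proj, mapPow_last] at h2
  rw [← h2, h1]

/-- Two maps of `D` with equal domains factor jointly through the image of a product of `C`, so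
identities between projections in `C` can be transferred to arbitrary maps of `D`. -/
theorem exists_comp_map_fst_snd {T : D} {X Y : C} (p : T ⟶ F.obj X) (q : T ⟶ F.obj Y)
    (h : rst p = rst q) : ∃ w : T ⟶ F.obj (CRStruct.prod X Y),
      w ≫ F.map (fst X Y) = p ∧ w ≫ F.map (snd X Y) = q ∧ rst w = rst p := by
  have e : ∀ {Z : D} (k : CRStruct.prod (F.obj X) (F.obj Y) ⟶ Z),
      (lift p q ≫ eqToHom (F.obj_prod X Y).symm) ≫ eqToHom (F.obj_prod X Y) ≫ k =
        lift p q ≫ k := fun k => by simp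
  refine ⟨lift p q ≫ eqToHom (F.obj_prod X Y).symm, ?_, ?_, ?_⟩
  · rw [F.map_fst, e, lift_fst, ← h, rst_comp_self]
  · rw [F.map_snd, e, lift_snd, h, rst_comp_self]
  · rw [rst_total_comp _ _ (rst_eqToHom _), rst_lift, ← h, FaaRes.rst_idem]

/-- Additivity is an equation between maps out of `A × (A × Z)` in `C`; its image under `F` is
evaluated at the map `w` with coordinates `b`, `c`, `t`. The object `W` is kept as a variable equal
to `F.obj Z`, so that the casts disappear by substitution. -/
theorem mapTo_comp_additive {A B : TotalCommMon C} {Z : C}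
    {h : CRStruct.prod A.carrier Z ⟶ B.carrier}
    (h1 : ∀ {T : C} (b c : T ⟶ A.carrier) (z : T ⟶ Z),
      lift (b + c) z ≫ h = lift b z ≫ h + lift c z ≫ h)
    (h2 : lift 0 (𝟙 Z) ≫ h = rst (lift 0 (𝟙 Z) ≫ h) ≫ 0) {W : D} (e : F.obj Z = W)
    {k : CRStruct.prod (F.mapMon A).carrier W ⟶ (F.mapMon B).carrier}
    (e' : CRStruct.prod (F.mapMon A).carrier W = F.obj (CRStruct.prod A.carrier Z))
    (hk : k = eqToHom e' ≫ F.mapTo B h) {T : D} (b c : T ⟶ (F.mapMon A).carrier) (t : T ⟶ W)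
    (hb : rst b = rst t) (hc : rst c = rst t)
    {o : T ⟶ (F.mapMon A).carrier} (ho : o = rst t ≫ 0) :
    lift (b + c) t ≫ k = lift b t ≫ k + lift c t ≫ k ∧
      lift o t ≫ k = rst (lift o t ≫ k) ≫ 0 := by
  subst e ho
  have hl : ∀ {U : C} (y : U ⟶ A.carrier) (z : U ⟶ Z),
      F.mapTo B (lift y z ≫ h) = lift (F.mapTo A y) (F.map z) ≫ k := by
    intro U y z
    have h3 := F.map_comp (lift y z) h
    rw [F.map_lift, Category.assoc] at h3
    rw [hk]
    exact h3
  obtain ⟨w1, w2, w3, w4⟩ := F.exists_comp_map_fst_snd (X := A.carrier) c t hc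
  obtain ⟨w, v1, v2, v3⟩ := F.exists_comp_map_fst_snd (X := A.carrier) b w1 ((hb.trans hc.symm).trans w4.symm)
  have v4 : w ≫ F.mapTo A (snd _ _ ≫ fst A.carrier Z) = c := by
    have h3 := F.map_comp (snd A.carrier _) (fst A.carrier Z)
    refine (congrArg (fun t => w ≫ t) h3).trans ?_
    rw [← Category.assoc, v2, w2]
  have v5 : w ≫ F.map (snd A.carrier _ ≫ snd A.carrier Z) = t := by
    rw [F.map_comp, ← Category.assoc, v2, w3]
  have v1' : w ≫ F.mapTo A (fst A.carrier _) = b := v1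
  constructor
  · have h3 : F.mapTo B (lift (fst A.carrier _ + snd _ _ ≫ fst A.carrier Z)
        (snd A.carrier _ ≫ snd A.carrier Z) ≫ h) = _ := congrArg (F.mapTo B)
      (h1 (fst A.carrier _) (snd _ _ ≫ fst A.carrier Z) (snd A.carrier _ ≫ snd A.carrier Z))
    rw [hl, mapTo_add, mapTo_add, hl, hl] at h3
    have h4 := congrArg (fun m => w ≫ m) h3
    simp only [TotalCommMon.comp_add] at h4
    rw [← Category.assoc, ← Category.assoc, ← Category.assoc, comp_lift, comp_lift, comp_lift,
      TotalCommMon.comp_add, v1', v4, v5] at h4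
    exact h4
  · have h3 := congrArg (F.mapTo B) h2
    rw [mapTo_rst_comp, mapTo_zero, hl, mapTo_zero, F.map_id] at h3
    have h4 : lift (rst t ≫ 0) t ≫ k = t ≫ lift 0 (𝟙 _) ≫ k := by
      rw [← Category.assoc, comp_lift, (F.mapMon A).comp_zero t, Category.comp_id]
    rw [h4]
    conv_lhs => rw [h3]
    rw [← Category.assoc, IsCartesianRestriction.comp_rst, Category.assoc,
      TotalCommMon.comp_zero, ← Category.assoc, rst_comp_rst_left]

end StrictFunctor

theorem tuple_update_zero {T A X : C} {n : ℕ} (a : Fin (n + 1) → (T ⟶ A)) (y : T ⟶ A)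
    (x : T ⟶ X) : tuple (Function.update a 0 y) x = lift y (tuple (fun j => a j.succ) x) := by
  change lift (Function.update a 0 y 0) (tuple (fun j => Function.update a 0 y j.succ) x) = _
  rw [Function.update_self]
  congr 2

/-- By symmetry only the first variable matters, and over a stage all domains agree, as
`mapTo_comp_additive` requires. -/
theorem StrictFunctor.isAdditive_mapPow {A B : TotalCommMon C} {X Y : C} {n : ℕ}
    {h : pow A.carrier X n ⟶ B.carrier} {k : X ⟶ Y} (hk : rst h = rst (last A.carrier X n ≫ k))
    (hs : IsSymm A.carrier X B.carrier n h) (ha : IsAdditive A X B n h) :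
    IsAdditive (F.mapMon A) (F.obj X) (F.mapMon B) n (F.mapPow h) := by
  cases n with
  | zero => exact fun _ _ _ i => i.elim0
  | succ m =>
    refine additive_of_symm (k := F.map k) ?_ (F.isSymm_mapPow hs) fun s x a hx hxk => ?_
    · have h1 := F.rst_mapPow hk
      rw [F.mapPow_comp, F.mapPow_last] at h1
      exact h1
    have ht : rst (tuple (fun i => (a i).val) x) = s.idem :=
      rst_tuple (fun i => (a i).rst_val) hx
    have u1 : ∀ {T : C} (b c : T ⟶ A.carrier) (z : T ⟶ pow A.carrier X m),
        lift (b + c) z ≫ h = lift b z ≫ h + lift c z ≫ h := by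
      intro T b c z
      have h1 := (ha T (Fin.cons b fun i => z ≫ proj _ _ m i) (z ≫ last _ _ m) 0).1 b c
      simp only [tuple_update_zero, Fin.cons_succ, ← comp_tuple, tuple_proj_last] at h1
      have h2 := Category.comp_id z
      rw [h2] at h1
      exact h1
    have u2 : lift 0 (𝟙 (pow A.carrier X m)) ≫ h =
        rst (lift 0 (𝟙 (pow A.carrier X m)) ≫ h) ≫ 0 := by
      have h1 := (ha _ (Fin.cons 0 (proj A.carrier X m)) (last _ _ m) 0).2
      simp only [tuple_update_zero, Fin.cons_succ, tuple_proj_last] at h1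
      exact h1
    have key := fun b c : s.Vec (F.mapMon A) => F.mapTo_comp_additive u1 u2
      (F.obj_pow A.carrier X m) (F.obj_pow A.carrier X (m + 1)).symm rfl b.val c.val
      (tuple (fun i => (a i).val) x) (b.rst_val.trans ht.symm) (c.rst_val.trans ht.symm)
      (o := (0 : s.Vec (F.mapMon A)).val) (congrArg (fun t => t ≫ 0) ht.symm)
    refine ⟨fun b c => (key b c).1, ?_⟩
    have h0 := (key 0 0).2
    refine h0.trans (congrArg (fun t => t ≫ 0) ?_)
    have h1 := F.rst_mapPow hk
    rw [F.mapPow_comp, F.mapPow_last] at h1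
    have h2 := rst_tuple_comp_of_rst (n := m + 1)
      (Fin.cons (s.idem ≫ (0 : _ ⟶ (F.mapMon A).carrier)) fun i => (a i).val) x h1
    refine h2.trans ?_
    rw [hxk, rst_tuple (e := s.idem) (Fin.cases ?_ ?_) hx, s.idem_idem]
    · exact (0 : s.Vec (F.mapMon A)).rst_val
    · exact fun i => (a i).rst_val

end MapPow

/-! ### `Faà(F)` as a strict functor, and the counit -/

section FaaMap

variable {C : Type u} [CartRest.{v} C] {D : Type u'} [CartRest.{v'} D] (F : StrictFunctor C D)
  {P Q R : FaaObj C}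

namespace StrictFunctor

/-- The action of `Faà(F)` on morphisms. -/
def mapHom (f : FaaHom P Q) : FaaHom (F.mapObj P) (F.mapObj Q) where
  star := F.map f.star
  d n := F.mapPow (f.d n)
  rst_d n := by
    have h1 := F.rst_mapPow (f.rst_d n)
    rw [F.mapPow_comp, F.mapPow_last] at h1
    exact h1
  additive n := F.isAdditive_mapPow (f.rst_d n) (f.symm n) (f.additive n)
  symm n := F.isSymm_mapPow (f.symm n)

/-- Additivity on the generic pair of projections transfers to all pairs with equal domains. -/
theorem isMonHom_map {A B : TotalCommMon C} {k : A.carrier ⟶ B.carrier} (hk : IsMonHom A B k) :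
    IsMonHom (F.mapMon A) (F.mapMon B) (F.map k) where
  total := by
    have h : rst (F.map k) = 𝟙 (F.obj A.carrier) := by rw [← F.map_rst, hk.total, F.map_id]
    exact h
  map_add {T} a b := by
    let k' : (F.mapMon A).carrier ⟶ (F.mapMon B).carrier := F.map k
    change (a + b) ≫ k' = a ≫ k' + b ≫ k'
    have hc : ∀ {U : C} (f : U ⟶ A.carrier), F.mapTo B (f ≫ k) = F.mapTo A f ≫ k' :=
      fun f => F.map_comp f k
    have h1 := congrArg (F.mapTo B) (hk.map_add (fst A.carrier A.carrier) (snd _ _))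
    rw [hc, mapTo_add, mapTo_add, hc, hc] at h1
    have key : ∀ (a b : T ⟶ (F.mapMon A).carrier), rst a = rst b →
        (a + b) ≫ k' = a ≫ k' + b ≫ k' := by
      intro a b hab
      obtain ⟨w, w1, w2, -⟩ := F.exists_comp_map_fst_snd (X := A.carrier) (Y := A.carrier) a b hab
      have w1' : w ≫ F.mapTo A (fst A.carrier _) = a := w1
      have w2' : w ≫ F.mapTo A (snd A.carrier _) = b := w2
      have h2 := congrArg (fun t => w ≫ t) h1
      simp only [TotalCommMon.comp_add] at h2
      rw [← Category.assoc, TotalCommMon.comp_add, ← Category.assoc, ← Category.assoc, w1',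
        w2'] at h2
      exact h2
    -- An arbitrary pair is first cut down to its common domain, which changes neither side of the
    -- equation.
    have h3 := key (rst b ≫ a) (rst a ≫ b) (by rw [rst_rst_comp, rst_rst_comp, rst_comm])
    have h4 : ∀ {A : TotalCommMon D} (a b : T ⟶ A.carrier) {Y Z : D} (e : T ⟶ Y) (e' : T ⟶ Z),
        rst e ≫ a + rst e' ≫ b = rst e ≫ rst e' ≫ (a + b) := by
      intro A a b Y Z e e'
      rw [TotalCommMon.hom_add_def, TotalCommMon.hom_add_def, rst_lift_left, rst_lift_right,
        Category.assoc, Category.assoc]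
    rw [Category.assoc, Category.assoc, h4, h4] at h3
    have h5 : ∀ {A B : TotalCommMon D} (a : T ⟶ A.carrier) (b : T ⟶ B.carrier)
        {Z : D} (c : T ⟶ Z), rst c = rst a ≫ rst b → rst b ≫ rst a ≫ c = c :=
      fun a b _ c h => by rw [← Category.assoc, rst_comm, ← h, rst_comp_self]
    have hk' : rst k' = 𝟙 _ := by
      have h : rst (F.map k) = 𝟙 (F.obj A.carrier) := by rw [← F.map_rst, hk.total, F.map_id]
      exact h
    rw [Category.assoc, Category.assoc, h5 a b _ (by rw [rst_total_comp _ _ hk',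
      TotalCommMon.rst_add]), h5 a b _ (by rw [TotalCommMon.rst_add, rst_total_comp _ _ hk',
      rst_total_comp _ _ hk'])] at h3
    exact h3
  map_zero T := by
    let k' : (F.mapMon A).carrier ⟶ (F.mapMon B).carrier := F.map k
    change 0 ≫ k' = 0
    have h1 : F.map (A.zero ≫ k) = F.map B.zero := by
      have h2 := hk.map_zero one
      rw [TotalCommMon.hom_zero_def, TotalCommMon.hom_zero_def, bang_one, Category.id_comp,
        Category.id_comp] at h2
      rw [h2]
    have h2 : (bang T ≫ eqToHom F.obj_one.symm ≫ F.map A.zero) ≫ F.map k =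
        bang T ≫ eqToHom F.obj_one.symm ≫ F.map B.zero := by
      rw [Category.assoc, Category.assoc, ← F.map_comp, h1]
    exact h2

end StrictFunctor

/-- Two monoids with the same carrier are equal if the identity preserves their structures. -/
theorem TotalCommMon.eq_of_isMonHom {A B : TotalCommMon C} (e : A.carrier = B.carrier)
    (h : IsMonHom A B (eqToHom e)) : A = B := by
  obtain ⟨A, a, z, hA⟩ := A
  obtain ⟨B, b, z', hB⟩ := B
  cases e
  have h1 := h.map_add (fst A A) (snd A A)
  have h2 := h.map_zero one
  have h1' : (lift (fst A A) (snd A A) ≫ a) ≫ 𝟙 A =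
    lift (fst A A ≫ 𝟙 A) (snd A A ≫ 𝟙 A) ≫ b := h1
  have h2' : (bang one ≫ z) ≫ 𝟙 A = bang one ≫ z' := h2
  rw [Category.comp_id, Category.comp_id, Category.comp_id, lift_fst_snd, Category.id_comp,
    Category.id_comp] at h1'
  rw [Category.comp_id, bang_one, Category.id_comp, Category.id_comp] at h2'
  cases h1'
  cases h2'
  rfl

theorem isMonHom_eqToHom {A B : TotalCommMon C} (e : A = B) :
    IsMonHom A B (eqToHom (congrArg TotalCommMon.carrier e)) := by
  subst e; exact IsMonHom.id A

theorem isMonHom_unit {A : TotalCommMon C} {k : A.carrier ⟶ one} (hk : rst k = 𝟙 A.carrier) :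
    IsMonHom A (TotalCommMon.unit C) k := by
  have h := comp_bang k
  rw [bang_one, Category.comp_id, hk, Category.id_comp] at h
  subst h
  exact isMonHom_bang A

theorem isMonHom_prod {A B D : TotalCommMon C} {k : A.carrier ⟶ CRStruct.prod B.carrier D.carrier}
    (h1 : IsMonHom A B (k ≫ fst _ _)) (h2 : IsMonHom A D (k ≫ snd _ _)) :
    IsMonHom A (B.prod D) k where
  total := by rw [← h1.total]; exact (rst_total_comp _ _ (rst_fst _ _)).symm
  map_add a b := by
    have e : ∀ {T : C} (a b : T ⟶ A.carrier), (a + b) ≫ k =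
        lift (a ≫ k) (b ≫ k) ≫ TotalCommMon.prodAdd B D := by
      intro T a b
      apply hom_ext
      · rw [TotalCommMon.comp_prodAdd_fst, Category.assoc, Category.assoc, Category.assoc,
          h1.map_add]
      · rw [TotalCommMon.comp_prodAdd_snd, Category.assoc, Category.assoc, Category.assoc,
          h2.map_add]
    exact e a b
  map_zero T := by
    have e : (0 : T ⟶ A.carrier) ≫ k = bang T ≫ lift B.zero D.zero := by
      apply hom_ext
      · rw [Category.assoc, Category.assoc, h1.map_zero, TotalCommMon.total_lift_fst _ _
          D.isMon.rst_zero]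
        rfl
      · rw [Category.assoc, Category.assoc, h2.map_zero, TotalCommMon.total_lift_snd _ _
          B.isMon.rst_zero]
        rfl
    exact e

/-- Equality of strict functors requires equality of objects; checking that a transport map is a
homomorphism avoids heterogeneous equalities between structure maps. -/
theorem FaaObj.ext_of_isMonHom {P Q : FaaObj C} (e : P.mon.carrier = Q.mon.carrier)
    (h : IsMonHom P.mon Q.mon (eqToHom e)) (e' : P.pt = Q.pt) : P = Q := by
  obtain ⟨A, X⟩ := P
  obtain ⟨B, Y⟩ := Q
  cases TotalCommMon.eq_of_isMonHom e h
  cases e'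
  rfl

theorem FaaHom.hext {P P' Q Q' : FaaObj C} (hP : P = P') (hQ : Q = Q') {f : FaaHom P Q}
    {g : FaaHom P' Q'} (h : HEq f.star g.star) (h' : ∀ n, HEq (f.d n) (g.d n)) : HEq f g := by
  subst hP hQ
  exact heq_of_eq (FaaHom.ext (eq_of_heq h) (funext fun n => eq_of_heq (h' n)))

section Linear

variable (S : FaaStr C)

theorem FaaHom.IsLinearOn.congr {f : FaaHom P Q} {h h' : P.pt ⟶ Q.pt}
    {k k' : P.mon.carrier ⟶ Q.mon.carrier} (hf : f.IsLinearOn h k) (e : h = h') (e' : k = k') :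
    f.IsLinearOn h' k' := by
  subst e e'; exact hf

/-- The composite of linear morphisms is linear. -/
theorem FaaHom.IsLinearOn.comp {f : FaaHom P Q} {g : FaaHom Q R} {h : P.pt ⟶ Q.pt}
    {h' : Q.pt ⟶ R.pt} {k : P.mon.carrier ⟶ Q.mon.carrier} {l : Q.mon.carrier ⟶ R.mon.carrier}
    (hf : f.IsLinearOn h k) (hk : IsMonHom P.mon Q.mon k) (hg : g.IsLinearOn h' l)
    (hl : IsMonHom Q.mon R.mon l) : (S.comp f g).IsLinearOn (h ≫ h') (k ≫ l) := by
  have h1 : (S.comp f g).star = h ≫ h' := by rw [S.comp_star, hf.star, hg.star]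
  have e : S.comp f g = FaaHom.linear (h ≫ h') (hk.comp hl) := by
    refine FaaHom.ext_germ h1 fun s x hx m hm => ?_
    rw [S.germ_isLinearOn_comp g hf hk hx]
    have hg' := hg.isLin_germ hl (s := s) (x := x ≫ f.star) (by
      rw [S.comp_star] at hx
      exact (Stage.defined_comp.1 hx).2)
    have hfg := (FaaHom.isLinearOn_linear (h ≫ h') (hk.comp hl)).isLin_germ (hk.comp hl)
      (s := s) (x := x) (by rw [h1] at hx; exact hx)
    by_cases hm1 : Multiset.card m = 1
    · obtain ⟨a, rfl⟩ := Multiset.card_eq_one.1 hm1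
      rw [Multiset.map_singleton, hg'.single, hfg.single, Stage.Vec.map_comp]
    · rw [hg'.other _ (by simpa using hm1), hfg.other _ hm1]
  rw [e]
  exact FaaHom.isLinearOn_linear _ _

/-- `eqToHom` in `Faà(C)` -/
theorem isLinearOn_eqToHom {P Q : FaaObj C} (e : P = Q) :
    FaaHom.IsLinearOn (eqToHom (C := S.Cat) e) (eqToHom (congrArg FaaObj.pt e))
      (eqToHom (congrArg (fun P => P.mon.carrier) e)) := by
  subst e
  exact S.isLinearOn_id P

end Linear

namespace StrictFunctor

theorem mapPow_linPart {A B : TotalCommMon C} (X : C) (k : A.carrier ⟶ B.carrier) (n : ℕ) :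
    F.mapPow (linPart X k n) =
      linPart (A := F.mapMon A) (B := F.mapMon B) (F.obj X) (F.map k) n := by
  match n with
  | 0 => exact F.mapPowTo_zero _ _ B 0
  | 1 =>
    have h : F.mapPow (proj A.carrier X 1 0 ≫ k) = proj (F.obj A.carrier) (F.obj X) 1 0 ≫
      F.map k := by rw [mapPow_comp, mapPow_proj]
    exact h
  | n + 2 => exact F.mapPowTo_zero _ _ B _

theorem isLinearOn_mapHom {f : FaaHom P Q} {h : P.pt ⟶ Q.pt}
    {k : P.mon.carrier ⟶ Q.mon.carrier} (hf : f.IsLinearOn h k) :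
    (F.mapHom f).IsLinearOn (F.map h) (F.map k) := by
  refine ⟨congrArg (fun t => F.map t) hf.star, fun n => ?_⟩
  have h1 : F.mapPow (f.d n) = rst (last (F.obj P.mon.carrier) (F.obj P.pt) n ≫ F.map h) ≫
      F.mapPow (linPart P.pt k n) := by
    rw [hf.d, mapPow_rst_comp, mapPow_comp, mapPow_last]
  exact h1.trans (congrArg (fun t => _ ≫ t) (F.mapPow_linPart P.pt k n))

theorem mapHom_comps (f : FaaHom P Q) (n : ℕ) :
    (F.mapHom f).comps n = F.mapPow (f.comps n) := by
  cases n with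
  | zero =>
    have h1 : F.mapPow (rst (last P.mon.carrier P.pt 0 ≫ f.star) ≫ (0 : _ ⟶ Q.mon.carrier)) =
        rst (last (F.obj P.mon.carrier) (F.obj P.pt) 0 ≫ F.map f.star) ≫
          F.mapPow (0 : _ ⟶ Q.mon.carrier) := by
      rw [mapPow_rst_comp, mapPow_comp, mapPow_last]
    exact (h1.trans (congrArg (fun t => _ ≫ t) (F.mapPowTo_zero _ _ Q.mon 0))).symm
  | succ n => rfl

theorem mapPow_compD (f : FaaHom P Q) (g : FaaHom Q R) (n : ℕ+) :
    F.mapPow (compD f g n) = compD (F.mapHom f) (F.mapHom g) n := by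
  rw [compD_eq, compD_eq]
  refine (F.mapPowTo_sum Finset.univ _).trans (Finset.sum_congr rfl fun c _ => ?_)
  have h1 := F.mapPow_tuple_comp (g.comps c.length) (fun i : Fin c.length =>
    tuple (fun j : Fin (c.partSize i) => proj P.mon.carrier P.pt n (c.emb i j))
      (last P.mon.carrier P.pt n) ≫ f.comps (c.partSize i)) (last P.mon.carrier P.pt n ≫ f.star)
  have h2 : ∀ i : Fin c.length, F.mapPow (tuple (fun j : Fin (c.partSize i) =>
      proj P.mon.carrier P.pt n (c.emb i j)) (last P.mon.carrier P.pt n) ≫ f.comps (c.partSize i)) =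
      tuple (fun j : Fin (c.partSize i) => proj (F.obj P.mon.carrier) (F.obj P.pt) n (c.emb i j))
        (last (F.obj P.mon.carrier) (F.obj P.pt) n) ≫ F.mapPow (f.comps (c.partSize i)) := by
    intro i
    rw [mapPow_tuple_comp, mapPow_last]
    simp only [mapPow_proj]
  rw [F.mapPow_comp (last P.mon.carrier P.pt n), mapPow_last, ← mapHom_comps] at h1
  simp only [h2, ← mapHom_comps] at h1
  exact h1

theorem mapObj_unit : F.mapObj (FaaObj.unit C) = FaaObj.unit D :=
  FaaObj.ext_of_isMonHom F.obj_one (isMonHom_unit (rst_eqToHom _)) F.obj_one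

theorem mapObj_prod (P Q : FaaObj C) :
    F.mapObj (P.prod Q) = (F.mapObj P).prod (F.mapObj Q) :=
  FaaObj.ext_of_isMonHom (F.obj_prod _ _) (isMonHom_prod
    (F.map_fst P.mon.carrier Q.mon.carrier ▸ F.isMonHom_map (isMonHom_fst P.mon Q.mon))
    (F.map_snd P.mon.carrier Q.mon.carrier ▸ F.isMonHom_map (isMonHom_snd P.mon Q.mon)))
    (F.obj_prod _ _)

theorem mapHom_fst (S : FaaStr C) (S' : FaaStr D) (P Q : FaaObj C) : F.mapHom (S.fst P Q) =
    S'.comp (eqToHom (C := S'.Cat) (F.mapObj_prod P Q)) (S'.fst (F.mapObj P) (F.mapObj Q)) := by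
  have h := (isLinearOn_eqToHom S' (F.mapObj_prod P Q)).comp S'
    (isMonHom_eqToHom (congrArg FaaObj.mon (F.mapObj_prod P Q)))
    (S'.isLinearOn_fst (F.mapObj P) (F.mapObj Q)) (isMonHom_fst _ _)
  exact ext_isLinearOn (F.isLinearOn_mapHom (S.isLinearOn_fst P Q))
    (h.congr (F.map_fst P.pt Q.pt).symm (F.map_fst P.mon.carrier Q.mon.carrier).symm)

theorem mapHom_snd (S : FaaStr C) (S' : FaaStr D) (P Q : FaaObj C) : F.mapHom (S.snd P Q) =
    S'.comp (eqToHom (C := S'.Cat) (F.mapObj_prod P Q)) (S'.snd (F.mapObj P) (F.mapObj Q)) := by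
  have h := (isLinearOn_eqToHom S' (F.mapObj_prod P Q)).comp S'
    (isMonHom_eqToHom (congrArg FaaObj.mon (F.mapObj_prod P Q)))
    (S'.isLinearOn_snd (F.mapObj P) (F.mapObj Q)) (isMonHom_snd _ _)
  exact ext_isLinearOn (F.isLinearOn_mapHom (S.isLinearOn_snd P Q))
    (h.congr (F.map_snd P.pt Q.pt).symm (F.map_snd P.mon.carrier Q.mon.carrier).symm)

/-- `Faà(F)` -/
def faaMap (S : FaaStr C) (S' : FaaStr D) : StrictFunctor S.Cat S'.Cat where
  obj P := F.mapObj P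
  map f := F.mapHom f
  map_id P := ext_isLinearOn (F.isLinearOn_mapHom (S.isLinearOn_id P)) (by
    have h := S'.isLinearOn_id (F.mapObj P)
    have e : ∀ X : C, F.map (𝟙 X) = 𝟙 (F.obj X) := F.map_id
    rw [e, e]
    exact h)
  map_comp {P Q R} f g := FaaHom.ext
    ((congrArg (fun t => F.map t) (S.comp_star f g)).trans
      ((F.map_comp _ _).trans (S'.comp_star (F.mapHom f) (F.mapHom g)).symm))
    (funext fun n => (congrArg F.mapPow (S.comp_d f g n)).trans ((F.mapPow_compD f g n).trans
      (S'.comp_d (F.mapHom f) (F.mapHom g) n).symm))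
  map_rst {P Q} f := ext_isLinearOn (F.isLinearOn_mapHom (S.isLinearOn_rst f)) (by
    have h := S'.isLinearOn_rst (F.mapHom f)
    have e := F.map_id P.mon.carrier
    have e' := F.map_rst (FaaHom.star f)
    rw [e, e']
    exact h)
  obj_one := F.mapObj_unit
  obj_prod := F.mapObj_prod
  map_fst := F.mapHom_fst S S'
  map_snd := F.mapHom_snd S S'

theorem isFaaMap_faaMap {D : Type u} [CartRest.{v} D] (F : StrictFunctor C D) (S : FaaStr C)
    (S' : FaaStr D) : IsFaaMap S S' F (F.faaMap S S') :=
  ⟨F.mapHom, fun _ => ⟨rfl, fun _ => rfl⟩, rfl⟩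

end StrictFunctor

/-- Carrier and point agree definitionally, but the structure maps on the left contain an extra
transport, so the monoids are compared through the identity. -/
theorem StrictFunctor.mapObj_id (P : FaaObj C) : (StrictFunctor.id C).mapObj P = P :=
  FaaObj.ext_of_isMonHom rfl
    { total := rst_id _
      map_add := by
        have h : ∀ {T : C} (a b : T ⟶ P.mon.carrier),
            (lift a b ≫ 𝟙 _ ≫ P.mon.add) ≫ 𝟙 _ = lift (a ≫ 𝟙 _) (b ≫ 𝟙 _) ≫ P.mon.add := by
          intro T a b
          rw [Category.comp_id, Category.id_comp, Category.comp_id, Category.comp_id]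
        exact fun {_} a b => h a b
      map_zero := fun T => by
        have h : (bang T ≫ 𝟙 _ ≫ P.mon.zero) ≫ 𝟙 _ = bang T ≫ P.mon.zero := by
          rw [Category.comp_id, Category.id_comp]
        exact h } rfl

theorem StrictFunctor.faaMap_id (S : FaaStr C) :
    (StrictFunctor.id C).faaMap S S = StrictFunctor.id S.Cat := by
  refine StrictFunctor.eq_of_toFunctor (Functor.hext mapObj_id fun P Q f => ?_)
  exact FaaHom.hext (mapObj_id P) (mapObj_id Q) HEq.rfl fun n => heq_of_eq (Category.id_comp _)

section Comp

variable {C D E : Type u} [CartRest.{v} C] [CartRest.{v} D] [CartRest.{v} E]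
  (F : StrictFunctor C D) (G : StrictFunctor D E)

theorem StrictFunctor.mapObj_comp (P : FaaObj C) :
    (F.comp G).mapObj P = G.mapObj (F.mapObj P) :=
  FaaObj.ext_of_isMonHom rfl
    { total := rst_id _
      map_add := by
        have h : ∀ {T : E} (a b : T ⟶ G.obj (F.obj P.mon.carrier)), (lift a b ≫
            eqToHom ((F.comp G).obj_prod P.mon.carrier P.mon.carrier).symm ≫
              G.map (F.map P.mon.add)) ≫ 𝟙 _ =
            lift (a ≫ 𝟙 _) (b ≫ 𝟙 _) ≫ eqToHom (G.obj_prod _ _).symm ≫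
              G.map (eqToHom (F.obj_prod _ _).symm ≫ F.map P.mon.add) := by
          intro T a b
          rw [Category.comp_id, Category.comp_id, Category.comp_id, G.map_comp, eqToHom_map,
            ← Category.assoc (eqToHom _), eqToHom_trans]
          rfl
        exact fun {_} a b => h a b
      map_zero := fun T => by
        have h : (bang T ≫ eqToHom (F.comp G).obj_one.symm ≫ G.map (F.map P.mon.zero)) ≫
            𝟙 _ = bang T ≫ eqToHom G.obj_one.symm ≫
              G.map (eqToHom F.obj_one.symm ≫ F.map P.mon.zero) := by
          rw [Category.comp_id, G.map_comp, eqToHom_map,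
            ← Category.assoc (eqToHom _), eqToHom_trans]
          rfl
        exact h } rfl

theorem StrictFunctor.mapPow_mapPow {A X B : C} {n : ℕ} (h : pow A X n ⟶ B) :
    (F.comp G).mapPow h = G.mapPow (F.mapPow h) := by
  have e : eqToHom ((F.comp G).obj_pow A X n).symm ≫ G.map (F.map h) =
      eqToHom (G.obj_pow (F.obj A) (F.obj X) n).symm ≫
        G.map (eqToHom (F.obj_pow A X n).symm ≫ F.map h) := by
    rw [G.map_comp, eqToHom_map, ← Category.assoc (eqToHom _), eqToHom_trans]
    rfl
  exact e

theorem StrictFunctor.faaMap_comp (S : FaaStr C) (S' : FaaStr D) (S'' : FaaStr E) :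
    (F.comp G).faaMap S S'' = (F.faaMap S S').comp (G.faaMap S' S'') := by
  refine StrictFunctor.eq_of_toFunctor (Functor.hext (mapObj_comp F G) fun P Q f => ?_)
  exact FaaHom.hext (mapObj_comp F G P) (mapObj_comp F G Q) HEq.rfl
    fun n => heq_of_eq (mapPow_mapPow F G _)

end Comp

/-- The counit of `Faà`. -/
def FaaStr.counit (S : FaaStr C) : StrictFunctor S.Cat C where
  obj P := FaaObj.pt P
  map f := FaaHom.star f
  map_id P := (S.isLinear_id P).1
  map_comp f g := S.comp_star f g
  map_rst f := S.rst_star f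
  obj_one := rfl
  obj_prod _ _ := rfl
  map_fst P Q := (S.isLinear_fst P Q).1.trans (Category.id_comp _).symm
  map_snd P Q := (S.isLinear_snd P Q).1.trans (Category.id_comp _).symm

end FaaMap

/-- The endofunctor `Faà`. -/
noncomputable def faaEndofunctor : FaaEndofunctor.{v, u} where
  str X := faaStr X
  map F := StrictFunctor.faaMap F _ _
  isFaaMap F := StrictFunctor.isFaaMap_faaMap F _ _
  map_id X := StrictFunctor.faaMap_id (faaStr X)
  map_comp F G := StrictFunctor.faaMap_comp F G _ _ _

/-- The counit of `Faà`, as a natural transformation. -/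
noncomputable def faaCounit :
    faaEndofunctor.{v, u}.functor ⟶ 𝟭 CartRestCat.{v, max u v} where
  app X := (faaStr X).counit
  naturality _ _ _ := StrictFunctor.eq_of_toFunctor rfl

/-! ### The components of the comultiplication -/

section LinMap

variable {α B : Type*} [AddCommMonoid B]

theorem linMap_zero (k : α → B) : linMap k 0 = 0 := (isLin_linMap k).other 0 (by simp)

theorem linMap_singleton (k : α → B) (a : α) : linMap k {a} = k a := (isLin_linMap k).single a

theorem linMap_of_one_lt (k : α → B) {m : Multiset α} (h : 1 < Multiset.card m) :
    linMap k m = 0 := (isLin_linMap k).other m h.ne'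

theorem linMap_add (k l : α → B) (m : Multiset α) :
    linMap (fun a => k a + l a) m = linMap k m + linMap l m := by
  by_cases h : Multiset.card m = 1
  · obtain ⟨a, rfl⟩ := Multiset.card_eq_one.1 h
    simp only [linMap_singleton]
  · rw [(isLin_linMap _).other m h, (isLin_linMap _).other m h, (isLin_linMap _).other m h,
      add_zero]

theorem linMap_const_zero (m : Multiset α) : linMap (fun _ => (0 : B)) m = 0 := by
  by_cases h : Multiset.card m = 1
  · obtain ⟨a, rfl⟩ := Multiset.card_eq_one.1 h
    simp only [linMap_singleton]
  · rw [(isLin_linMap _).other m h]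

/-- Each vector occurs in exactly one pair of every matching. -/
theorem gridSum_multiAdditive {α A B M : Type*} [AddCommMonoid A] [AddCommMonoid B]
    [AddCommMonoid M] {Φ : Multiset A → M} (hΦ : MultiAdditive Φ)
    {u : Multiset α × Multiset B → A} (hadd : ∀ β a b, u (β, {a + b}) = u (β, {a}) + u (β, {b}))
    (hzero : ∀ β, u (β, {0}) = 0) (S : Multiset α) : MultiAdditive (gridSum Φ u S) where
  add a b t := by
    simp only [gridSum, Multiset.map_cons, msum_matchings_cons_right, hadd, hΦ.add, msum_add]
  zero t := by
    simp only [gridSum, Multiset.map_cons, msum_matchings_cons_right, hzero, hΦ.zero,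
      msum_const_zero]

theorem univ_val_map_append {α : Type*} {m n : ℕ} (f : Fin (m + n) → α) :
    (Finset.univ : Finset (Fin (m + n))).val.map f =
      (Finset.univ : Finset (Fin m)).val.map (fun i => f (Fin.castAdd n i)) +
        (Finset.univ : Finset (Fin n)).val.map (fun i => f (Fin.natAdd m i)) := by
  rw [Fin.univ_val_map, Fin.univ_val_map, Fin.univ_val_map, List.ofFn_add]
  rfl

theorem univ_val_map_orderEmbOfFin {α : Type*} {n : ℕ} (U : Finset (Fin n)) (f : Fin n → α) :
    (Finset.univ : Finset (Fin U.card)).val.map (fun k => f (U.orderEmbOfFin rfl k)) =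
      U.val.map f := by
  have h := congrArg Finset.val (Finset.map_orderEmbOfFin_univ U rfl)
  rw [Finset.map_val] at h
  conv_rhs => rw [← h, Multiset.map_map]
  rfl

end LinMap

/-! ### Coordinates, and sums over partial injections at a stage -/

section Coords

variable {C : Type u} [CartRest.{v} C]

/-- The object `((A, +, 0), A)` of `Faà(C)`. -/
abbrev TotalCommMon.diag (A : TotalCommMon C) : FaaObj C := ⟨A, A.carrier⟩

open Classical in
/-- The vector obtained by evaluating `k` at the point `x` (or `0`, outside the domain of `k`). -/
noncomputable def Stage.vecAt (s : Stage C) {X : C} {A : TotalCommMon C} (x : s.obj ⟶ X)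
    (k : X ⟶ A.carrier) : s.Vec A :=
  if h : s.Defined x k then ⟨x ≫ k, h.rst_comp⟩ else 0

theorem Stage.val_vecAt {s : Stage C} {X : C} {A : TotalCommMon C} {x : s.obj ⟶ X}
    {k : X ⟶ A.carrier} (h : s.Defined x k) : (s.vecAt x k : s.Vec A).val = x ≫ k := by
  rw [Stage.vecAt, dif_pos h]

open Classical in
/-- The germ of a morphism into `((A, +, 0), A)`, extended by the value at the empty family. -/
noncomputable def FaaHom.full {P : FaaObj C} {A : TotalCommMon C} (f : FaaHom P A.diag)
    (s : Stage C) (x : s.obj ⟶ P.pt) (m : Multiset (s.Vec P.mon)) : s.Vec A :=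
  if m = 0 then s.vecAt x f.star else f.germ s x m

theorem FaaHom.full_zero {P : FaaObj C} {A : TotalCommMon C} (f : FaaHom P A.diag)
    (s : Stage C) (x : s.obj ⟶ P.pt) : f.full s x 0 = s.vecAt x f.star := if_pos rfl

theorem FaaHom.full_of_ne {P : FaaObj C} {A : TotalCommMon C} (f : FaaHom P A.diag)
    (s : Stage C) (x : s.obj ⟶ P.pt) {m : Multiset (s.Vec P.mon)} (hm : m ≠ 0) :
    f.full s x m = f.germ s x m := if_neg hm

/-- The values at the empty family recover the base maps, by evaluation at the universal point of
the domain of `f_*`. -/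
theorem FaaHom.ext_full {P : FaaObj C} {A : TotalCommMon C} {f g : FaaHom P A.diag}
    (h : CRStruct.rst f.star = CRStruct.rst g.star) (H : ∀ (s : Stage C) (x : s.obj ⟶ P.pt),
      s.Defined x f.star → s.Defined x g.star → ∀ m, f.full s x m = g.full s x m) : f = g := by
  have hd : ∀ (s : Stage C) (x : s.obj ⟶ P.pt), s.Defined x f.star → s.Defined x g.star := by
    intro s x hx
    rw [← Stage.defined_rst, ← h, Stage.defined_rst]
    exact hx
  have hs : f.star = g.star := by
    let s : Stage C := ⟨P.pt, CRStruct.rst f.star, rst_rst _⟩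
    have hf : s.Defined s.idem f.star :=
      ⟨rst_rst _, congrArg CRStruct.rst (IsCartesianRestriction.rst_comp_self f.star)⟩
    have h1 := H s s.idem hf (hd s _ hf) 0
    rw [f.full_zero, g.full_zero] at h1
    have h2 := congrArg Stage.Vec.val h1
    rw [Stage.val_vecAt hf, Stage.val_vecAt (hd s _ hf)] at h2
    have h3 : CRStruct.rst f.star ≫ f.star = CRStruct.rst f.star ≫ g.star := h2
    rw [IsCartesianRestriction.rst_comp_self, h, IsCartesianRestriction.rst_comp_self] at h3
    exact h3
  refine FaaHom.ext_germ hs fun s x hx m hm => ?_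
  have h1 := H s x hx (hd s x hx) m
  rwa [f.full_of_ne _ _ hm, g.full_of_ne _ _ hm] at h1

/-- Total maps from the two parts of `W` to those of `P^r × P`, where `P = (A, X)` and the first
`r` factors stand for `(A, A)`. -/
structure Coords (W P : FaaObj C) (r : ℕ) where
  pt : Fin r → (W.pt ⟶ P.mon.carrier)
  base : W.pt ⟶ P.pt
  vec : Fin r → (W.mon.carrier ⟶ P.mon.carrier)
  fib : W.mon.carrier ⟶ P.mon.carrier
  rst_pt : ∀ i, rst (pt i) = 𝟙 W.pt
  rst_base : rst base = 𝟙 W.pt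
  isMonHom_vec : ∀ i, IsMonHom W.mon P.mon (vec i)
  isMonHom_fib : IsMonHom W.mon P.mon fib

namespace Coords

variable {W P Q : FaaObj C} {r : ℕ} (c : Coords W P r)

open Classical in
/-- The entries of a row. -/
noncomputable def row (s : Stage C) (z : s.obj ⟶ W.pt) (i : Fin r)
    (γ : Multiset (s.Vec W.mon)) : s.Vec P.mon :=
  if γ = 0 then s.vecAt z (c.pt i) else linMap (Stage.Vec.map (c.isMonHom_vec i)) γ

open Classical in
/-- What is to be inserted for a pair of at most one row and at most one vector. -/
noncomputable def grid (s : Stage C) (z : s.obj ⟶ W.pt)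
    (p : Multiset (Fin r) × Multiset (s.Vec W.mon)) : s.Vec P.mon :=
  if p.1 = 0 then linMap (Stage.Vec.map c.isMonHom_fib) p.2
  else linMap (fun i => c.row s z i p.2) p.1

variable (s : Stage C) (z : s.obj ⟶ W.pt)

theorem grid_zero (γ : Multiset (s.Vec W.mon)) :
    c.grid s z (0, γ) = linMap (Stage.Vec.map c.isMonHom_fib) γ := if_pos rfl

theorem grid_singleton (i : Fin r) (γ : Multiset (s.Vec W.mon)) :
    c.grid s z ({i}, γ) = c.row s z i γ :=
  (if_neg (Multiset.singleton_ne_zero i)).trans (linMap_singleton _ _)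

theorem row_zero (i : Fin r) : c.row s z i 0 = s.vecAt z (c.pt i) := if_pos rfl

theorem row_singleton (i : Fin r) (w : s.Vec W.mon) :
    c.row s z i {w} = w.map (c.isMonHom_vec i) :=
  (if_neg (Multiset.singleton_ne_zero w)).trans (linMap_singleton _ _)

theorem row_of_one_lt (i : Fin r) {γ : Multiset (s.Vec W.mon)} (h : 1 < Multiset.card γ) :
    c.row s z i γ = 0 :=
  (if_neg (by rintro rfl; simp at h)).trans (linMap_of_one_lt _ h)

theorem isGrid_grid : IsGrid (c.grid s z) := by
  rintro ⟨β, γ⟩ h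
  by_cases hβ : β = 0
  · subst hβ
    rw [grid_zero]
    exact linMap_of_one_lt _ (h.resolve_left (by simp))
  · refine (if_neg hβ).trans ?_
    rcases h with h | h
    · exact linMap_of_one_lt _ h
    · have e : (fun i => c.row s z i γ) = fun _ => 0 := funext fun i => c.row_of_one_lt s z i h
      exact (congrArg (fun k => linMap k β) e).trans (linMap_const_zero β)

theorem grid_add (β : Multiset (Fin r)) (a b : s.Vec W.mon) :
    c.grid s z (β, {a + b}) = c.grid s z (β, {a}) + c.grid s z (β, {b}) := by
  by_cases hβ : β = 0
  · subst hβ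
    rw [grid_zero, grid_zero, grid_zero, linMap_singleton, linMap_singleton, linMap_singleton,
      Stage.Vec.map_add]
  · rw [grid, grid, grid, if_neg hβ, if_neg hβ, if_neg hβ, ← linMap_add]
    simp only [row_singleton, Stage.Vec.map_add]

theorem grid_singleton_zero (β : Multiset (Fin r)) : c.grid s z (β, {0}) = 0 := by
  by_cases hβ : β = 0
  · subst hβ
    rw [grid_zero, linMap_singleton, Stage.Vec.map_zero]
  · rw [grid, if_neg hβ]
    simp only [row_singleton, Stage.Vec.map_zero]
    exact linMap_const_zero β

theorem multiAdditive_gridSum {M : Type*} [AddCommMonoid M] {Φ : Multiset (s.Vec P.mon) → M}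
    (hΦ : MultiAdditive Φ) (S : Multiset (Fin r)) : MultiAdditive (gridSum Φ (c.grid s z) S) :=
  gridSum_multiAdditive hΦ (c.grid_add s z) (c.grid_singleton_zero s z) S

end Coords

open Classical in
theorem sum_subtype_eq_sum_ite {ι M : Type*} [AddCommMonoid M] [Fintype ι] (p : ι → Prop)
    [Fintype {i // p i}] (F : ι → M) :
    ∑ i : {i // p i}, F i.1 = ∑ i, if p i then F i else 0 := by
  rw [← Finset.sum_filter]
  exact (Finset.sum_subtype (Finset.univ.filter p) (by simp) F).symm

/-- The value of a component depends only on the multiset of its arguments, so the appended tuple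
and the increasing order of the unmatched indices become immaterial. -/
theorem comultSum_eq {P Q : FaaObj C} (f : FaaHom P Q) (r : ℕ+) (n : ℕ) {T : C}
    (a : Fin n → Fin r → (T ⟶ P.mon.carrier)) (b : Fin n → (T ⟶ P.mon.carrier))
    (c : Fin r → (T ⟶ P.mon.carrier)) (x : T ⟶ P.pt) : comultSum f r n a b c x =
      ∑ φ : {φ : Fin r → Option (Fin n) // ∀ i i' j, φ i = some j → φ i' = some j → i = i'},
        f.eval x (Finset.univ.val.map (fun i => (φ.1 i).elim (c i) fun j => a j i) +
          (Finset.univ.filter fun j => ∀ i, φ.1 i ≠ some j).val.map b) := by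
  refine Finset.sum_congr rfl fun φ _ => ?_
  let U : Finset (Fin n) := Finset.univ.filter fun j => ∀ i, φ.1 i ≠ some j
  let p : Fin r → (T ⟶ P.mon.carrier) := fun i => match φ.1 i with
    | some j => a j i
    | none => c i
  let q : Fin U.card → (T ⟶ P.mon.carrier) := fun k => b (U.orderEmbOfFin rfl k)
  have h1 : tuple (Fin.append p q) x ≫ f.comps (r + U.card) =
      f.eval x (Finset.univ.val.map (fun i => (φ.1 i).elim (c i) fun j => a j i) +
        U.val.map b) := by
    rw [FaaHom.tuple_comp_comps, univ_val_map_append]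
    simp only [Fin.append_left, Fin.append_right]
    congr 2
    · refine Multiset.map_congr rfl fun i _ => ?_
      cases hi : φ.1 i <;> simp only [p, hi, Option.elim_none, Option.elim_some]
    · exact univ_val_map_orderEmbOfFin U b
  exact (congrArg (fun t => _ ≫ t) (f.d_mk (r + U.card) _)).trans h1

/-- The value of `comultSum` at vectors over a stage. -/
theorem tuple_comp_comultSum {W P Q : FaaObj C} {r : ℕ+} (c : Coords W P r) (f : FaaHom P Q)
    {s : Stage C} {z : s.obj ⟶ W.pt} (hz : rst z = s.idem) (h : s.Defined (z ≫ c.base) f.star)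
    {n : ℕ} (w : Fin n → s.Vec W.mon) :
    tuple (fun j => (w j).val) z ≫ comultSum f r n
        (fun j i => proj W.mon.carrier W.pt n j ≫ c.vec i)
        (fun j => proj W.mon.carrier W.pt n j ≫ c.fib)
        (fun i => last W.mon.carrier W.pt n ≫ c.pt i) (last W.mon.carrier W.pt n ≫ c.base) =
      (gridSum (f.germ s (z ≫ c.base)) (c.grid s z) Finset.univ.val
        (Finset.univ.val.map w)).val := by
  have ht : rst (tuple (fun j => (w j).val) z) = s.idem := rst_tuple (fun j => (w j).rst_val) hz
  have hp : ∀ j, tuple (fun j => (w j).val) z ≫ proj W.mon.carrier W.pt n j = (w j).val := by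
    intro j
    rw [tuple_proj, ht, Stage.Vec.idem_comp]
  have hl : tuple (fun j => (w j).val) z ≫ last W.mon.carrier W.pt n = z := by
    rw [tuple_last, ht, s.idem_comp hz]
  -- A pair `({i}, {w j})` contributes `a_{j,i}`, an unmatched row `({i}, 0)` contributes `c_i`, and
  -- an unmatched vector `(0, {w j})` contributes `b_j`.
  let G : (Fin r → Option (Fin n)) → s.Vec Q.mon := fun φ => f.germ s (z ≫ c.base)
    ((Finset.univ.val.map (fun i => (({i} : Multiset (Fin r)),
        (φ i).elim 0 fun j => ({w j} : Multiset (s.Vec W.mon)))) +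
      (Finset.univ.filter fun j => ∀ i, φ i ≠ some j).val.map fun j => (0, {w j})).map
        (c.grid s z))
  have e : ∑ φ : {φ : Fin r → Option (Fin n) //
      ∀ i i' j, φ i = some j → φ i' = some j → i = i'}, G φ.1 =
        gridSum (f.germ s (z ≫ c.base)) (c.grid s z) Finset.univ.val
          (Finset.univ.val.map w) := by
    have key := sum_partialInjections (fun i : Fin r => ({i} : Multiset (Fin r)))
      (fun j => ({w j} : Multiset (s.Vec W.mon))) Finset.univ
      (fun μ => f.germ s (z ≫ c.base) (μ.map (c.grid s z)))
    rw [gridSum, Multiset.map_map]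
    refine Eq.trans ?_ key
    rw [sum_subtype_eq_sum_ite]
    refine Finset.sum_congr rfl fun φ _ => ?_
    by_cases hφ : ∀ i i' j, φ i = some j → φ i' = some j → i = i'
    · rw [if_pos hφ, if_pos ⟨hφ, fun _ _ _ => Finset.mem_univ _⟩]
    · rw [if_neg hφ, if_neg fun h => hφ h.1]
  rw [comultSum_eq, ← e]
  refine Stage.val_sum_of_comp Finset.univ _ ht (fun φ : {φ : Fin r → Option (Fin n) //
      ∀ i i' j, φ i = some j → φ i' = some j → i = i'} => f.eval _ _) (fun φ => G φ.1) fun φ _ => ?_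
  rw [FaaHom.eval_map_comp, ← Category.assoc, hl, FaaHom.val_germ f h]
  · congr 1
    simp only [Multiset.map_add, Multiset.map_map]
    congr 1
    · refine Multiset.map_congr rfl fun i _ => ?_
      cases hi : φ.1 i with
      | none =>
        simp only [hi, Function.comp, Option.elim_none, c.grid_singleton, c.row_zero]
        rw [← Category.assoc, hl, Stage.val_vecAt (.of_total hz (c.rst_pt i))]
      | some j =>
        simp only [hi, Function.comp, Option.elim_some, c.grid_singleton, c.row_singleton]
        rw [← Category.assoc, hp]
        rfl
    · refine Multiset.map_congr rfl fun j _ => ?_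
      simp only [Function.comp, c.grid_zero, linMap_singleton]
      rw [← Category.assoc, hp]
      rfl
  · intro h0
    have h1 := congrArg Multiset.card h0
    simp at h1

end Coords

/-! ### The formula for `δ(f)_r` in arbitrary coordinates -/

section ComultAlong

variable {C : Type u} [CartRest.{v} C] {T W P Q : FaaObj C}

/-- `g` is given by the formula for the components of the comultiplication, in the coordinates
`c`. -/
structure FaaHom.IsComultAlong {r : ℕ+} (g : FaaHom W Q.mon.diag) (f : FaaHom P Q)
    (c : Coords W P r) : Prop where
  star : g.star = tuple c.pt c.base ≫ f.d r
  d : ∀ n : ℕ+, g.d n = comultSum f r n (fun j i => proj W.mon.carrier W.pt n j ≫ c.vec i)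
        (fun j => proj W.mon.carrier W.pt n j ≫ c.fib)
        (fun i => last W.mon.carrier W.pt n ≫ c.pt i) (last W.mon.carrier W.pt n ≫ c.base)

theorem FaaHom.rst_eval_total (f : FaaHom P Q) {T : C} {x : T ⟶ P.pt}
    {m : Multiset (T ⟶ P.mon.carrier)} (hx : CRStruct.rst x = 𝟙 T)
    (hm : ∀ a ∈ m, CRStruct.rst a = 𝟙 T) :
    CRStruct.rst (f.eval x m) = CRStruct.rst (x ≫ f.star) := by
  obtain ⟨a, ha⟩ := exists_fin_eq m
  have h : ∀ i, CRStruct.rst (a i) = 𝟙 T := fun i => hm _ (ha ▸ Multiset.mem_map_of_mem a (by simp))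
  rw [ha, ← tuple_comp_comps, rst_tuple_comp_of_rst _ _ (f.rst_comps _), rst_tuple_total h hx,
    Category.id_comp]

/-- Every summand evaluates `f` at total vectors over the same point, so all have the same domain;
the nowhere defined injection shows that there is a summand. -/
theorem rst_comultSum (f : FaaHom P Q) {r : ℕ+} (c : Coords W P r) (n : ℕ) :
    rst (comultSum f r n (fun j i => proj W.mon.carrier W.pt n j ≫ c.vec i)
        (fun j => proj W.mon.carrier W.pt n j ≫ c.fib)
        (fun i => last W.mon.carrier W.pt n ≫ c.pt i) (last W.mon.carrier W.pt n ≫ c.base)) =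
      rst (last W.mon.carrier W.pt n ≫ tuple c.pt c.base ≫ f.d r) := by
  have hl : ∀ {Y : C} (k : W.pt ⟶ Y), rst k = 𝟙 _ → rst (last W.mon.carrier W.pt n ≫ k) = 𝟙 _ :=
    fun k hk => by rw [rst_total_comp _ _ hk, rst_last]
  have hp : ∀ j {Y : C} (k : W.mon.carrier ⟶ Y), rst k = 𝟙 _ →
      rst (proj W.mon.carrier W.pt n j ≫ k) = 𝟙 _ :=
    fun j _ k hk => by rw [rst_total_comp _ _ hk, rst_proj]
  have e : rst (last W.mon.carrier W.pt n ≫ tuple c.pt c.base ≫ f.d r) =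
      rst ((last W.mon.carrier W.pt n ≫ c.base) ≫ f.star) := by
    rw [← rst_comp_rst, rst_tuple_comp_of_rst _ _ (f.rst_d r),
      rst_tuple_total c.rst_pt c.rst_base, Category.id_comp, rst_comp_rst, Category.assoc]
  rw [e, comultSum_eq]
  refine rst_sum_of_forall ⟨⟨fun _ => none, by simp⟩, Finset.mem_univ _⟩ fun φ _ => ?_
  refine f.rst_eval_total (hl _ c.rst_base) fun a ha => ?_
  rcases Multiset.mem_add.1 ha with ha | ha
  · obtain ⟨i, -, rfl⟩ := Multiset.mem_map.1 ha
    cases φ.1 i with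
    | none => exact hl _ (c.rst_pt i)
    | some j => exact hp j _ (c.isMonHom_vec i).total
  · obtain ⟨j, -, rfl⟩ := Multiset.mem_map.1 ha
    exact hp j _ c.isMonHom_fib.total

theorem rst_tuple_coords_comp (f : FaaHom P Q) {r : ℕ+} (c : Coords W P r) :
    rst (tuple c.pt c.base ≫ f.d r) = rst (c.base ≫ f.star) := by
  rw [rst_tuple_comp_of_rst _ _ (f.rst_d r), rst_tuple_total c.rst_pt c.rst_base,
    Category.id_comp]

theorem defined_of_rst_eq {s : Stage C} {X Y Z : C} {x : s.obj ⟶ X} {k : X ⟶ Y} {l : X ⟶ Z}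
    (h : rst k = rst l) (hx : s.Defined x k) : s.Defined x l := by
  rw [← Stage.defined_rst, ← h, Stage.defined_rst]
  exact hx

/-- The morphism given by the formula for the components of the comultiplication, in the
coordinates `c`. -/
noncomputable def comultAlong (f : FaaHom P Q) {r : ℕ+} (c : Coords W P r) :
    FaaHom W Q.mon.diag :=
  have H := fun n : ℕ+ => additive_symm_of_stage (rst_comultSum f c n) fun s z h1 h2 =>
    have hd : s.Defined z (c.base ≫ f.star) :=
      defined_of_rst_eq (rst_tuple_coords_comp f c) ⟨h1, h2⟩
    ⟨gridSum (f.germ s (z ≫ c.base)) (c.grid s z) Finset.univ.val,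
      c.multiAdditive_gridSum s z (f.multiAdditive_germ s _) _,
      fun w => tuple_comp_comultSum c f h1 (Stage.defined_comp.1 hd).2 w⟩
  { star := tuple c.pt c.base ≫ f.d r
    d := fun n => comultSum f r n (fun j i => proj W.mon.carrier W.pt n j ≫ c.vec i)
        (fun j => proj W.mon.carrier W.pt n j ≫ c.fib)
        (fun i => last W.mon.carrier W.pt n ≫ c.pt i) (last W.mon.carrier W.pt n ≫ c.base)
    rst_d := fun n => rst_comultSum f c n
    additive := fun n => (H n).1
    symm := fun n => (H n).2 }

theorem isComultAlong_comultAlong (f : FaaHom P Q) {r : ℕ+} (c : Coords W P r) :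
    (comultAlong f c).IsComultAlong f c := ⟨rfl, fun _ => rfl⟩

namespace FaaHom.IsComultAlong

variable {r : ℕ+} {g : FaaHom W Q.mon.diag} {f : FaaHom P Q} {c : Coords W P r}

theorem rst_star (hg : g.IsComultAlong f c) : CRStruct.rst g.star =
    CRStruct.rst (c.base ≫ f.star) := by rw [hg.star, rst_tuple_coords_comp]

theorem defined (hg : g.IsComultAlong f c) {s : Stage C} {z : s.obj ⟶ W.pt}
    (h : s.Defined z g.star) : s.Defined (z ≫ c.base) f.star :=
  (Stage.defined_comp.1 (defined_of_rst_eq hg.rst_star h)).2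

/-- At the empty family every row is unmatched and the sum collapses to `f_r` at the point
coordinates. Hence one formula covers the base map and all components. -/
theorem full_eq (hg : g.IsComultAlong f c) {s : Stage C} {z : s.obj ⟶ W.pt}
    (h : s.Defined z g.star) (N : Multiset (s.Vec W.mon)) :
    g.full s z N = gridSum (f.germ s (z ≫ c.base)) (c.grid s z) Finset.univ.val N := by
  by_cases hN : N = 0
  · subst hN
    rw [g.full_zero, gridSum, Multiset.map_zero, matchings_zero_right, msum_singleton]
    apply Stage.Vec.ext
    rw [Stage.val_vecAt h, hg.star, ← Category.assoc, comp_tuple]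
    have h1 : ∀ i, z ≫ c.pt i = (s.vecAt z (c.pt i) : s.Vec P.mon).val := fun i =>
      (Stage.val_vecAt (.of_total h.rst_left (c.rst_pt i))).symm
    simp only [h1]
    refine (f.tuple_comp_d_eq_germ (hg.defined h) _).trans ?_
    simp only [Multiset.map_map, Function.comp_def, c.grid_singleton, c.row_zero]
  · rw [g.full_of_ne _ _ hN]
    refine FaaHom.germ_eq_of_forall h (fun n w => ?_) hN
    rw [hg.d]
    exact tuple_comp_comultSum c f h.rst_left (hg.defined h) w

end FaaHom.IsComultAlong

/-- The empty family has only the empty partition, where `full` returns the value of the base map;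
partitions of a nonempty family are nonempty, so there `full` is the germ. -/
theorem FaaOps.full_comp (S : FaaOps C) {A : TotalCommMon C} (h : FaaHom T W)
    (g : FaaHom W A.diag) {s : Stage C} {z : s.obj ⟶ T.pt}
    (hz : s.Defined z (S.comp h g).star) (N : Multiset (s.Vec T.mon)) :
    (S.comp h g).full s z N = pcomp (g.full s (z ≫ h.star)) (h.germ s z) N := by
  by_cases hN : N = 0
  · subst hN
    rw [pcomp_zero, FaaHom.full_zero, FaaHom.full_zero]
    have hz' := hz
    rw [S.comp_star] at hz'
    apply Stage.Vec.ext
    rw [Stage.val_vecAt hz, Stage.val_vecAt (Stage.defined_comp.1 hz').2, S.comp_star,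
      Category.assoc]
  · rw [FaaHom.full_of_ne _ _ _ hN, S.germ_comp h g hz]
    refine msum_congr fun π hπ => ?_
    rw [FaaHom.full_of_ne]
    intro h0
    rw [Multiset.map_eq_zero] at h0
    subst h0
    exact hN (sum_of_mem_parts hπ).symm

/-- Composites with the components of the comultiplication. -/
theorem FaaHom.IsComultAlong.full_comp (S : FaaOps C) {r : ℕ+} {g : FaaHom W Q.mon.diag}
    {f : FaaHom P Q} {c : Coords W P r} (hg : g.IsComultAlong f c) (h : FaaHom T W)
    {s : Stage C} {z : s.obj ⟶ T.pt} (hz : s.Defined z (S.comp h g).star)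
    {B : Type*} [Zero B] (β : Fin r → B) (G : B × Multiset (s.Vec T.mon) → s.Vec P.mon)
    (h0 : ∀ γ, G (0, γ) = (h.germ s z γ).map c.isMonHom_fib)
    (h1 : ∀ i, G (β i, 0) = s.vecAt (z ≫ h.star) (c.pt i))
    (h2 : ∀ i γ, γ ≠ 0 → G (β i, γ) = (h.germ s z γ).map (c.isMonHom_vec i))
    (N : Multiset (s.Vec T.mon)) :
    (S.comp h g).full s z N = msum (parts N) fun ρ =>
      msum (matchings (Finset.univ.val.map β) ρ) fun μ =>
        f.germ s ((z ≫ h.star) ≫ c.base) (μ.map G) := by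
  classical
  rw [S.full_comp h g hz]
  refine msum_congr fun ρ hρ => ?_
  have hz' := hz
  rw [S.comp_star] at hz'
  rw [hg.full_eq (Stage.defined_comp.1 hz').2, gridSum]
  -- The two index types for rows need not map to each other preserving `0`. Both receive a map from
  -- `WithZero (Fin r)`, so both sums are compared with the sum over the matchings of `ι` with `ρ`.
  let e1 : WithZero (Fin r) → Multiset (Fin r) := fun o => Option.elim o 0 singleton
  let e2 : WithZero (Fin r) → B := fun o => Option.elim o 0 β
  let q : Multiset (s.Vec T.mon) → Multiset (s.Vec W.mon) := fun γ =>
    if γ = 0 then 0 else {h.germ s z γ}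
  let ι : Multiset (WithZero (Fin r)) := Finset.univ.val.map (fun i => (some i : Option (Fin r)))
  have k1 : (Finset.univ : Finset (Fin r)).val.map (singleton : Fin r → Multiset (Fin r)) =
      ι.map e1 := (Multiset.map_map e1 (fun i : Fin r => (some i : Option (Fin r))) Finset.univ.val).symm
  have k2 : (Finset.univ : Finset (Fin r)).val.map β = ι.map e2 :=
    (Multiset.map_map e2 (fun i : Fin r => (some i : Option (Fin r))) Finset.univ.val).symm
  have k3 : (ρ.map (h.germ s z)).map singleton = ρ.map q := by
    rw [Multiset.map_map]
    refine Multiset.map_congr rfl fun γ hγ => ?_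
    exact (if_neg (ne_zero_of_mem_parts hρ γ hγ)).symm
  have hq : q 0 = 0 := if_pos rfl
  have hq' : ∀ γ, γ ≠ 0 → q γ = {h.germ s z γ} := fun γ hγ => if_neg hγ
  have k4 : msum (matchings (ι.map e2) ρ) (fun μ => f.germ s ((z ≫ h.star) ≫ c.base) (μ.map G)) =
      msum (matchings ι ρ) fun μ => f.germ s ((z ≫ h.star) ≫ c.base)
        ((μ.map (Prod.map e2 id)).map G) := by
    conv_lhs => rw [← Multiset.map_id ρ]
    exact msum_matchings_map e2 id rfl rfl ι ρ _
  rw [k1, k2, k3, k4, msum_matchings_map e1 q rfl hq]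
  refine msum_congr fun μ _ => congrArg _ ?_
  rw [Multiset.map_map, Multiset.map_map]
  refine Multiset.map_congr rfl fun p _ => ?_
  obtain ⟨o, γ⟩ := p
  change c.grid s _ (e1 o, q γ) = G (e2 o, γ)
  match o with
  | none =>
    refine (c.grid_zero s _ (q γ)).trans (Eq.trans ?_ (h0 γ).symm)
    by_cases hγ : γ = 0
    · rw [hγ, hq, linMap_zero, FaaHom.germ_empty, Stage.Vec.map_zero]
    · rw [hq' γ hγ, linMap_singleton]
  | some i =>
    refine (c.grid_singleton s _ i (q γ)).trans ?_
    by_cases hγ : γ = 0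
    · rw [hγ, hq, c.row_zero]
      exact (h1 i).symm
    · rw [hq' γ hγ, c.row_singleton]
      exact (h2 i γ hγ).symm

end ComultAlong

/-! ### The coordinates of `(A, A)^r × (A, X)` -/

section PowCoords

variable {C : Type u} [CartRest.{v} C] (S : FaaStr C)

variable (P Q : FaaObj C)

theorem isMonHom_vecProj : ∀ (r : ℕ) (i : Fin r),
    IsMonHom (FaaObj.mon (C := C) (pow (C := S.Cat) P Q r)) P.mon
      (vecProj (S := S) P Q r i)
  | 0, i => i.elim0
  | r + 1, i => Fin.cases (isMonHom_fst _ _)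
      (fun j => (isMonHom_snd _ _).comp (isMonHom_vecProj r j)) i

theorem isMonHom_vecLast : ∀ r : ℕ,
    IsMonHom (FaaObj.mon (C := C) (pow (C := S.Cat) P Q r)) Q.mon (vecLast (S := S) P Q r)
  | 0 => IsMonHom.id _
  | r + 1 => (isMonHom_snd _ _).comp (isMonHom_vecLast r)

theorem isLinearOn_proj : ∀ (r : ℕ) (i : Fin r),
    FaaHom.IsLinearOn (C := C) (P := pow (C := S.Cat) P Q r) (Q := P)
      (proj (C := S.Cat) P Q r i) (ptProj (S := S) P Q r i) (vecProj (S := S) P Q r i)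
  | 0, i => i.elim0
  | r + 1, i => Fin.cases (S.isLinearOn_fst P (pow (C := S.Cat) P Q r))
      (fun j => (S.isLinearOn_snd P (pow (C := S.Cat) P Q r)).comp S (isMonHom_snd _ _)
        (isLinearOn_proj r j) (isMonHom_vecProj S P Q r j)) i

theorem isLinearOn_last : ∀ r : ℕ,
    FaaHom.IsLinearOn (C := C) (P := pow (C := S.Cat) P Q r) (Q := Q)
      (last (C := S.Cat) P Q r) (ptLast (S := S) P Q r) (vecLast (S := S) P Q r)
  | 0 => S.isLinearOn_id Q
  | r + 1 => (S.isLinearOn_snd P (pow (C := S.Cat) P Q r)).comp S (isMonHom_snd _ _)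
        (isLinearOn_last r) (isMonHom_vecLast S P Q r)

/-- Totality of the projections in the restriction category `Faà(C)`, read off on base maps. -/
theorem rst_ptProj (r : ℕ) (i : Fin r) : rst (ptProj (S := S) P Q r i) = 𝟙 _ :=
  (congrArg CRStruct.rst (isLinearOn_proj S P Q r i).star).symm.trans
    ((S.rst_star _).symm.trans ((congrArg (FaaHom.star (C := C))
      (rst_proj (C := S.Cat) P Q r i)).trans (S.isLinear_id _).1))

theorem rst_ptLast (r : ℕ) : rst (ptLast (S := S) P Q r) = 𝟙 _ :=
  (congrArg CRStruct.rst (isLinearOn_last S P Q r).star).symm.trans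
    ((S.rst_star _).symm.trans ((congrArg (FaaHom.star (C := C))
      (rst_last (C := S.Cat) P Q r)).trans (S.isLinear_id _).1))

/-- The object `(A, A)^r × (A, X)` of `Faà(C)`. -/
abbrev FaaStr.powDiag (P : FaaObj C) (r : ℕ) : FaaObj C := pow (C := S.Cat) P.mon.diag P r

/-- The coordinates of `(A, A)^r × (A, X)`. -/
def FaaStr.coords (P : FaaObj C) (r : ℕ) : Coords (S.powDiag P r) P r where
  pt := ptProj (S := S) P.mon.diag P r
  base := ptLast (S := S) P.mon.diag P r
  vec := vecProj (S := S) P.mon.diag P r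
  fib := vecLast (S := S) P.mon.diag P r
  rst_pt := rst_ptProj S P.mon.diag P r
  rst_base := rst_ptLast S P.mon.diag P r
  isMonHom_vec := isMonHom_vecProj S P.mon.diag P r
  isMonHom_fib := isMonHom_vecLast S P.mon.diag P r

end PowCoords

/-! ### Composition in two families of variables -/

section BComp

variable {α β A B M : Type*} [AddCommMonoid M] [AddCommMonoid A] [AddCommMonoid B]

/-- The sum of `Φ` over all partitions of the disjoint union of `s` and `t`, where `u` tells what
to insert for a block. -/
noncomputable def bcomp (Φ : Multiset A → M) (u : Multiset α × Multiset β → A)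
    (s : Multiset α) (t : Multiset β) : M :=
  msum (parts s) fun π => msum (parts t) fun ρ => msum (matchings π ρ) fun μ => Φ (μ.map u)

theorem filterMap_getLeft_add (x : Multiset α) (y : Multiset β) :
    (x.map Sum.inl + y.map Sum.inr : Multiset (α ⊕ β)).filterMap Sum.getLeft? = x := by
  have h1 : (x.map (Sum.inl : α → α ⊕ β)).filterMap Sum.getLeft? = x := by
    induction x using Multiset.induction_on <;> simp_all
  have h2 : (y.map (Sum.inr : β → α ⊕ β)).filterMap Sum.getLeft? = 0 := by
    induction y using Multiset.induction_on <;> simp_all [Multiset.filterMap_cons]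
  rw [Multiset.filterMap_add, h1, h2, add_zero]

theorem filterMap_getRight_add (x : Multiset α) (y : Multiset β) :
    (x.map Sum.inl + y.map Sum.inr : Multiset (α ⊕ β)).filterMap Sum.getRight? = y := by
  have h1 : (x.map (Sum.inl : α → α ⊕ β)).filterMap Sum.getRight? = 0 := by
    induction x using Multiset.induction_on <;> simp_all [Multiset.filterMap_cons]
  have h2 : (y.map (Sum.inr : β → α ⊕ β)).filterMap Sum.getRight? = y := by
    induction y using Multiset.induction_on <;> simp_all
  rw [Multiset.filterMap_add, h1, h2, zero_add]

/-- Partitions of both families with a partial matching of their blocks are partitions of the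
disjoint union; `filterMap` recovers the two parts of a block. -/
theorem bcomp_eq_pcomp (Φ : Multiset A → M) (u : Multiset α × Multiset β → A) (s : Multiset α)
    (t : Multiset β) : bcomp Φ u s t = pcomp Φ (fun w : Multiset (α ⊕ β) =>
      u (w.filterMap Sum.getLeft?, w.filterMap Sum.getRight?))
        (s.map Sum.inl + t.map Sum.inr) := by
  rw [pcomp, msum_parts_sum]
  simp only [Multiset.map_map, Function.comp_def, filterMap_getLeft_add, filterMap_getRight_add]
  rfl

/-- Associativity of `pcomp` on the disjoint union; it is the combinatorial content of functoriality
of `δ`. -/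
theorem bcomp_assoc {Ψ : Multiset B → M} (hΨ : MultiAdditive Ψ) (Φ : Multiset A → B)
    (u : Multiset α × Multiset β → A) (s : Multiset α) (t : Multiset β) :
    bcomp Ψ (fun p => bcomp Φ u p.1 p.2) s t = bcomp (pcomp Ψ Φ) u s t := by
  rw [bcomp_eq_pcomp (pcomp Ψ Φ), ← pcomp_assoc hΨ, bcomp, pcomp, msum_parts_sum]
  simp only [Multiset.map_map, Function.comp_def, bcomp_eq_pcomp Φ]

theorem bcomp_zero_left (Φ : Multiset A → M) (u : Multiset α × Multiset β → A) (t : Multiset β) :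
    bcomp Φ u 0 t = pcomp Φ (fun γ => u (0, γ)) t := by
  simp [bcomp, pcomp]

/-- `u` vanishes on all pairs whose first entry has more than one element. -/
theorem bcomp_of_left {Φ : Multiset A → M} (hΦ : ∀ s, Φ (0 ::ₘ s) = 0)
    {u : Multiset α × Multiset β → A} (hu : ∀ p, 1 < Multiset.card p.1 → u p = 0)
    (s : Multiset α) (t : Multiset β) :
    bcomp Φ u s t = msum (parts t) fun ρ =>
      msum (matchings (s.map singleton) ρ) fun μ => Φ (μ.map u) := by
  rw [bcomp, msum_parts_of_card]
  intro b π hb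
  refine msum_eq_zero fun ρ _ => ?_
  rw [msum_matchings_cons]
  refine msum_eq_zero fun p _ => msum_eq_zero fun μ _ => ?_
  rw [Multiset.map_cons, hu _ hb, hΦ]

theorem msum_matchings_multiAdditive {Φ : Multiset A → M} (hΦ : MultiAdditive Φ)
    {u : Multiset B × Multiset β → A} (hadd : ∀ a b γ, u ({a + b}, γ) = u ({a}, γ) + u ({b}, γ))
    (hzero : ∀ γ, u ({0}, γ) = 0) (t : Multiset (Multiset β)) : MultiAdditive fun s : Multiset B =>
      msum (matchings (s.map singleton) t) fun μ => Φ (μ.map u) where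
  add a b s := by
    simp only [Multiset.map_cons, msum_matchings_cons, hadd, hΦ.add, msum_add]
  zero s := by
    simp only [Multiset.map_cons, msum_matchings_cons, hzero, hΦ.zero, msum_const_zero]

theorem MultiAdditive.msum {ι : Type*} {Φ : ι → Multiset A → M} (h : ∀ i, MultiAdditive (Φ i))
    (t : Multiset ι) : MultiAdditive fun s => msum t fun i => Φ i s where
  add a b s := by simp only [(h _).add, msum_add]
  zero s := by simp only [(h _).zero, msum_const_zero]

theorem map_msum {ι F : Type*} [FunLike F A M] [AddMonoidHomClass F A M] (f : F) (t : Multiset ι)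
    (G : ι → A) : f (msum t G) = msum t fun i => f (G i) := by
  induction t using Multiset.induction_on with
  | empty => simp
  | cons a t ih => simp [ih]

end BComp

/-! ### The monoids `((A, A), +, 0)` -/

section LinearMonoid

variable {C : Type u} [CartRest.{v} C]

theorem TotalCommMon.isMonHom_add (A : TotalCommMon C) : IsMonHom (A.prod A) A A.add where
  total := A.isMon.rst_add
  map_add {T} a b := by
    have e : ∀ c : T ⟶ CRStruct.prod A.carrier A.carrier,
        c ≫ A.add = c ≫ fst _ _ + c ≫ snd _ _ := fun c => by
      rw [A.hom_add_def, lift_eta]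
    have h : ∀ a b : T ⟶ CRStruct.prod A.carrier A.carrier,
        (lift a b ≫ TotalCommMon.prodAdd A A) ≫ A.add = a ≫ A.add + b ≫ A.add := fun a b => by
      rw [e, e a, e b, comp_prodAdd_fst, comp_prodAdd_snd]
      exact add_add_add_comm _ _ _ _
    exact h a b
  map_zero T := by
    have h : (bang T ≫ lift A.zero A.zero) ≫ A.add = 0 := by
      have h1 : lift A.zero A.zero ≫ A.add = A.zero := by
        have h2 : (A.zero + A.zero : one ⟶ A.carrier) = A.zero := by
          have h3 : A.zero = (0 : one ⟶ A.carrier) := by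
            rw [A.hom_zero_def, bang_one, Category.id_comp]
          rw [h3, add_zero]
        exact h2
      rw [Category.assoc, h1]
      rfl
    exact h

theorem TotalCommMon.isMonHom_zero (A : TotalCommMon C) :
    IsMonHom (TotalCommMon.unit C) A A.zero where
  total := A.isMon.rst_zero
  map_add {T} a b := by
    have e : ∀ c : T ⟶ one, c ≫ A.zero = rst c ≫ 0 := fun c => by
      have h := comp_bang c
      rw [bang_one, Category.comp_id] at h
      rw [A.hom_zero_def, ← Category.assoc, ← h]
    have h : ∀ a b : T ⟶ one, (lift a b ≫ bang _) ≫ A.zero = a ≫ A.zero + b ≫ A.zero := by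
      intro a b
      rw [e, e a, e b, A.hom_add_def, rst_lift_left, rst_lift_right, rst_total_comp _ _ (rst_bang _),
        rst_lift, Category.assoc, Category.assoc, Category.assoc, ← A.hom_add_def, add_zero]
    exact h a b
  map_zero T := by
    have h : (bang T ≫ 𝟙 one) ≫ A.zero = bang T ≫ A.zero := by rw [Category.comp_id]
    exact h

theorem IsMonHom.lift {A B D : TotalCommMon C} {k : A.carrier ⟶ B.carrier}
    {l : A.carrier ⟶ D.carrier} (hk : IsMonHom A B k) (hl : IsMonHom A D l) :
    IsMonHom A (B.prod D) (CRStruct.lift k l) := by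
  have e1 : CRStruct.lift k l ≫ CRStruct.fst _ _ = k := by
    rw [lift_fst, hl.total, Category.id_comp]
  have e2 : CRStruct.lift k l ≫ CRStruct.snd _ _ = l := by
    rw [lift_snd, hk.total, Category.id_comp]
  exact isMonHom_prod (e1.symm ▸ hk) (e2.symm ▸ hl)

/-- The pairing of linear morphisms is linear. -/
theorem FaaHom.IsLinearOn.lift (S : FaaOps C) {P Q R : FaaObj C} {f : FaaHom P Q} {g : FaaHom P R}
    {h : P.pt ⟶ Q.pt} {h' : P.pt ⟶ R.pt} {k : P.mon.carrier ⟶ Q.mon.carrier}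
    {l : P.mon.carrier ⟶ R.mon.carrier} (hf : f.IsLinearOn h k) (hk : IsMonHom P.mon Q.mon k)
    (hg : g.IsLinearOn h' l) (hl : IsMonHom P.mon R.mon l) :
    (S.lift f g).IsLinearOn (CRStruct.lift h h') (CRStruct.lift k l) := by
  have h1 : (S.lift f g).star = CRStruct.lift h h' := by rw [S.lift_star, hf.star, hg.star]
  have hkl : IsMonHom P.mon (Q.mon.prod R.mon) (CRStruct.lift k l) := hk.lift hl
  have e : S.lift f g = FaaHom.linear (Q := Q.prod R) (CRStruct.lift h h') hkl := by
    refine FaaHom.ext_germ h1 fun s x hx m hm => ?_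
    rw [S.germ_lift f g hx]
    rw [h1] at hx
    have hx' := Stage.defined_lift.1 hx
    have hf' := hf.isLin_germ hk (s := s) (x := x) (hf.star ▸ hx'.1)
    have hg' := hg.isLin_germ hl (s := s) (x := x) (hg.star ▸ hx'.2)
    have hfg := (FaaHom.isLinearOn_linear (Q := Q.prod R) (CRStruct.lift h h') hkl).isLin_germ hkl
      (s := s) (x := x) hx
    by_cases hm1 : Multiset.card m = 1
    · obtain ⟨a, rfl⟩ := Multiset.card_eq_one.1 hm1
      rw [hf'.single, hg'.single, hfg.single]
      exact Stage.Vec.ext (comp_lift a.val k l).symm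
    · rw [hf'.other _ hm1, hg'.other _ hm1, hfg.other _ hm1]
      exact Stage.Vec.pair_zero
  rw [e]
  exact FaaHom.isLinearOn_linear _ _

namespace FaaStr

variable (S : FaaStr C)

/-- The commutative monoid `((A, A), +, 0)` in `Faà(C)`. -/
noncomputable def linearMonoid (A : TotalCommMon C) : LinearMonoid S A := by
  have ha : (FaaHom.linear (P := A.diag.prod A.diag) (Q := A.diag) A.add
      A.isMonHom_add).IsLinearOn A.add A.add := FaaHom.isLinearOn_linear _ _
  have hz : (FaaHom.linear (P := FaaObj.unit C) (Q := A.diag) A.zero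
      A.isMonHom_zero).IsLinearOn A.zero A.zero := FaaHom.isLinearOn_linear _ _
  have ma : IsMonHom (A.diag.prod A.diag).mon A.diag.mon A.add := A.isMonHom_add
  have mz : IsMonHom (FaaObj.unit C).mon A.diag.mon A.zero := A.isMonHom_zero
  have mf : IsMonHom (A.diag.prod A.diag).mon A.diag.mon (fst _ _) := isMonHom_fst A A
  have ms : IsMonHom (A.diag.prod A.diag).mon A.diag.mon (snd _ _) := isMonHom_snd A A
  have mf' : IsMonHom ((A.diag.prod A.diag).prod A.diag).mon (A.diag.prod A.diag).mon (fst _ _) :=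
    isMonHom_fst (A.prod A) A
  have ms' : IsMonHom ((A.diag.prod A.diag).prod A.diag).mon A.diag.mon (snd _ _) :=
    isMonHom_snd (A.prod A) A
  have mb := isMonHom_bang A
  have mi := IsMonHom.id A
  have hf := S.isLinearOn_fst A.diag A.diag
  have hs := S.isLinearOn_snd A.diag A.diag
  have hf' := S.isLinearOn_fst (A.diag.prod A.diag) A.diag
  have hs' := S.isLinearOn_snd (A.diag.prod A.diag) A.diag
  have hi := S.isLinearOn_id A.diag
  have hb := S.isLinearOn_bang A.diag
  -- The terms of each monoid law are composites and pairings of linear morphisms, hence linear,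
  -- with the corresponding terms of the law for `A` both as base map and as linear part. So each
  -- law follows from the one in `C`, used twice.
  have law1 := ((hb.comp S mb hz mz).lift S.toFaaOps (mb.comp mz) hi mi).comp S
    ((mb.comp mz).lift mi) ha ma
  have law2 := (hs.lift S.toFaaOps ms hf mf).comp S (ms.lift mf) ha ma
  have law3 := ((hf'.comp S mf' ha ma).lift S.toFaaOps (mf'.comp ma) hs' ms').comp S
    ((mf'.comp ma).lift ms') ha ma
  have law4 := ((hf'.comp S mf' hf mf).lift S.toFaaOps (mf'.comp mf)
    (((hf'.comp S mf' hs ms).lift S.toFaaOps (mf'.comp ms) hs' ms').comp S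
      ((mf'.comp ms).lift ms') ha ma) (((mf'.comp ms).lift ms').comp ma)).comp S
    ((mf'.comp mf).lift (((mf'.comp ms).lift ms').comp ma)) ha ma
  exact
  { add := FaaHom.linear (P := A.diag.prod A.diag) (Q := A.diag) A.add A.isMonHom_add
    isLinear_add := (FaaHom.isLinearOn_iff_isLinear A.isMon.rst_add).1 ha
    zero := FaaHom.linear (P := FaaObj.unit C) (Q := A.diag) A.zero A.isMonHom_zero
    isLinear_zero := (FaaHom.isLinearOn_iff_isLinear A.isMon.rst_zero).1 hz
    isMon :=
      { rst_add := S.rst_eq_id A.isMon.rst_add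
        rst_zero := S.rst_eq_id A.isMon.rst_zero
        zero_add := ext_isLinearOn (law1.congr A.isMon.zero_add A.isMon.zero_add) hi
        add_comm := ext_isLinearOn (law2.congr A.isMon.add_comm A.isMon.add_comm) ha
        add_assoc := ext_isLinearOn (law3.congr A.isMon.add_assoc A.isMon.add_assoc) law4 } }

end FaaStr

end LinearMonoid

/-! ### Components of `δ` at tuples -/

section Tuples

variable {C : Type u} [CartRest.{v} C] (S : FaaStr C) {T P Q : FaaObj C}

namespace FaaStr

/-- Tuples in `Faà(C)`. -/
def tup {r : ℕ} (E : Fin r → FaaHom T P) (y : FaaHom T Q) :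
    FaaHom T (pow (C := S.Cat) P Q r) := tuple (C := S.Cat) (T := T) (A := P) (X := Q) E y

variable {r : ℕ} (E : Fin r → FaaHom T P) (y : FaaHom T Q)

theorem tup_proj (i : Fin r) : S.comp (S.tup E y) (proj (C := S.Cat) P Q r i) =
    S.comp (S.rst (S.tup E y)) (E i) :=
  tuple_proj (C := S.Cat) (T := T) (A := P) (X := Q) E y i

theorem tup_last : S.comp (S.tup E y) (last (C := S.Cat) P Q r) =
    S.comp (S.rst (S.tup E y)) y :=
  tuple_last (C := S.Cat) (T := T) (A := P) (X := Q) E y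

end FaaStr

namespace FaaOps

variable (S : FaaOps C) {W R : FaaObj C} {t : FaaHom T W} {k : FaaHom W R} {e : FaaHom T R}
  {h : W.pt ⟶ R.pt} {l : W.mon.carrier ⟶ R.mon.carrier} {s : Stage C} {z : s.obj ⟶ T.pt}

/-- At a point where `t` is defined the restriction factor disappears, so the coordinate of `t`
along `k` may be replaced by `e`. -/
theorem star_of_comp_eq (hz : s.Defined z t.star) (hk : k.star = h) (hh : CRStruct.rst h = 𝟙 _)
    (H : S.comp t k = S.comp (S.rst t) e) : (z ≫ t.star) ≫ h = z ≫ e.star ∧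
      s.Defined z e.star ∧ s.Defined z (S.comp t k).star := by
  have h1 : (z ≫ t.star) ≫ h = z ≫ e.star := by
    have h2 := congrArg FaaHom.star H
    rw [S.comp_star, S.comp_star, S.rst_star, hk] at h2
    rw [Category.assoc, h2, ← Category.assoc, hz.comp_rst]
  have h3 : s.Defined z (t.star ≫ h) :=
    Stage.defined_comp.2 ⟨hz, .of_total hz.rst_comp hh⟩
  refine ⟨h1, ⟨hz.rst_left, ?_⟩, ?_⟩
  · rw [← h1, Category.assoc]
    exact h3.rst_comp
  · rw [S.comp_star, hk]
    exact h3

theorem germ_of_comp_eq (hz : s.Defined z t.star) (hk : k.IsLinearOn h l) (hh : CRStruct.rst h = 𝟙 _)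
    (hl : IsMonHom W.mon R.mon l) (H : S.comp t k = S.comp (S.rst t) e)
    (γ : Multiset (s.Vec T.mon)) : (t.germ s z γ).map hl = e.germ s z γ := by
  by_cases hγ : γ = 0
  · subst hγ
    rw [FaaHom.germ_empty, FaaHom.germ_empty, Stage.Vec.map_zero]
  · have h1 := (S.star_of_comp_eq hz hk.star hh H).2.2
    rw [← S.germ_comp_of_isLinearOn _ hk hl h1 hγ, H, S.germ_rst_comp]
    rwa [← H]

/-- A morphism given by the formula for the components of the comultiplication, at a tuple. -/
theorem full_comp_of_comp_eq {r : ℕ+} {c : Coords W P r} {g : FaaHom W Q.mon.diag}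
    {f : FaaHom P Q} (hg : g.IsComultAlong f c) {p : Fin r → FaaHom W P.mon.diag} {q : FaaHom W P}
    (hp : ∀ i, (p i).IsLinearOn (c.pt i) (c.vec i)) (hq : q.IsLinearOn c.base c.fib)
    {E : Fin r → FaaHom T P.mon.diag} {y : FaaHom T P}
    (hE : ∀ i, S.comp t (p i) = S.comp (S.rst t) (E i))
    (hy : S.comp t q = S.comp (S.rst t) y) (hz : s.Defined z (S.comp t g).star)
    {B : Type*} [Zero B] (β : Fin r → B)
    (G : B × Multiset (s.Vec T.mon) → s.Vec P.mon) (h0 : ∀ γ, G (0, γ) = y.germ s z γ)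
    (h1 : ∀ i γ, G (β i, γ) = (E i).full s z γ) (N : Multiset (s.Vec T.mon)) :
    (S.comp t g).full s z N = msum (parts N) fun ρ =>
      msum (matchings (Finset.univ.val.map β) ρ) fun μ =>
        f.germ s (z ≫ y.star) (μ.map G) := by
  have hz' := hz
  rw [S.comp_star] at hz'
  have ht := (Stage.defined_comp.1 hz').1
  rw [hg.full_comp S t hz β G]
  · rw [(S.star_of_comp_eq ht hq.star c.rst_base hy).1]
  · exact fun γ => (h0 γ).trans (S.germ_of_comp_eq ht hq c.rst_base c.isMonHom_fib hy γ).symm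
  · intro i
    obtain ⟨h3, h4, -⟩ := S.star_of_comp_eq ht (hp i).star (c.rst_pt i) (hE i)
    rw [h1, FaaHom.full_zero]
    apply Stage.Vec.ext
    rw [Stage.val_vecAt h4, Stage.val_vecAt (.of_total ht.rst_comp (c.rst_pt i)), h3]
  · intro i γ hγ
    rw [h1, FaaHom.full_of_ne _ _ _ hγ]
    exact (S.germ_of_comp_eq ht (hp i) (c.rst_pt i) (c.isMonHom_vec i) (hE i) γ).symm

end FaaOps

/-- A component of the comultiplication at a tuple. -/
theorem FaaStr.full_tup_comp {r : ℕ+} {E : Fin r → FaaHom T P.mon.diag} {y : FaaHom T P}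
    {g : FaaHom (S.powDiag P r) Q.mon.diag} {f : FaaHom P Q}
    (hg : g.IsComultAlong f (S.coords P r)) {s : Stage C} {z : s.obj ⟶ T.pt}
    (hz : s.Defined z (S.comp (S.tup E y) g).star) {B : Type*} [Zero B] (β : Fin r → B)
    (G : B × Multiset (s.Vec T.mon) → s.Vec P.mon) (h0 : ∀ γ, G (0, γ) = y.germ s z γ)
    (h1 : ∀ i γ, G (β i, γ) = (E i).full s z γ) (N : Multiset (s.Vec T.mon)) :
    (S.comp (S.tup E y) g).full s z N = msum (parts N) fun ρ =>
      msum (matchings (Finset.univ.val.map β) ρ) fun μ =>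
        f.germ s (z ≫ y.star) (μ.map G) :=
  S.full_comp_of_comp_eq hg (isLinearOn_proj S P.mon.diag P r) (isLinearOn_last S P.mon.diag P r)
    (S.tup_proj E y) (S.tup_last E y) hz β G h0 h1 N

end Tuples

/-! ### Vectors over a stage of `Faà(C)`, evaluated over stages of `C` -/

section StageVec

variable {C : Type u} [CartRest.{v} C] {S : FaaStr C} {A : TotalCommMon C} {L : LinearMonoid S A}

/-- The object of `Faà(C)` underlying a stage. -/
def Stage.ob (t : Stage S.Cat) : FaaObj C := t.obj

/-- The idempotent of a stage of `Faà(C)`. -/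
def Stage.idemHom (t : Stage S.Cat) : FaaHom t.ob t.ob := t.idem

/-- The morphism of `Faà(C)` underlying a vector. -/
def Stage.Vec.hom {t : Stage S.Cat} (a : t.Vec L.toMon) : FaaHom t.ob A.diag := a.val

/-- `z` lies in the domain of definition of the stage `t`. -/
def Stage.DefinedAt (t : Stage S.Cat) (s : Stage C) (z : s.obj ⟶ t.ob.pt) : Prop :=
  s.Defined z t.idemHom.star

variable {t : Stage S.Cat} {s : Stage C} {z : s.obj ⟶ t.ob.pt}

theorem Stage.defined_of_rst_eq_idem {R : FaaObj C} {f : FaaHom t.ob R}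
    (hf : S.rst f = t.idemHom) : s.Defined z f.star ↔ t.DefinedAt s z := by
  have h : t.idemHom.star = CRStruct.rst f.star := by rw [← hf, S.rst_star]
  rw [Stage.DefinedAt, h, Stage.defined_rst]

theorem Stage.Vec.defined_hom (hz : t.DefinedAt s z) (a : t.Vec L.toMon) :
    s.Defined z a.hom.star := (Stage.defined_of_rst_eq_idem a.rst_val).2 hz

theorem FaaHom.full_val {P : FaaObj C} (f : FaaHom P A.diag) {s : Stage C} {x : s.obj ⟶ P.pt}
    (h : s.Defined x f.star) {m : Multiset (s.Vec P.mon)} (hm : m = 0) :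
    (f.full s x m).val = x ≫ f.star := by
  rw [hm, f.full_zero, Stage.val_vecAt h]

/-- The addition of the linear monoid is `+` both on base maps and on vectors, so the values at the
empty family and at all other families add up alike. -/
theorem Stage.Vec.full_add (hz : t.DefinedAt s z) (a b : t.Vec L.toMon)
    (N : Multiset (s.Vec t.ob.mon)) :
    (a + b).hom.full s z N = a.hom.full s z N + b.hom.full s z N := by
  have e : (a + b).hom = S.comp (S.lift a.hom b.hom) L.add := rfl
  have h := (a + b).defined_hom hz
  have hL := (FaaHom.isLinearOn_iff_isLinear A.isMon.rst_add).2 L.isLinear_add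
  have hs : (a + b).hom.star = a.hom.star + b.hom.star := by
    rw [e, S.comp_star, S.lift_star, hL.star]
    rfl
  by_cases hN : N = 0
  · apply Stage.Vec.ext
    rw [FaaHom.full_val _ h hN, Stage.Vec.val_add, FaaHom.full_val _ (a.defined_hom hz) hN,
      FaaHom.full_val _ (b.defined_hom hz) hN, hs]
    exact A.comp_add _ _ _
  · rw [FaaHom.full_of_ne _ _ _ hN, FaaHom.full_of_ne _ _ _ hN, FaaHom.full_of_ne _ _ _ hN]
    rw [e] at h ⊢
    rw [S.germ_comp_of_isLinearOn _ hL A.isMonHom_add h hN, S.germ_lift]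
    · rfl
    · rw [S.comp_star] at h
      exact (Stage.defined_comp.1 h).1

theorem Stage.Vec.full_zero (hz : t.DefinedAt s z)
    (N : Multiset (s.Vec t.ob.mon)) :
    (0 : t.Vec L.toMon).hom.full s z N = 0 := by
  have e : (0 : t.Vec L.toMon).hom = S.comp (S.rst t.idemHom)
      (S.comp (S.bang t.ob) L.zero) :=
    congrArg (fun k : FaaHom t.ob t.ob => S.comp k (S.comp (S.bang t.ob) L.zero))
      t.rst_idem.symm
  have h := (0 : t.Vec L.toMon).defined_hom hz
  have hL := (FaaHom.isLinearOn_iff_isLinear A.isMon.rst_zero).2 L.isLinear_zero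
  by_cases hN : N = 0
  · apply Stage.Vec.ext
    rw [FaaHom.full_val _ h hN, e, S.comp_star, S.rst_star, S.comp_star, hL.star,
      (S.isLinear_bang _).1, ← Category.assoc, Stage.Defined.comp_rst hz]
    refine (A.comp_zero z).trans ?_
    rw [hz.rst_left]
    rfl
  · rw [FaaHom.full_of_ne _ _ _ hN]
    rw [e] at h ⊢
    have h2 := h
    rw [S.comp_star, S.rst_star] at h2
    have h3 := (Stage.defined_comp.1 h2).2
    rw [Stage.Defined.comp_rst hz] at h3
    rw [S.germ_rst_comp _ _ h, S.germ_comp_of_isLinearOn _ hL A.isMonHom_zero h3 hN]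
    exact (congrArg (Stage.Vec.map A.isMonHom_zero) (Stage.Vec.unit_ext _ 0)).trans
      (Stage.Vec.map_zero _)

/-- The value of a vector over a stage of `Faà(C)` at a family of vectors over a stage of `C`. -/
noncomputable def Stage.fullHom (L : LinearMonoid S A) (hz : t.DefinedAt s z)
    (N : Multiset (s.Vec t.ob.mon)) : t.Vec L.toMon →+ s.Vec A where
  toFun a := a.hom.full s z N
  map_zero' := Stage.Vec.full_zero hz N
  map_add' a b := Stage.Vec.full_add hz a b N

theorem Stage.Vec.full_msum (hz : t.DefinedAt s z) {ι : Type*} (m : Multiset ι)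
    (F : ι → t.Vec L.toMon) (N : Multiset (s.Vec t.ob.mon)) :
    (msum m F).hom.full s z N = msum m fun i => (F i).hom.full s z N :=
  map_msum (Stage.fullHom L hz N) m F

/-- Equality of restrictions in `Faà(C)` is automatic here, since both vectors have the domain of
the stage; hence values determine the vector. -/
theorem Stage.Vec.ext_full {a b : t.Vec L.toMon} (H : ∀ (s : Stage C)
    (z : s.obj ⟶ t.ob.pt), t.DefinedAt s z →
      ∀ N, a.hom.full s z N = b.hom.full s z N) : a = b := by
  have h : S.rst a.hom = S.rst b.hom := a.rst_val.trans b.rst_val.symm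
  have h1 := congrArg FaaHom.star h
  rw [S.rst_star, S.rst_star] at h1
  refine Stage.Vec.ext (FaaHom.ext_full (f := a.hom) (g := b.hom) h1 fun s z hz _ N => ?_)
  exact H s z ((Stage.defined_of_rst_eq_idem a.rst_val).1 hz) N

end StageVec

/-! ### The comultiplication on morphisms -/

section Comult

variable {C : Type u} [CartRest.{v} C] {S : FaaStr C} {P Q R : FaaObj C}

open Classical in
/-- What is to be inserted for a block with vectors over a stage `t` of `Faà(C)` and vectors over a
stage of `C`, at the point `x`. -/
noncomputable def pairGrid {A : TotalCommMon C} {L : LinearMonoid S A} {t : Stage S.Cat} {X : C}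
    (x : FaaHom t.ob ⟨A, X⟩) (s : Stage C) (z : s.obj ⟶ t.ob.pt)
    (p : Multiset (t.Vec L.toMon) × Multiset (s.Vec t.ob.mon)) : s.Vec A :=
  if p.1 = 0 then x.germ s z p.2 else linMap (fun a => a.hom.full s z p.2) p.1

section PairGrid

variable {A : TotalCommMon C} {L : LinearMonoid S A} {t : Stage S.Cat} {X : C}
  (x : FaaHom t.ob ⟨A, X⟩) (s : Stage C) (z : s.obj ⟶ t.ob.pt)

theorem pairGrid_zero (γ : Multiset (s.Vec t.ob.mon)) :
    pairGrid (L := L) x s z (0, γ) = x.germ s z γ := if_pos rfl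

theorem pairGrid_singleton (a : t.Vec L.toMon) (γ : Multiset (s.Vec t.ob.mon)) :
    pairGrid x s z ({a}, γ) = a.hom.full s z γ :=
  (if_neg (Multiset.singleton_ne_zero a)).trans (linMap_singleton _ _)

theorem pairGrid_of_one_lt (p : Multiset (t.Vec L.toMon) × Multiset (s.Vec t.ob.mon))
    (h : 1 < Multiset.card p.1) : pairGrid x s z p = 0 :=
  (if_neg (by rintro h0; rw [h0] at h; simp at h)).trans (linMap_of_one_lt _ h)

variable {s z}

theorem bcomp_pairGrid_multiAdditive (hz : t.DefinedAt s z) {M : Type*} [AddCommMonoid M]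
    {Φ : Multiset (s.Vec A) → M} (hΦ : MultiAdditive Φ) (N : Multiset (s.Vec t.ob.mon)) :
    MultiAdditive fun m => bcomp Φ (pairGrid (L := L) x s z) m N := by
  have e : (fun m => bcomp Φ (pairGrid (L := L) x s z) m N) = fun m => msum (parts N) fun ρ =>
      msum (matchings (m.map singleton) ρ) fun μ => Φ (μ.map (pairGrid x s z)) :=
    funext fun m => bcomp_of_left hΦ.zero (pairGrid_of_one_lt x s z) m N
  rw [e]
  refine MultiAdditive.msum (fun ρ => msum_matchings_multiAdditive hΦ (fun a b γ => ?_)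
    (fun γ => ?_) ρ) _
  · rw [pairGrid_singleton, pairGrid_singleton, pairGrid_singleton, Stage.Vec.full_add hz]
  · rw [pairGrid_singleton, Stage.Vec.full_zero hz]

end PairGrid

variable {LP : LinearMonoid S P.mon} {LQ : LinearMonoid S Q.mon}

/-- A component of the comultiplication at a family of vectors over a stage. -/
theorem FaaHom.IsComultAlong.full_tup_comp {f : FaaHom P Q} {r : ℕ+}
    {g : FaaHom (S.powDiag P r) Q.mon.diag} (hg : g.IsComultAlong f (S.coords P r))
    {t : Stage S.Cat} {x : FaaHom t.ob P} (a : Fin r → t.Vec LP.toMon) {s : Stage C}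
    {z : s.obj ⟶ t.ob.pt} (hz : s.Defined z (S.comp (S.tup (fun i => (a i).hom) x) g).star)
    (N : Multiset (s.Vec t.ob.mon)) :
    (S.comp (S.tup (fun i => (a i).hom) x) g).full s z N =
      bcomp (f.germ s (z ≫ x.star)) (pairGrid x s z) (Finset.univ.val.map a) N := by
  rw [bcomp_of_left (f.multiAdditive_germ s _).zero (pairGrid_of_one_lt x s z), Multiset.map_map]
  exact S.full_tup_comp hg hz (fun i => {a i}) _ (pairGrid_zero x s z)
    (fun i γ => pairGrid_singleton x s z (a i) γ) N

/-- A morphism `g` of `Faà(Faà(C))` is `δ(f)`. -/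
structure IsComultOf (f : FaaHom P Q)
    (g : FaaHom (C := S.Cat) ⟨LP.toMon, P⟩ ⟨LQ.toMon, Q⟩) : Prop where
  star : g.star = f
  d : ∀ r : ℕ+, FaaHom.IsComultAlong (W := S.powDiag P r) (g.d r) f (S.coords P r)

theorem FaaStr.rst_congr (S : FaaStr C) {f : FaaHom P Q} {g : FaaHom P R}
    (h : CRStruct.rst f.star = CRStruct.rst g.star) : S.rst f = S.rst g :=
  ext_isLinearOn (S.isLinearOn_rst f) (h ▸ S.isLinearOn_rst g)

/-- Restrictions are determined by restrictions of base maps, where the claim is known. -/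
theorem FaaStr.rst_comultAlong (S : FaaStr C) (f : FaaHom P Q) (r : ℕ+) :
    S.rst (comultAlong f (S.coords P r)) =
      S.rst (S.comp (last (C := S.Cat) P.mon.diag P r) f) := by
  refine S.rst_congr ((isComultAlong_comultAlong f (S.coords P r)).rst_star.trans ?_)
  have h := S.comp_star (last (C := S.Cat) P.mon.diag P r : FaaHom (S.powDiag P r) P) f
  have h' : FaaHom.star (last (C := S.Cat) P.mon.diag P r : FaaHom (S.powDiag P r) P) =
    (S.coords P r).base := (isLinearOn_last S P.mon.diag P r).star
  rw [h'] at h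
  exact congrArg CRStruct.rst h.symm

/-- The values of the components of `δ(f)` over a stage. -/
theorem exists_comultAlong_family (f : FaaHom P Q) (t : Stage S.Cat) (x : FaaHom t.ob P)
    (h1 : S.rst x = t.idemHom) (h2 : S.rst (S.comp x f) = t.idemHom) :
    ∃ Φ : Multiset (t.Vec LP.toMon) → t.Vec LQ.toMon, MultiAdditive Φ ∧
      ∀ (r : ℕ+) (a : Fin r → t.Vec LP.toMon),
        S.comp (S.tup (fun i => (a i).hom) x) (comultAlong f (S.coords P r)) =
          (Φ (Finset.univ.val.map a)).hom := by
  have key : ∀ (r : ℕ+) (a : Fin r → t.Vec LP.toMon),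
      S.rst (S.comp (S.tup (fun i => (a i).hom) x) (comultAlong f (S.coords P r))) =
        t.idemHom := fun r a => by
    have ht := rst_tuple (C := S.Cat) (T := t.obj) (X := P) (x := x) (e := t.idem)
      (fun i => (a i).rst_val) h1
    have h3 := rst_tuple_comp_of_rst (C := S.Cat) (T := t.obj) (fun i => (a i).val) x
      (S.rst_comultAlong f r)
    exact h3.trans ((congrArg₂ (fun k l : t.obj ⟶ t.obj => k ≫ l) ht h2).trans t.idem_idem)
  let ψ : ∀ (r : ℕ+) (a : Fin r → t.Vec LP.toMon), t.Vec LQ.toMon := fun r a =>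
    ⟨S.comp (S.tup (fun i => (a i).hom) x) (comultAlong f (S.coords P r)), key r a⟩
  have hψ : ∀ (r : ℕ+) (a : Fin r → t.Vec LP.toMon) (s : Stage C) (z : s.obj ⟶ t.ob.pt)
      (hz : t.DefinedAt s z) N, (ψ r a).hom.full s z N =
        bcomp (f.germ s (z ≫ x.star)) (pairGrid x s z) (Finset.univ.val.map a) N :=
    fun r a s z hz N => (isComultAlong_comultAlong f (S.coords P r)).full_tup_comp a
      ((ψ r a).defined_hom hz) N
  -- Only the values of the vector over stages of `C` are prescribed. They depend on the multiset
  -- alone and determine the vector, so additivity and independence of the enumeration are inherited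
  -- from `bcomp`. The empty family is exempt, since no component belongs to it.
  have ex : ∀ m : Multiset (t.Vec LP.toMon), ∃ y : t.Vec LQ.toMon, (m ≠ 0 → ∀ (s : Stage C) (z : s.obj ⟶ t.ob.pt), t.DefinedAt s z → ∀ N,
        y.hom.full s z N = bcomp (f.germ s (z ≫ x.star)) (pairGrid x s z) m N) := by
    intro m
    by_cases hm : m = 0
    · exact ⟨0, fun h => absurd hm h⟩
    · obtain ⟨r, a, rfl⟩ : ∃ (r : ℕ+) (a : Fin r → t.Vec LP.toMon), m = Finset.univ.val.map a := by
        obtain ⟨a, ha⟩ := FaaHom.exists_fin_eq m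
        exact ⟨⟨Multiset.card m, Multiset.card_pos.2 hm⟩, a, ha⟩
      exact ⟨ψ r a, fun _ s z hz N => hψ r a s z hz N⟩
  choose Φ hΦ using ex
  refine ⟨Φ, ⟨fun a b m => ?_, fun m => ?_⟩, fun r a => ?_⟩
  · refine Stage.Vec.ext_full fun s z hz N => ?_
    have h := bcomp_pairGrid_multiAdditive (L := LP) x hz (f.multiAdditive_germ s (z ≫ x.star)) N
    rw [Stage.Vec.full_add hz, hΦ _ (by simp) s z hz, hΦ _ (by simp) s z hz,
      hΦ _ (by simp) s z hz]
    exact h.add a b m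
  · refine Stage.Vec.ext_full fun s z hz N => ?_
    have h := bcomp_pairGrid_multiAdditive (L := LP) x hz (f.multiAdditive_germ s (z ≫ x.star)) N
    rw [Stage.Vec.full_zero hz, hΦ _ (by simp) s z hz]
    exact h.zero m
  · have e : ψ r a = Φ (Finset.univ.val.map a) := Stage.Vec.ext_full fun s z hz N => by
      rw [hψ r a s z hz N, hΦ _ (FaaHom.univ_map_ne_zero r.ne_zero a) s z hz]
    exact congrArg Stage.Vec.hom e

variable (LP LQ) in
/-- `δ(f)` -/
noncomputable def comultHom (f : FaaHom P Q) :
    FaaHom (C := S.Cat) ⟨LP.toMon, P⟩ ⟨LQ.toMon, Q⟩ :=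
  have H := fun r : ℕ+ => additive_symm_of_stage (C := S.Cat) (A := LP.toMon) (B := LQ.toMon)
    (X := P) (Y := Q) (n := r) (h := comultAlong f (S.coords P r)) (k := f)
    (S.rst_comultAlong f r) fun t x h1 h2 =>
      let ⟨Φ, hΦ, h⟩ := exists_comultAlong_family f t x h1 h2
      ⟨Φ, hΦ, fun a => h r a⟩
  { star := f
    d := fun r => comultAlong f (S.coords P r)
    rst_d := fun r => S.rst_comultAlong f r
    additive := fun r => (H r).1
    symm := fun r => (H r).2 }

theorem isComultOf_comultHom (f : FaaHom P Q) : IsComultOf f (comultHom LP LQ f) :=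
  ⟨rfl, fun r => isComultAlong_comultAlong f (S.coords P r)⟩

end Comult

/-! ### Homomorphisms between linear monoids -/

section MonHom

variable {C : Type u} [CartRest.{v} C]

theorem IsMonHom.of_eq {A B : TotalCommMon C} {k : A.carrier ⟶ B.carrier} (hk : rst k = 𝟙 _)
    (hadd : A.add ≫ k = CRStruct.lift (fst _ _ ≫ k) (snd _ _ ≫ k) ≫ B.add)
    (hzero : A.zero ≫ k = B.zero) : IsMonHom A B k where
  total := hk
  map_add a b := by
    rw [A.hom_add_def, B.hom_add_def, Category.assoc, hadd, ← Category.assoc, comp_lift,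
      ← Category.assoc, lift_fst, ← Category.assoc, lift_snd, Category.assoc, Category.assoc,
      TotalCommMon.rst_comp_lift _ _ _ _ hk hk]
  map_zero T := by
    rw [A.hom_zero_def, B.hom_zero_def, Category.assoc, hzero]

theorem IsMonHom.add_comp {A B : TotalCommMon C} {k : A.carrier ⟶ B.carrier}
    (hk : IsMonHom A B k) : A.add ≫ k = CRStruct.lift (fst _ _ ≫ k) (snd _ _ ≫ k) ≫ B.add := by
  have h := hk.map_add (fst A.carrier A.carrier) (snd _ _)
  rw [A.hom_add_def, lift_fst_snd, Category.id_comp] at h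
  exact h

theorem IsMonHom.zero_comp {A B : TotalCommMon C} {k : A.carrier ⟶ B.carrier}
    (hk : IsMonHom A B k) : A.zero ≫ k = B.zero := by
  have h := hk.map_zero one
  rw [A.hom_zero_def, B.hom_zero_def, bang_one, Category.id_comp, Category.id_comp] at h
  exact h

/-- The morphism `((A, A)) ⟶ ((B, B))` with linear part `k` and base map `k`. -/
noncomputable def IsMonHom.diag {A B : TotalCommMon C} {k : A.carrier ⟶ B.carrier}
    (hk : IsMonHom A B k) : FaaHom A.diag B.diag := FaaHom.linear (P := A.diag) (Q := B.diag) k hk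

theorem IsMonHom.isLinearOn_diag {A B : TotalCommMon C} {k : A.carrier ⟶ B.carrier}
    (hk : IsMonHom A B k) : hk.diag.IsLinearOn k k := FaaHom.isLinearOn_linear _ _

variable {S : FaaStr C}

theorem LinearMonoid.isLinearOn_add {A : TotalCommMon C} (L : LinearMonoid S A) :
    L.add.IsLinearOn A.add A.add :=
  (FaaHom.isLinearOn_iff_isLinear A.isMon.rst_add).2 L.isLinear_add

theorem LinearMonoid.isLinearOn_zero {A : TotalCommMon C} (L : LinearMonoid S A) :
    L.zero.IsLinearOn A.zero A.zero :=
  (FaaHom.isLinearOn_iff_isLinear A.isMon.rst_zero).2 L.isLinear_zero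

/-- The two sides of each condition are linear morphisms, so the conditions reduce to those for `k`
on base maps and on linear parts. -/
theorem IsMonHom.isMonHom_diag {A B : TotalCommMon C} {k : A.carrier ⟶ B.carrier}
    (hk : IsMonHom A B k) (L : LinearMonoid S A) (L' : LinearMonoid S B) :
    IsMonHom (C := S.Cat) L.toMon L'.toMon hk.diag := by
  have hd := hk.isLinearOn_diag
  have mf : IsMonHom (A.diag.prod A.diag).mon A.diag.mon (fst _ _) := isMonHom_fst A A
  have ms : IsMonHom (A.diag.prod A.diag).mon A.diag.mon (snd _ _) := isMonHom_snd A A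
  have ma : IsMonHom (A.diag.prod A.diag).mon A.diag.mon A.add := A.isMonHom_add
  have ma' : IsMonHom (B.diag.prod B.diag).mon B.diag.mon B.add := B.isMonHom_add
  have mz : IsMonHom (FaaObj.unit C).mon A.diag.mon A.zero := A.isMonHom_zero
  have h1 := L.isLinearOn_add.comp S ma hd hk
  have h2 := (((S.isLinearOn_fst A.diag A.diag).comp S mf hd hk).lift S.toFaaOps (mf.comp hk)
    ((S.isLinearOn_snd A.diag A.diag).comp S ms hd hk) (ms.comp hk)).comp S
      ((mf.comp hk).lift (ms.comp hk)) L'.isLinearOn_add ma'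
  have h3 := L.isLinearOn_zero.comp S mz hd hk
  exact IsMonHom.of_eq (C := S.Cat) (S.rst_eq_id hk.total)
    (ext_isLinearOn (h1.congr hk.add_comp hk.add_comp) h2)
    (ext_isLinearOn (h3.congr hk.zero_comp hk.zero_comp) L'.isLinearOn_zero)

theorem IsMonHom.diag_eq {A B : TotalCommMon C} {k : A.carrier ⟶ B.carrier}
    (hk : IsMonHom A B k) {f : FaaHom A.diag B.diag} (hf : f.IsLinearOn k k) : hk.diag = f :=
  ext_isLinearOn hk.isLinearOn_diag hf

theorem FaaOps.full_comp_of_isLinearOn (S : FaaOps C) {T : FaaObj C} {A B : TotalCommMon C}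
    (f : FaaHom T A.diag) {g : FaaHom A.diag B.diag} {k : A.carrier ⟶ B.carrier}
    (hg : g.IsLinearOn k k) (hk : IsMonHom A B k) {s : Stage C} {z : s.obj ⟶ T.pt}
    (hz : s.Defined z f.star) (N : Multiset (s.Vec T.mon)) :
    (S.comp f g).full s z N = (f.full s z N).map hk := by
  have hz' : s.Defined z (S.comp f g).star := by
    rw [S.comp_star, hg.star]
    exact Stage.defined_comp.2 ⟨hz, .of_total hz.rst_comp hk.total⟩
  by_cases hN : N = 0
  · apply Stage.Vec.ext
    rw [FaaHom.full_val _ hz' hN, S.comp_star, hg.star]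
    change _ = (f.full s z N).val ≫ k
    rw [FaaHom.full_val _ hz hN, Category.assoc]
  · rw [FaaHom.full_of_ne _ _ _ hN, FaaHom.full_of_ne _ _ _ hN]
    exact S.germ_comp_of_isLinearOn f hg hk hz' hN

end MonHom

/-! ### Functoriality of `δ` -/

section ComultFunctor

theorem bcomp_of_isLin {α β A M : Type*} [AddCommMonoid M] [AddCommMonoid A]
    {Ω : Multiset A → M} {k : A → M} (hΩ : IsLin Ω k) (u : Multiset α × Multiset β → A)
    {s : Multiset α} (hs : s ≠ 0) (t : Multiset β) : bcomp Ω u s t = k (u (s, t)) := by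
  rw [bcomp_eq_pcomp, pcomp_of_isLin_left hΩ, filterMap_getLeft_add, filterMap_getRight_add]
  intro h
  have h1 := congrArg Multiset.card h
  simp only [Multiset.card_add, Multiset.card_map, Multiset.card_zero] at h1
  have := Multiset.card_pos.2 hs
  omega

variable {C : Type u} [CartRest.{v} C] {S : FaaStr C} {P Q R : FaaObj C}
  {LP : LinearMonoid S P.mon} {LQ : LinearMonoid S Q.mon} {LR : LinearMonoid S R.mon}

/-- The bridge to combinatorics: after two evaluations, a germ of `δ(f)` is a sum over partitions of
`m` and of `N` and matchings of their blocks. -/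
theorem IsComultOf.full_germ {f : FaaHom P Q} {g : FaaHom (C := S.Cat) ⟨LP.toMon, P⟩ ⟨LQ.toMon, Q⟩}
    (hg : IsComultOf f g) {t : Stage S.Cat} {x : FaaHom t.ob P}
    (hx : t.Defined (X := P) (Y := Q) x f) {m : Multiset (t.Vec LP.toMon)} (hm : m ≠ 0)
    {s : Stage C} {z : s.obj ⟶ t.ob.pt} (hz : t.DefinedAt s z) (N : Multiset (s.Vec t.ob.mon)) :
    (Stage.Vec.hom (L := LQ) (FaaHom.germ g t x m)).full s z N =
      bcomp (f.germ s (z ≫ x.star)) (pairGrid x s z) m N := by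
  obtain ⟨r, a, rfl⟩ : ∃ (r : ℕ+) (a : Fin r → t.Vec LP.toMon), m = Finset.univ.val.map a := by
    obtain ⟨a, ha⟩ := FaaHom.exists_fin_eq m
    exact ⟨⟨Multiset.card m, Multiset.card_pos.2 hm⟩, a, ha⟩
  have hx' : t.Defined x g.star := hg.star.symm ▸ hx
  have e : S.comp (S.tup (fun i => (a i).hom) x) (g.d r) =
    Stage.Vec.hom (L := LQ) (FaaHom.germ g t x (Finset.univ.val.map a)) :=
      FaaHom.tuple_comp_d_eq_germ g hx' a
  rw [← e]
  refine (hg.d r).full_tup_comp a ?_ N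
  exact (congrArg (fun k : FaaHom t.ob Q.mon.diag => s.Defined z k.star) e).mpr
    (Stage.Vec.defined_hom hz _)

theorem Stage.defined_of_defined {t : Stage S.Cat} {x : FaaHom t.ob P} {f : FaaHom P Q}
    (hx : t.Defined (X := P) (Y := Q) x f) {s : Stage C} {z : s.obj ⟶ t.ob.pt}
    (hz : t.DefinedAt s z) : s.Defined z x.star ∧ s.Defined (z ≫ x.star) f.star := by
  have h := (Stage.defined_of_rst_eq_idem (f := S.comp x f) hx.rst_comp).2 hz
  rw [S.comp_star] at h
  exact Stage.defined_comp.1 h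

-- Blocks of a partition are nonempty, so replacing a block by its value never collides with the
-- marker `0` of an unmatched place.
open Classical in
theorem msum_matchings_map_singleton {α β B M : Type*} [Zero α] [Zero β] [AddCommMonoid M]
    (φ : α → B) {π : Multiset α} (hπ : ∀ b ∈ π, b ≠ 0) (ρ : Multiset β)
    (F : Multiset (Multiset B × β) → M) :
    msum (matchings ((π.map φ).map singleton) ρ) F = msum (matchings π ρ) fun μ =>
      F (μ.map fun p => (if p.1 = 0 then 0 else {φ p.1}, p.2)) := by
  have e : (π.map φ).map singleton = π.map fun b => if b = 0 then (0 : Multiset B) else {φ b} := by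
    rw [Multiset.map_map]
    exact Multiset.map_congr rfl fun b hb => (if_neg (hπ b hb)).symm
  have h := msum_matchings_map (fun b : α => if b = 0 then (0 : Multiset B) else {φ b})
    (id : β → β) (if_pos rfl) rfl π ρ F
  rw [Multiset.map_id] at h
  rw [e]
  exact h

open Classical in
theorem msum_matchings_map_singleton_right {α β B M : Type*} [Zero α] [Zero β] [AddCommMonoid M]
    (φ : β → B) (π : Multiset α) {ρ : Multiset β} (hρ : ∀ b ∈ ρ, b ≠ 0)
    (F : Multiset (α × Multiset B) → M) :
    msum (matchings π ((ρ.map φ).map singleton)) F = msum (matchings π ρ) fun μ =>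
      F (μ.map fun p => (p.1, if p.2 = 0 then 0 else {φ p.2})) := by
  have e : (ρ.map φ).map singleton = ρ.map fun b => if b = 0 then (0 : Multiset B) else {φ b} := by
    rw [Multiset.map_map]
    exact Multiset.map_congr rfl fun b hb => (if_neg (hρ b hb)).symm
  have h := msum_matchings_map (id : α → α)
    (fun b : β => if b = 0 then (0 : Multiset B) else {φ b}) rfl (if_pos rfl) π ρ F
  rw [Multiset.map_id] at h
  rw [e]
  exact h

/-- After evaluating twice, one side is `bcomp` with outer function a composite of germs, the other
a composite whose inner values are again of the form `bcomp`; `bcomp_assoc` identifies them. -/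
theorem comultHom_comp (S₂ : FaaStr S.Cat) (f : FaaHom P Q) (g : FaaHom Q R) :
    comultHom LP LR (S.comp f g) = S₂.comp (comultHom LP LQ f) (comultHom LQ LR g) := by
  have hs : (comultHom LP LR (S.comp f g)).star =
    (S₂.comp (comultHom LP LQ f) (comultHom LQ LR g)).star :=
      (S₂.comp_star (comultHom LP LQ f) (comultHom LQ LR g)).symm
  refine FaaHom.ext_germ hs fun t x hx m hm => ?_
  let x' : FaaHom t.ob P := x
  let y : FaaHom t.ob Q := S.comp x' f
  have hx1 : t.Defined (X := P) (Y := R) x' (S.comp f g) := hx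
  have hx2 := (Stage.defined_comp (C := S.Cat) (X := P) (Y := Q) (Z := R) (x := x') (k := f)
    (l := g)).1 hx1
  have hx3 : t.Defined x (S₂.comp (comultHom LP LQ f) (comultHom LQ LR g)).star := hs ▸ hx
  refine Stage.Vec.ext_full (L := LR) fun s z hz N => ?_
  obtain ⟨hd, hdf⟩ := Stage.defined_of_defined hx2.1 hz
  obtain ⟨-, hdfg⟩ := Stage.defined_of_defined hx1 hz
  have hdy : s.Defined z y.star := (Stage.defined_of_rst_eq_idem hx2.1.rst_comp).2 hz
  have ey : (z ≫ x'.star) ≫ f.star = z ≫ y.star := by rw [S.comp_star, Category.assoc]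
  rw [(isComultOf_comultHom (S.comp f g)).full_germ hx1 hm hz,
    funext (S.germ_comp f g hdfg), ← bcomp_assoc (g.multiAdditive_germ s _), ey,
    S₂.germ_comp (comultHom LP LQ f) (comultHom LQ LR g) hx3 m]
  refine Eq.trans ?_ (Stage.Vec.full_msum hz _ _ N).symm
  refine msum_congr fun π hπ => ?_
  have hπ0 : π.map (FaaHom.germ (comultHom LP LQ f) t x) ≠ 0 := by
    intro h0
    rw [Multiset.map_eq_zero] at h0
    subst h0
    exact hm (sum_of_mem_parts hπ).symm
  refine Eq.trans ?_ ((isComultOf_comultHom g).full_germ (x := y) hx2.2 hπ0 hz N).symm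
  rw [bcomp_of_left (g.multiAdditive_germ s _).zero (pairGrid_of_one_lt y s z)]
  refine msum_congr fun ρ _ => ?_
  rw [msum_matchings_map_singleton _ (ne_zero_of_mem_parts hπ)]
  refine msum_congr fun μ _ => congrArg _ ?_
  rw [Multiset.map_map]
  refine Multiset.map_congr rfl fun p _ => ?_
  obtain ⟨β, γ⟩ := p
  -- An unmatched block of `N` is handled by the germ of the composite point, a block with vectors
  -- from `m` by a germ of `δ(f)`.
  by_cases hβ : β = 0
  · subst hβ
    simp only [Function.comp_apply, if_true]
    rw [bcomp_zero_left, pairGrid_zero, S.germ_comp x' f hdy]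
    rfl
  · simp only [Function.comp_apply, if_neg hβ]
    rw [pairGrid_singleton]
    exact ((isComultOf_comultHom f).full_germ hx2.1 hβ hz γ).symm

/-- If the germ of `f` is linear only the single block `(m, N)` survives, and it vanishes unless `m`
is one vector. Thus identities, restrictions and projections are sent to their counterparts. -/
theorem isLinearOn_comultHom {f : FaaHom P Q} {h : P.pt ⟶ Q.pt}
    {k : P.mon.carrier ⟶ Q.mon.carrier} (hf : f.IsLinearOn h k) (hk : IsMonHom P.mon Q.mon k) :
    (comultHom LP LQ f).IsLinearOn f hk.diag := by
  have hd := hk.isMonHom_diag LP LQ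
  have e : comultHom LP LQ f = FaaHom.linear (C := S.Cat) (P := ⟨LP.toMon, P⟩)
      (Q := ⟨LQ.toMon, Q⟩) f hd := by
    refine FaaHom.ext_germ (C := S.Cat) rfl fun t x hx m hm => ?_
    refine Stage.Vec.ext_full (L := LQ) fun s z hz N => ?_
    let x' : FaaHom t.ob P := x
    have hx1 : t.Defined (X := P) (Y := Q) x' f := hx
    have hl := (FaaHom.isLinearOn_linear (C := S.Cat) (P := ⟨LP.toMon, P⟩)
      (Q := ⟨LQ.toMon, Q⟩) f hd).isLin_germ hd (s := t) (x := x) hx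
    rw [(isComultOf_comultHom f).full_germ hx1 hm hz,
      bcomp_of_isLin (hf.isLin_germ hk (Stage.defined_of_defined hx1 hz).2) _ hm]
    by_cases hm1 : Multiset.card m = 1
    · obtain ⟨a, rfl⟩ := Multiset.card_eq_one.1 hm1
      rw [pairGrid_singleton, hl.single]
      exact (S.full_comp_of_isLinearOn (Stage.Vec.hom a) hk.isLinearOn_diag hk
        (Stage.Vec.defined_hom hz a) N).symm
    · have hm2 := Multiset.card_pos.2 hm
      rw [pairGrid_of_one_lt _ _ _ _ (show 1 < Multiset.card m by omega), hl.other _ hm1,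
        Stage.Vec.map_zero]
      exact (Stage.Vec.full_zero hz N).symm
  rw [e]
  exact FaaHom.isLinearOn_linear _ _

end ComultFunctor

/-! ### Strictness of `δ`, and the first counit law -/

section ComultFunctor

theorem IsMonHom.congr {C : Type u} [CartRest.{v} C] {A B : TotalCommMon C}
    {k l : A.carrier ⟶ B.carrier} (h : IsMonHom A B k) (e : k = l) : IsMonHom A B l := e ▸ h

variable {C : Type u} [CartRest.{v} C] (S : FaaStr C)

namespace FaaStr

/-- The action of the comultiplication on objects. -/
noncomputable abbrev comultObj (P : FaaObj C) : FaaObj S.Cat := FaaRes.comultObj S S.linearMonoid P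

/-- The action of the comultiplication on morphisms. -/
noncomputable abbrev comultMap {P Q : FaaObj C} (f : FaaHom P Q) :
    FaaHom (S.comultObj P) (S.comultObj Q) :=
  comultHom (S.linearMonoid P.mon) (S.linearMonoid Q.mon) f

theorem comultObj_unit : S.comultObj (FaaObj.unit C) = FaaObj.unit S.Cat :=
  FaaObj.ext_of_isMonHom (C := S.Cat) (P := S.comultObj (FaaObj.unit C))
    (Q := FaaObj.unit S.Cat) rfl (isMonHom_unit (C := S.Cat) (rst_id (C := S.Cat) _)) rfl

/-- Both monoids have the same carrier, and a map into a product is a homomorphism when its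
composites with the projections are. -/
theorem isMonHom_linearMonoid_prod_id (A B : TotalCommMon C) :
    IsMonHom (C := S.Cat) (S.linearMonoid (A.prod B)).toMon
      ((S.linearMonoid A).toMon.prod (S.linearMonoid B).toMon) (𝟙 _) := by
  have h1 := (isMonHom_fst A B).isMonHom_diag (S.linearMonoid (A.prod B)) (S.linearMonoid A)
  have h2 := (isMonHom_snd A B).isMonHom_diag (S.linearMonoid (A.prod B)) (S.linearMonoid B)
  rw [(isMonHom_fst A B).diag_eq (S.isLinearOn_fst A.diag B.diag)] at h1
  rw [(isMonHom_snd A B).diag_eq (S.isLinearOn_snd A.diag B.diag)] at h2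
  have e1 : S.comp (S.id (A.diag.prod B.diag)) (S.fst A.diag B.diag) = S.fst A.diag B.diag :=
    S.id_comp _
  have e2 : S.comp (S.id (A.diag.prod B.diag)) (S.snd A.diag B.diag) = S.snd A.diag B.diag :=
    S.id_comp _
  exact isMonHom_prod (C := S.Cat) (h1.congr e1.symm) (h2.congr e2.symm)

theorem comultObj_prod (P Q : FaaObj C) :
    S.comultObj (P.prod Q) = (S.comultObj P).prod (S.comultObj Q) :=
  FaaObj.ext_of_isMonHom (C := S.Cat) (P := S.comultObj (P.prod Q))
    (Q := (S.comultObj P).prod (S.comultObj Q)) rfl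
    (S.isMonHom_linearMonoid_prod_id P.mon Q.mon) rfl

variable (S₂ : FaaStr S.Cat)

theorem comultMap_fst (P Q : FaaObj C) : S.comultMap (S.fst P Q) =
    S₂.comp (eqToHom (C := S₂.Cat) (S.comultObj_prod P Q))
      (S₂.fst (S.comultObj P) (S.comultObj Q)) := by
  have h := (isLinearOn_eqToHom S₂ (S.comultObj_prod P Q)).comp S₂
    (isMonHom_eqToHom (congrArg FaaObj.mon (S.comultObj_prod P Q)))
    (S₂.isLinearOn_fst (S.comultObj P) (S.comultObj Q)) (isMonHom_fst _ _)
  have h' := isLinearOn_comultHom (LP := S.linearMonoid (P.prod Q).mon)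
    (LQ := S.linearMonoid P.mon) (S.isLinearOn_fst P Q) (isMonHom_fst P.mon Q.mon)
  refine ext_isLinearOn h' (h.congr (S.id_comp _) ((S.id_comp _).trans ?_))
  exact ((isMonHom_fst P.mon Q.mon).diag_eq (S.isLinearOn_fst P.mon.diag Q.mon.diag)).symm

theorem comultMap_snd (P Q : FaaObj C) : S.comultMap (S.snd P Q) =
    S₂.comp (eqToHom (C := S₂.Cat) (S.comultObj_prod P Q))
      (S₂.snd (S.comultObj P) (S.comultObj Q)) := by
  have h := (isLinearOn_eqToHom S₂ (S.comultObj_prod P Q)).comp S₂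
    (isMonHom_eqToHom (congrArg FaaObj.mon (S.comultObj_prod P Q)))
    (S₂.isLinearOn_snd (S.comultObj P) (S.comultObj Q)) (isMonHom_snd _ _)
  have h' := isLinearOn_comultHom (LP := S.linearMonoid (P.prod Q).mon)
    (LQ := S.linearMonoid Q.mon) (S.isLinearOn_snd P Q) (isMonHom_snd P.mon Q.mon)
  refine ext_isLinearOn h' (h.congr (S.id_comp _) ((S.id_comp _).trans ?_))
  exact ((isMonHom_snd P.mon Q.mon).diag_eq (S.isLinearOn_snd P.mon.diag Q.mon.diag)).symm

/-- The comultiplication of `Faà`. -/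
noncomputable def comult : StrictFunctor S.Cat S₂.Cat where
  obj P := S.comultObj P
  map f := S.comultMap f
  map_id P := by
    have h' := isLinearOn_comultHom (LP := S.linearMonoid (FaaObj.mon (C := C) P))
      (LQ := S.linearMonoid (FaaObj.mon (C := C) P)) (S.isLinearOn_id P) (IsMonHom.id _)
    refine ext_isLinearOn h' ((S₂.isLinearOn_id (S.comultObj P)).congr rfl ?_)
    exact ((IsMonHom.id _).diag_eq (S.isLinearOn_id _)).symm
  map_comp f g := comultHom_comp S₂ f g
  map_rst {P Q} f := by
    have h' := isLinearOn_comultHom (LP := S.linearMonoid (FaaObj.mon (C := C) P))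
      (LQ := S.linearMonoid (FaaObj.mon (C := C) P)) (S.isLinearOn_rst f) (IsMonHom.id _)
    refine ext_isLinearOn h' ((S₂.isLinearOn_rst (S.comultMap f)).congr rfl ?_)
    exact ((IsMonHom.id _).diag_eq (S.isLinearOn_id _)).symm
  obj_one := S.comultObj_unit
  obj_prod := S.comultObj_prod
  map_fst := S.comultMap_fst S₂
  map_snd := S.comultMap_snd S₂

theorem isComult_comult : IsComult S S₂ S.linearMonoid (S.comult S₂) :=
  ⟨fun f => S.comultMap f, fun _ => ⟨rfl, fun _ => ⟨rfl, fun _ => rfl⟩⟩, rfl⟩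

/-- The first counit law. -/
theorem comult_comp_counit : (S.comult S₂).toFunctor ⋙ S₂.counit.toFunctor = 𝟭 S.Cat := rfl

end FaaStr

end ComultFunctor

/-! ### Transport of coordinates along equalities of objects -/

section Coords

variable {C : Type u} [CartRest.{v} C]

theorem Coords.ext {W P : FaaObj C} {r : ℕ} {c c' : Coords W P r} (h1 : ∀ i, c.pt i = c'.pt i)
    (h2 : c.base = c'.base) (h3 : ∀ i, c.vec i = c'.vec i) (h4 : c.fib = c'.fib) : c = c' := by
  cases c; cases c'; cases funext h1; cases h2; cases funext h3; cases h4; rfl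

theorem FaaHom.IsComultAlong.ext {W P Q : FaaObj C} {r : ℕ+} {f : FaaHom P Q} {c : Coords W P r}
    {g g' : FaaHom W Q.mon.diag} (h : g.IsComultAlong f c) (h' : g'.IsComultAlong f c) : g = g' :=
  FaaHom.ext (h.star.trans h'.star.symm) (funext fun n => (h.d n).trans (h'.d n).symm)

/-- Transport of coordinates. -/
def Coords.pullback {W W' P : FaaObj C} {r : ℕ} (c : Coords W P r) (e : W' = W) :
    Coords W' P r := e ▸ c

theorem Coords.pullback_pt {W W' P : FaaObj C} {r : ℕ} (c : Coords W P r) (e : W' = W)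
    (i : Fin r) : (c.pullback e).pt i = eqToHom (congrArg FaaObj.pt e) ≫ c.pt i := by
  subst e; exact (Category.id_comp _).symm

theorem Coords.pullback_base {W W' P : FaaObj C} {r : ℕ} (c : Coords W P r) (e : W' = W) :
    (c.pullback e).base = eqToHom (congrArg FaaObj.pt e) ≫ c.base := by
  subst e; exact (Category.id_comp _).symm

theorem Coords.pullback_vec {W W' P : FaaObj C} {r : ℕ} (c : Coords W P r) (e : W' = W)
    (i : Fin r) : (c.pullback e).vec i =
      eqToHom (congrArg (fun P => P.mon.carrier) e) ≫ c.vec i := by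
  subst e; exact (Category.id_comp _).symm

theorem Coords.pullback_fib {W W' P : FaaObj C} {r : ℕ} (c : Coords W P r) (e : W' = W) :
    (c.pullback e).fib = eqToHom (congrArg (fun P => P.mon.carrier) e) ≫ c.fib := by
  subst e; exact (Category.id_comp _).symm

theorem FaaHom.IsComultAlong.eqToHom_comp (S : FaaStr C) {W W' P Q : FaaObj C} {r : ℕ+}
    {f : FaaHom P Q} {c : Coords W P r} {g : FaaHom W Q.mon.diag} (h : g.IsComultAlong f c)
    (e : W' = W) : (S.comp (eqToHom (C := S.Cat) e) g).IsComultAlong f (c.pullback e) := by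
  subst e
  have h1 : S.comp (eqToHom (C := S.Cat) rfl) g = g := S.id_comp g
  rw [h1]
  exact h

theorem eqToHom_prod_fst (A : C) {Y Y' : C} (e : Y = Y') :
    eqToHom (congrArg (CRStruct.prod A) e) ≫ fst A Y' = fst A Y := by
  subst e; exact Category.id_comp _

theorem eqToHom_prod_snd (A : C) {Y Y' Z : C} (e : Y = Y') (k : Y' ⟶ Z) :
    eqToHom (congrArg (CRStruct.prod A) e) ≫ snd A Y' ≫ k = snd A Y ≫ eqToHom e ≫ k := by
  subst e; simp

section

variable (S : FaaStr C) (P Q : FaaObj C)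

theorem FaaStr.vec_pow : ∀ r : ℕ, (FaaObj.mon (C := C) (pow (C := S.Cat) P Q r)).carrier =
    pow P.mon.carrier Q.mon.carrier r
  | 0 => rfl
  | r + 1 => congrArg (CRStruct.prod P.mon.carrier) (vec_pow r)

theorem FaaStr.pt_pow (r : ℕ) : FaaObj.pt (C := C) (pow (C := S.Cat) P Q r) = pow P.pt Q.pt r :=
  S.counit.obj_pow P Q r

theorem vecProj_eq : ∀ (r : ℕ) (i : Fin r), vecProj (S := S) P Q r i =
    eqToHom (S.vec_pow P Q r) ≫ proj P.mon.carrier Q.mon.carrier r i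
  | 0, i => i.elim0
  | r + 1, i => Fin.cases (eqToHom_prod_fst P.mon.carrier (S.vec_pow P Q r)).symm
      (fun j => (congrArg (fun k => snd _ _ ≫ k) (vecProj_eq r j)).trans
        (eqToHom_prod_snd P.mon.carrier (S.vec_pow P Q r) _).symm) i

theorem vecLast_eq : ∀ r : ℕ, vecLast (S := S) P Q r =
    eqToHom (S.vec_pow P Q r) ≫ last P.mon.carrier Q.mon.carrier r
  | 0 => (Category.id_comp (𝟙 _)).symm
  | r + 1 => (congrArg (fun k => snd _ _ ≫ k) (vecLast_eq r)).trans
      (eqToHom_prod_snd P.mon.carrier (S.vec_pow P Q r) _).symm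

theorem ptProj_eq (r : ℕ) (i : Fin r) : ptProj (S := S) P Q r i =
    eqToHom (S.pt_pow P Q r) ≫ proj P.pt Q.pt r i :=
  (isLinearOn_proj S P Q r i).star.symm.trans (S.counit.eqToHom_comp_proj P Q r i).symm

theorem ptLast_eq (r : ℕ) : ptLast (S := S) P Q r =
    eqToHom (S.pt_pow P Q r) ≫ last P.pt Q.pt r :=
  (isLinearOn_last S P Q r).star.symm.trans (S.counit.eqToHom_comp_last P Q r).symm

end

/-- A monoid with linear structure maps is determined by the underlying monoid. -/
theorem LinearMonoid.toMon_eq {S : FaaStr C} {A : TotalCommMon C} (L : LinearMonoid S A)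
    {add : FaaHom (A.diag.prod A.diag) A.diag} {zero : FaaHom (FaaObj.unit C) A.diag}
    (h : IsTotalCommMon (C := S.Cat) A.diag add zero) (ha : add.IsLinearOn A.add A.add)
    (hz : zero.IsLinearOn A.zero A.zero) :
    L.toMon = ⟨(A.diag : FaaObj C), add, zero, h⟩ := by
  obtain ⟨add', ha', zero', hz', h'⟩ := L
  have e1 : add' = add :=
    ext_isLinearOn ((FaaHom.isLinearOn_iff_isLinear A.isMon.rst_add).2 ha') ha
  have e2 : zero' = zero :=
    ext_isLinearOn ((FaaHom.isLinearOn_iff_isLinear A.isMon.rst_zero).2 hz') hz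
  subst e1 e2
  rfl

end Coords

/-! ### Naturality of `δ` -/

section Naturality

variable {C : Type u} [CartRest.{v} C] {D : Type u'} [CartRest.{v'} D] (F : StrictFunctor C D)

namespace StrictFunctor

theorem map_elim_add_map {α β ι κ : Type*} (g : α → β) (φ : ι → Option κ) (a : κ → ι → α)
    (b : κ → α) (c : ι → α) (s : Multiset ι) (t : Multiset κ) :
    (s.map (fun i => (φ i).elim (c i) fun j => a j i) + t.map b).map g =
      s.map (fun i => (φ i).elim (g (c i)) fun j => g (a j i)) + t.map fun j => g (b j) := by
  rw [Multiset.map_add, Multiset.map_map, Multiset.map_map]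
  congr 1
  refine Multiset.map_congr rfl fun i _ => ?_
  cases h : φ i <;> simp only [Function.comp_apply, h, Option.elim_none, Option.elim_some]

theorem mapPow_eval {P Q : FaaObj C} (f : FaaHom P Q) {A X : C} {n : ℕ} (x : pow A X n ⟶ P.pt)
    (m : Multiset (pow A X n ⟶ P.mon.carrier)) : F.mapPow (f.eval x m) =
      (F.mapHom f).eval (F.mapPow x) (m.map F.mapPow) := by
  obtain ⟨a, ha⟩ := FaaHom.exists_fin_eq m
  rw [ha, ← FaaHom.tuple_comp_comps, mapPow_tuple_comp]
  exact (congrArg (fun t => tuple _ _ ≫ t) (F.mapHom_comps f _).symm).trans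
    ((FaaHom.tuple_comp_comps (F.mapHom f) _ _).trans
      (congrArg (FaaHom.eval (F.mapHom f) _) (Multiset.map_map F.mapPow a _).symm))

theorem mapPow_comultSum {P Q : FaaObj C} (f : FaaHom P Q) {A X : C} {r : ℕ+} {n k : ℕ}
    (a : Fin n → Fin r → (pow A X k ⟶ P.mon.carrier)) (b : Fin n → (pow A X k ⟶ P.mon.carrier))
    (c : Fin r → (pow A X k ⟶ P.mon.carrier)) (x : pow A X k ⟶ P.pt) :
    F.mapPow (comultSum f r n a b c x) = comultSum (F.mapHom f) r n
      (fun j i => F.mapPow (a j i)) (fun j => F.mapPow (b j)) (fun i => F.mapPow (c i))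
      (F.mapPow x) := by
  rw [comultSum_eq]
  refine Eq.trans ?_ (comultSum_eq (F.mapHom f) r n _ _ _ _).symm
  refine (F.mapPowTo_sum Finset.univ _).trans (Finset.sum_congr rfl fun φ _ => ?_)
  refine (F.mapPow_eval f x _).trans (congrArg _ ?_)
  exact map_elim_add_map F.mapPow φ.1 _ _ _ _ _

/-- The image of coordinates under a functor. -/
def mapCoords {W P : FaaObj C} {r : ℕ} (c : Coords W P r) :
    Coords (F.mapObj W) (F.mapObj P) r where
  pt i := F.map (c.pt i)
  base := F.map c.base
  vec i := F.map (c.vec i)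
  fib := F.map c.fib
  rst_pt i := (F.map_rst _).symm.trans ((congrArg _ (c.rst_pt i)).trans (F.map_id _))
  rst_base := (F.map_rst _).symm.trans ((congrArg _ c.rst_base).trans (F.map_id _))
  isMonHom_vec i := F.isMonHom_map (c.isMonHom_vec i)
  isMonHom_fib := F.isMonHom_map c.isMonHom_fib

/-- A strict functor preserves sums, tuples and projections, hence the whole formula. -/
theorem isComultAlong_mapHom {W P Q : FaaObj C} {r : ℕ+} {f : FaaHom P Q} {c : Coords W P r}
    {g : FaaHom W Q.mon.diag} (h : g.IsComultAlong f c) :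
    FaaHom.IsComultAlong (Q := F.mapObj Q) (F.mapHom g) (F.mapHom f) (F.mapCoords c) where
  star := (congrArg (fun k => F.map k) h.star).trans (F.tuple_comp_mapPow (f.d r) _ _).symm
  d n := by
    have e := congrArg F.mapPow (h.d n)
    rw [mapPow_comultSum] at e
    simp only [mapPow_comp, mapPow_proj, mapPow_last] at e
    exact e

/-- On either side each coordinate is an `eqToHom` followed by the same projection of a power in
`D`, and parallel `eqToHom`s are equal. -/
theorem mapCoords_coords (S : FaaStr C) (S' : FaaStr D) (P : FaaObj C) (r : ℕ) :
    (F.mapCoords (S.coords P r)).pullback ((F.faaMap S S').obj_pow P.mon.diag P r).symm =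
      S'.coords (F.mapObj P) r := by
  have key : ∀ {X Y Z V W : D} (e1 : X = Y) (e2 : Y = Z) (e3 : Z = V) (e4 : X = V) (k : V ⟶ W),
      eqToHom e1 ≫ eqToHom e2 ≫ eqToHom e3 ≫ k = eqToHom e4 ≫ k := by
    intro X Y Z V W e1 e2 e3 e4 k
    subst e1 e2 e3
    simp
  have hm : ∀ {X Y Z : C} (e : X = Y) (k : Y ⟶ Z), F.map (eqToHom e ≫ k) =
      eqToHom (congrArg F.obj e) ≫ F.map k := by
    intro X Y Z e k
    subst e
    simp
  refine Coords.ext (fun i => ?_) ?_ (fun i => ?_) ?_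
  · have e1 : F.map ((S.coords P r).pt i) = _ :=
      (congrArg (fun k => F.map k) (ptProj_eq S P.mon.diag P r i)).trans ((hm _ _).trans
        (congrArg (fun k => _ ≫ k) (F.eqToHom_comp_proj P.mon.carrier P.pt r i).symm))
    exact (Coords.pullback_pt _ _ _).trans <| (congrArg (fun k => _ ≫ k) e1).trans ((key _ _ _ _ _).trans
      (ptProj_eq S' (F.mapObj P).mon.diag (F.mapObj P) r i).symm)
  · have e1 : F.map (S.coords P r).base = _ :=
      (congrArg (fun k => F.map k) (ptLast_eq S P.mon.diag P r)).trans ((hm _ _).trans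
        (congrArg (fun k => _ ≫ k) (F.eqToHom_comp_last P.mon.carrier P.pt r).symm))
    exact (Coords.pullback_base _ _).trans <| (congrArg (fun k => _ ≫ k) e1).trans ((key _ _ _ _ _).trans
      (ptLast_eq S' (F.mapObj P).mon.diag (F.mapObj P) r).symm)
  · have e1 : F.map ((S.coords P r).vec i) = _ :=
      (congrArg (fun k => F.map k) (vecProj_eq S P.mon.diag P r i)).trans ((hm _ _).trans
        (congrArg (fun k => _ ≫ k)
          (F.eqToHom_comp_proj P.mon.carrier P.mon.carrier r i).symm))
    exact (Coords.pullback_vec _ _ _).trans <| (congrArg (fun k => _ ≫ k) e1).trans ((key _ _ _ _ _).trans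
      (vecProj_eq S' (F.mapObj P).mon.diag (F.mapObj P) r i).symm)
  · have e1 : F.map (S.coords P r).fib = _ :=
      (congrArg (fun k => F.map k) (vecLast_eq S P.mon.diag P r)).trans ((hm _ _).trans
        (congrArg (fun k => _ ≫ k)
          (F.eqToHom_comp_last P.mon.carrier P.mon.carrier r).symm))
    exact (Coords.pullback_fib _ _).trans <| (congrArg (fun k => _ ≫ k) e1).trans ((key _ _ _ _ _).trans
      (vecLast_eq S' (F.mapObj P).mon.diag (F.mapObj P) r).symm)

variable (S : FaaStr C) (S' : FaaStr D)

theorem mapMon_linearMonoid (A : TotalCommMon C) :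
    (S'.linearMonoid (F.mapMon A)).toMon = (F.faaMap S S').mapMon (S.linearMonoid A).toMon := by
  let M := (F.faaMap S S').mapMon (S.linearMonoid A).toMon
  have ma := isMonHom_eqToHom (congrArg FaaObj.mon (F.mapObj_prod A.diag A.diag).symm)
  have mz := isMonHom_eqToHom (congrArg FaaObj.mon F.mapObj_unit.symm)
  have ha := (isLinearOn_eqToHom S' (F.mapObj_prod A.diag A.diag).symm).comp S' ma
    (F.isLinearOn_mapHom (S.linearMonoid A).isLinearOn_add) (F.isMonHom_map A.isMonHom_add)
  have hz := (isLinearOn_eqToHom S' F.mapObj_unit.symm).comp S' mz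
    (F.isLinearOn_mapHom (S.linearMonoid A).isLinearOn_zero) (F.isMonHom_map A.isMonHom_zero)
  exact (S'.linearMonoid (F.mapMon A)).toMon_eq M.isMon ha hz

theorem mapObj_comultObj (P : FaaObj C) :
    S'.comultObj (F.mapObj P) = (F.faaMap S S').mapObj (S.comultObj P) :=
  congrArg (fun M => (⟨M, F.mapObj P⟩ : FaaObj S'.Cat)) (F.mapMon_linearMonoid S S' P.mon)

/-- Both morphisms obey the formula for `δ(F f)_r` in the same coordinates, and the formula
determines the morphism. -/
theorem mapPow_comultAlong {P Q : FaaObj C} (f : FaaHom P Q) (r : ℕ+) :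
    comultAlong (F.mapHom f) (S'.coords (F.mapObj P) r) =
      (F.faaMap S S').mapPow (A := P.mon.diag) (X := P) (B := Q.mon.diag) (n := r)
        (comultAlong f (S.coords P r)) := by
  have h1 := isComultAlong_comultAlong (F.mapHom f) (S'.coords (F.mapObj P) r)
  have h2 := (F.isComultAlong_mapHom (isComultAlong_comultAlong f (S.coords P r))).eqToHom_comp S'
    ((F.faaMap S S').obj_pow P.mon.diag P r).symm
  rw [mapCoords_coords] at h2
  exact h1.ext h2

end StrictFunctor

end Naturality

section Natural

variable {C D : Type u} [CartRest.{v} C] [CartRest.{v} D] (F : StrictFunctor C D)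

/-- The comultiplication is natural. -/
theorem StrictFunctor.faaMap_comp_comult (S : FaaStr C) (S' : FaaStr D) (S₂ : FaaStr S.Cat)
    (S₂' : FaaStr S'.Cat) : (F.faaMap S S').comp (S'.comult S₂') =
      (S.comult S₂).comp ((F.faaMap S S').faaMap S₂ S₂') := by
  refine StrictFunctor.eq_of_toFunctor (Functor.hext (F.mapObj_comultObj S S') fun P Q f => ?_)
  exact FaaHom.hext (C := S'.Cat) (F.mapObj_comultObj S S' P) (F.mapObj_comultObj S S' Q) HEq.rfl
    fun r => heq_of_eq (F.mapPow_comultAlong S S' f r)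

end Natural

/-! ### The second counit law -/

section Counit

variable {C : Type u} [CartRest.{v} C] (S : FaaStr C)

namespace FaaStr

theorem counit_mapObj_comultObj (P : FaaObj C) : S.counit.mapObj (S.comultObj P) = P := by
  refine FaaObj.ext_of_isMonHom (P := S.counit.mapObj (S.comultObj P)) rfl
    { total := rst_id _
      map_add := ?_
      map_zero := fun T => ?_ } rfl
  · have e : ∀ {T : C} (a b : T ⟶ P.mon.carrier),
        (lift a b ≫ 𝟙 _ ≫ (S.linearMonoid P.mon).add.star) ≫ 𝟙 _ =
        lift (a ≫ 𝟙 _) (b ≫ 𝟙 _) ≫ P.mon.add := by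
      intro T a b
      rw [(S.linearMonoid P.mon).isLinear_add.1]
      simp only [Category.comp_id, Category.id_comp]
    exact fun {_} a b => e a b
  · have e : (bang T ≫ 𝟙 _ ≫ (S.linearMonoid P.mon).zero.star) ≫ 𝟙 _ = bang T ≫ P.mon.zero := by
      rw [(S.linearMonoid P.mon).isLinear_zero.1]
      simp only [Category.comp_id, Category.id_comp]
    exact e

theorem tuple_ptProj_ptLast (P Q : FaaObj C) (r : ℕ) :
    (tuple (fun i => ptProj (S := S) P Q r i) (ptLast (S := S) P Q r) :
      FaaObj.pt (C := C) (pow (C := S.Cat) P Q r) ⟶ pow P.pt Q.pt r) =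
        eqToHom (S.pt_pow P Q r) := by
  have h : ∀ {X : C} (e : X = pow P.pt Q.pt r),
      tuple (fun i => eqToHom e ≫ proj P.pt Q.pt r i) (eqToHom e ≫ last P.pt Q.pt r) =
        eqToHom e := by
    intro X e
    subst e
    simp [tuple_proj_last]
  rw [← h (S.pt_pow P Q r)]
  exact congrArg₂ (fun a b => tuple a b) (funext fun i => ptProj_eq S P Q r i)
    (ptLast_eq S P Q r)

variable (S₂ : FaaStr S.Cat)

/-- The second counit law. -/
theorem comult_comp_faaMap_counit :
    (S.comult S₂).toFunctor ⋙ (S.counit.faaMap S₂ S).toFunctor = 𝟭 S.Cat := by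
  refine Functor.hext S.counit_mapObj_comultObj fun P Q f => ?_
  refine FaaHom.hext (S.counit_mapObj_comultObj P) (S.counit_mapObj_comultObj Q) HEq.rfl
    fun r => heq_of_eq ?_
  -- The base map of `δ(f)_r` is `f_r` at the tuple of all point coordinates, which is a mere
  -- transport.
  have h : eqToHom (S.counit.obj_pow P.mon.diag P r).symm ≫
      (comultAlong f (S.coords P r)).star = f.d r := by
    rw [(isComultAlong_comultAlong f (S.coords P r)).star]
    have e : (tuple (S.coords P r).pt (S.coords P r).base : _ ⟶ P.dom r) =
        eqToHom (S.pt_pow P.mon.diag P r) := S.tuple_ptProj_ptLast P.mon.diag P r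
    have key : ∀ {X Y Z : C} (e : X = Y) (e' : Y = X) (k : X ⟶ Z),
        eqToHom e ≫ eqToHom e' ≫ k = k := by
      intro X Y Z e e' k
      subst e
      simp
    exact (congrArg (fun k => _ ≫ k ≫ f.d r) e).trans (key _ _ _)
  exact h

end FaaStr

end Counit

/-! ### Nonzero entries of matchings -/

section Matchings

variable {α β γ M : Type*} [AddCommMonoid M]

theorem ne_zero_of_mem_matchings [Zero α] [Zero β] {s : Multiset α} {t : Multiset β}
    (hs : ∀ a ∈ s, a ≠ 0) (ht : ∀ b ∈ t, b ≠ 0) {μ : Multiset (α × β)} (hμ : μ ∈ matchings s t) :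
    ∀ p ∈ μ, p ≠ 0 := by
  induction s using Multiset.induction_on generalizing t μ with
  | empty =>
    rw [matchings_zero_left, Multiset.mem_singleton] at hμ
    subst hμ
    intro p hp
    obtain ⟨b, hb, rfl⟩ := Multiset.mem_map.1 hp
    exact fun h => ht b hb (congrArg Prod.snd h)
  | cons a s ih =>
    rw [matchings_cons] at hμ
    obtain ⟨q, hq, hμ⟩ := Multiset.mem_bind.1 hμ
    obtain ⟨ν, hν, rfl⟩ := Multiset.mem_map.1 hμ
    intro p hp
    rcases Multiset.mem_cons.1 hp with rfl | hp
    · exact fun h => hs a (Multiset.mem_cons_self a s) (congrArg Prod.fst h)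
    · refine ih (fun b hb => hs b (Multiset.mem_cons_of_mem hb)) (fun b hb => ?_) hν p hp
      rcases eq_of_mem_pointed hq with h | h
      · exact ht b (h.2 ▸ hb)
      · exact ht b (h ▸ Multiset.mem_cons_of_mem hb)

theorem ne_zero_of_mem_matchings_cons [Zero α] [Zero β] {a : α} {s : Multiset α}
    {t : Multiset β} {μ : Multiset (α × β)} (hμ : μ ∈ matchings (a ::ₘ s) t) : μ ≠ 0 := by
  rw [matchings_cons] at hμ
  obtain ⟨q, -, hμ⟩ := Multiset.mem_bind.1 hμ
  obtain ⟨ν, -, rfl⟩ := Multiset.mem_map.1 hμ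
  exact Multiset.cons_ne_zero

end Matchings

/-! ### Coassociativity: the two-stage matching -/

section Coassoc

variable {C : Type u} [CartRest.{v} C] {S : FaaStr C} {W P Q : FaaObj C}

/-- The coordinates in `Faà(C)` induced by coordinates in `C`. -/
noncomputable def Coords.comult {r : ℕ} (c : Coords W P r) :
    Coords (C := S.Cat) (S.comultObj W) (S.comultObj P) r where
  pt i := FaaHom.linear (P := W) (Q := P.mon.diag) (c.pt i) (c.isMonHom_vec i)
  base := FaaHom.linear (P := W) (Q := P) c.base c.isMonHom_fib
  vec i := (c.isMonHom_vec i).diag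
  fib := c.isMonHom_fib.diag
  rst_pt i := S.rst_eq_id (c.rst_pt i)
  rst_base := S.rst_eq_id c.rst_base
  isMonHom_vec i := (c.isMonHom_vec i).isMonHom_diag _ _
  isMonHom_fib := c.isMonHom_fib.isMonHom_diag _ _

variable {r : ℕ+} (c : Coords W P r)

theorem FaaHom.full_comp_linear (S : FaaStr C) {T : FaaObj C} (x : FaaHom T W)
    {A : TotalCommMon C} {h : W.pt ⟶ A.carrier}
    {k : W.mon.carrier ⟶ A.carrier} (hk : IsMonHom W.mon A k) (hh : CRStruct.rst h = 𝟙 _)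
    {g : FaaHom W A.diag} (hg : g.IsLinearOn h k)
    {s : Stage C} {z : s.obj ⟶ T.pt} (hz : s.Defined z x.star) {γ : Multiset (s.Vec T.mon)}
    (hγ : γ ≠ 0) : (S.comp x g).full s z γ = (x.germ s z γ).map hk := by
  rw [FaaHom.full_of_ne _ _ _ hγ]
  refine S.germ_comp_of_isLinearOn x hg hk ?_ hγ
  rw [S.comp_star, hg.star]
  exact Stage.defined_comp.2 ⟨hz, .of_total hz.rst_comp hh⟩

open Classical in
/-- The entries of the two sides of the coassociativity law. -/
theorem Coords.grid_pairGrid {t : Stage S.Cat} (x : FaaHom t.ob W) {s : Stage C}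
    {z : s.obj ⟶ t.ob.pt} (hz : t.DefinedAt s z) (hx : s.Defined z x.star) (hxt : S.rst x = t.idemHom)
    (α : Multiset (Fin r)) (a : Multiset (t.Vec (S.linearMonoid W.mon).toMon))
    (γ : Multiset (s.Vec t.ob.mon)) :
    c.grid s (z ≫ x.star) (α, if (a, γ) = 0 then 0 else
        {pairGrid (L := S.linearMonoid W.mon) x s z (a, γ)}) =
      pairGrid (A := P.mon) (L := S.linearMonoid P.mon) (X := P.pt)
        (S.comp x (FaaHom.linear (P := W) (Q := P) c.base c.isMonHom_fib)) s z
        (if (α, a) = 0 then 0 else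
          ({c.comult.grid t x (α, a)} : Multiset (t.Vec (S.linearMonoid P.mon).toMon)), γ) := by
  let LW := S.linearMonoid W.mon
  let LP := S.linearMonoid P.mon
  let cc := c.comult (S := S)
  let y : FaaHom t.ob P := S.comp x (FaaHom.linear (P := W) (Q := P) c.base c.isMonHom_fib)
  have pg1 : ∀ (v : t.Vec LP.toMon), pairGrid (L := LP) y s z ({v}, γ) = v.hom.full s z γ :=
    fun v => pairGrid_singleton y s z v γ
  -- Both sides vanish when `α` or `a` has more than one element. In the remaining four cases each
  -- is empty or a singleton.
  by_cases hα : 1 < Multiset.card α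
  · have h0 : (α, a) ≠ 0 := fun h => by
      rw [show α = 0 from congrArg Prod.fst h] at hα; simp at hα
    have h1 : cc.grid t x (α, a) = 0 := cc.isGrid_grid t x _ (Or.inl hα)
    rw [c.isGrid_grid s _ _ (Or.inl hα), if_neg h0]
    exact ((pg1 _).trans ((congrArg (fun v : t.Vec LP.toMon => v.hom.full s z γ) h1).trans
      (Stage.Vec.full_zero hz γ))).symm
  by_cases ha : 1 < Multiset.card a
  · have h0 : (α, a) ≠ 0 := fun h => by
      rw [show a = 0 from congrArg Prod.snd h] at ha; simp at ha
    have h0' : (a, γ) ≠ 0 := fun h => by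
      rw [show a = 0 from congrArg Prod.fst h] at ha; simp at ha
    have h1 : cc.grid t x (α, a) = 0 := cc.isGrid_grid t x _ (Or.inr ha)
    rw [if_neg h0', if_neg h0, pairGrid_of_one_lt _ _ _ _ ha, c.grid_singleton_zero]
    exact ((pg1 _).trans ((congrArg (fun v : t.Vec LP.toMon => v.hom.full s z γ) h1).trans
      (Stage.Vec.full_zero hz γ))).symm
  have full_map : ∀ (a0 : t.Vec LW.toMon) {k : W.mon.carrier ⟶ P.mon.carrier}
      (hk : IsMonHom W.mon P.mon k), (a0.hom.full s z γ).map hk =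
        (Stage.Vec.hom (L := LP) (a0.map (hk.isMonHom_diag LW LP))).full s z γ := fun a0 k hk =>
    (S.full_comp_of_isLinearOn a0.hom hk.isLinearOn_diag hk (Stage.Vec.defined_hom hz a0) γ).symm
  rcases Nat.lt_or_ge 0 (Multiset.card a) with ha' | ha'
  · obtain ⟨a0, rfl⟩ := Multiset.card_eq_one.1 (show Multiset.card a = 1 by omega)
    have h0' : (({a0} : Multiset (t.Vec LW.toMon)), γ) ≠ 0 := fun h =>
      Multiset.singleton_ne_zero a0 (congrArg Prod.fst h)
    have h0 : (α, ({a0} : Multiset (t.Vec LW.toMon))) ≠ 0 := fun h =>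
      Multiset.singleton_ne_zero a0 (congrArg Prod.snd h)
    rw [if_neg h0', if_neg h0, pairGrid_singleton]
    refine Eq.trans ?_ (pg1 _).symm
    rcases Nat.lt_or_ge 0 (Multiset.card α) with hα' | hα'
    · obtain ⟨i, rfl⟩ := Multiset.card_eq_one.1 (show Multiset.card α = 1 by omega)
      rw [c.grid_singleton, c.row_singleton, full_map]
      exact congrArg (fun v : t.Vec LP.toMon => v.hom.full s z γ)
        ((cc.grid_singleton t x i {a0}).trans (cc.row_singleton t x i a0)).symm
    · obtain rfl := Multiset.card_eq_zero.1 (Nat.le_zero.1 hα')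
      rw [c.grid_zero, linMap_singleton, full_map]
      exact congrArg (fun v : t.Vec LP.toMon => v.hom.full s z γ)
        ((cc.grid_zero t x {a0}).trans (linMap_singleton _ a0)).symm
  obtain rfl := Multiset.card_eq_zero.1 (Nat.le_zero.1 ha')
  have e0 : ((0 : Multiset (t.Vec LW.toMon)), (0 : Multiset (s.Vec t.ob.mon))) = 0 := rfl
  rcases Nat.lt_or_ge 0 (Multiset.card α) with hα' | hα'
  · obtain ⟨i, rfl⟩ := Multiset.card_eq_one.1 (show Multiset.card α = 1 by omega)
    have h0 : (({i} : Multiset (Fin r)), (0 : Multiset (t.Vec LW.toMon))) ≠ 0 := fun h =>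
      Multiset.singleton_ne_zero i (congrArg Prod.fst h)
    rw [if_neg h0]
    refine Eq.trans ?_ (pg1 _).symm
    -- A row without outer vector is evaluated through the linear morphism `p`: its base map gives
    -- the point coordinate when `γ` is empty, its linear part the vector coordinate otherwise.
    let p : FaaHom W P.mon.diag := FaaHom.linear (P := W) (Q := P.mon.diag) (c.pt i) (c.isMonHom_vec i)
    have hp : p.IsLinearOn (c.pt i) (c.vec i) := FaaHom.isLinearOn_linear _ _
    have hd : t.Defined (X := W) (Y := P.mon.diag) x p :=
      Stage.Defined.of_total (C := S.Cat) hxt (S.rst_eq_id (c.rst_pt i))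
    have h1 : (cc.grid t x ({i}, 0)).val = S.comp x p :=
      (congrArg Stage.Vec.val ((cc.grid_singleton t x i 0).trans (cc.row_zero t x i))).trans
        (Stage.val_vecAt hd)
    have h2 : Stage.Vec.hom (L := LP) (cc.grid t x ({i}, 0)) = S.comp x p := h1
    refine Eq.trans ?_ (congrArg (fun k : FaaHom t.ob P.mon.diag => k.full s z γ) h2.symm)
    rw [c.grid_singleton]
    have hd' := (Stage.Vec.defined_hom hz (cc.grid t x ({i}, 0)))
    rw [h2] at hd'
    by_cases hγ : γ = 0
    · subst hγ
      rw [if_pos e0, c.row_zero, FaaHom.full_zero]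
      apply Stage.Vec.ext
      rw [Stage.val_vecAt hd', Stage.val_vecAt (.of_total hx.rst_comp (c.rst_pt i)), S.comp_star,
        hp.star, Category.assoc]
    · rw [if_neg fun h => hγ (congrArg Prod.snd h), c.row_singleton, pairGrid_zero]
      exact (FaaHom.full_comp_linear S x (c.isMonHom_vec i) (c.rst_pt i) hp hx hγ).symm
  · obtain rfl := Multiset.card_eq_zero.1 (Nat.le_zero.1 hα')
    have hb : FaaHom.IsLinearOn (FaaHom.linear (P := W) (Q := P) c.base c.isMonHom_fib) c.base c.fib :=
      FaaHom.isLinearOn_linear _ _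
    have e1 : ((0 : Multiset (Fin r)), (0 : Multiset (t.Vec LW.toMon))) = 0 := rfl
    rw [if_pos e1, pairGrid_zero, c.grid_zero]
    by_cases hγ : γ = 0
    · subst hγ
      rw [if_pos e0, linMap_zero, pairGrid_zero, FaaHom.germ_empty]
    · rw [if_neg fun h => hγ (congrArg Prod.snd h), linMap_singleton, pairGrid_zero]
      refine (S.germ_comp_of_isLinearOn x hb c.isMonHom_fib ?_ hγ).symm
      rw [S.comp_star, hb.star]
      exact Stage.defined_comp.2 ⟨hx, .of_total hx.rst_comp c.rst_base⟩

theorem FaaHom.full_zero_cons {A : TotalCommMon C} (g : FaaHom W A.diag) (s : Stage C)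
    (x : s.obj ⟶ W.pt) (m : Multiset (s.Vec W.mon)) : g.full s x (0 ::ₘ m) = 0 := by
  rw [FaaHom.full_of_ne _ _ _ Multiset.cons_ne_zero, (g.multiAdditive_germ s _).zero]

/-- Extends the description of germs of `δ(g)` to the empty outer family, where the value is that of
a composite in `Faà(C)`. -/
theorem full_comultMap (g : FaaHom W Q.mon.diag) {t : Stage S.Cat} {x : FaaHom t.ob W}
    (hx : t.Defined (X := W) (Y := Q.mon.diag) x g) {s : Stage C} {z : s.obj ⟶ t.ob.pt}
    (hz : t.DefinedAt s z) (m : Multiset (t.Vec (S.linearMonoid W.mon).toMon))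
    (N : Multiset (s.Vec t.ob.mon)) :
    (Stage.Vec.hom (L := S.linearMonoid Q.mon) (FaaHom.full (C := S.Cat) (P := S.comultObj W)
      (A := (S.linearMonoid Q.mon).toMon) (S.comultMap g) t x m)).full s z N =
        bcomp (g.full s (z ≫ x.star)) (pairGrid (L := S.linearMonoid W.mon) x s z) m N := by
  by_cases hm : m = 0
  · subst hm
    have h1 : Stage.Vec.hom (L := S.linearMonoid Q.mon) (FaaHom.full (C := S.Cat)
        (P := S.comultObj W) (A := (S.linearMonoid Q.mon).toMon) (S.comultMap g) t x 0) =
          S.comp x g := FaaHom.full_val (C := S.Cat) (P := S.comultObj W)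
            (A := (S.linearMonoid Q.mon).toMon) (S.comultMap g) hx rfl
    refine (congrArg (fun k : FaaHom t.ob Q.mon.diag => k.full s z N) h1).trans ?_
    rw [bcomp_zero_left, S.full_comp x g ((Stage.defined_of_rst_eq_idem hx.rst_comp).2 hz)]
    simp only [pairGrid_zero]
  · have h1 := FaaHom.full_of_ne (C := S.Cat) (P := S.comultObj W)
      (A := (S.linearMonoid Q.mon).toMon) (S.comultMap g) t x hm
    refine (congrArg (fun v => (Stage.Vec.hom (L := S.linearMonoid Q.mon) v).full s z N) h1).trans ?_
    refine ((isComultOf_comultHom g).full_germ hx hm hz N).trans ?_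
    rw [bcomp_of_left (g.multiAdditive_germ s _).zero (pairGrid_of_one_lt x s z),
      bcomp_of_left (g.full_zero_cons s _) (pairGrid_of_one_lt x s z)]
    obtain ⟨a, ha⟩ := Multiset.exists_mem_of_ne_zero hm
    obtain ⟨m', rfl⟩ := Multiset.exists_cons_of_mem ha
    refine msum_congr fun ρ _ => msum_congr fun μ hμ => (FaaHom.full_of_ne _ _ _ fun h0 => ?_).symm
    rw [Multiset.map_cons] at hμ
    exact ne_zero_of_mem_matchings_cons hμ (Multiset.map_eq_zero.1 h0)

-- Here the outer vectors are matched first with the blocks of `N`, and the rows then with the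
-- resulting pairs.
open Classical in
theorem FaaHom.IsComultAlong.bcomp_full_pairGrid {f : FaaHom P Q} {g : FaaHom W Q.mon.diag}
    {c : Coords W P r} (hg : g.IsComultAlong f c) {t : Stage S.Cat} (x : FaaHom t.ob W)
    {s : Stage C} {z : s.obj ⟶ t.ob.pt} (hd : s.Defined (z ≫ x.star) g.star)
    (m : Multiset (t.Vec (S.linearMonoid W.mon).toMon)) (N : Multiset (s.Vec t.ob.mon)) :
    bcomp (g.full s (z ≫ x.star)) (pairGrid (L := S.linearMonoid W.mon) x s z) m N =
      msum (parts N) fun ρ => msum (matchings (m.map singleton) ρ) fun κ =>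
        msum (matchings (Finset.univ.val.map singleton) κ) fun τ =>
          f.germ s ((z ≫ x.star) ≫ c.base) (τ.map fun p => c.grid s (z ≫ x.star) (p.1,
            if p.2 = 0 then 0 else {pairGrid (L := S.linearMonoid W.mon) x s z p.2})) := by
  rw [bcomp_of_left (g.full_zero_cons s _) (pairGrid_of_one_lt x s z)]
  refine msum_congr fun ρ hρ => msum_congr fun κ hκ => ?_
  have hm : ∀ a ∈ m.map (singleton : _ → Multiset (t.Vec (S.linearMonoid W.mon).toMon)),
      a ≠ 0 := fun a ha => by
    obtain ⟨v, -, rfl⟩ := Multiset.mem_map.1 ha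
    exact Multiset.singleton_ne_zero v
  rw [hg.full_eq hd, gridSum, msum_matchings_map_singleton_right _ _
    (ne_zero_of_mem_matchings hm (ne_zero_of_mem_parts hρ) hκ)]
  refine msum_congr fun σ _ => congrArg _ ?_
  rw [Multiset.map_map]
  refine Multiset.map_congr rfl fun p _ => ?_
  by_cases h : p.2 = 0
  · simp only [Function.comp_apply, if_pos h]
  · simp only [Function.comp_apply, if_neg h]

-- Here the rows are matched first with the outer vectors, and the results then with the blocks of
-- `N`. `msum_matchings_assoc` rearranges the sum, and `Coords.grid_pairGrid` compares the entries.
open Classical in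
theorem bcomp_comult_grid (f : FaaHom P Q) {t : Stage S.Cat} (x : FaaHom t.ob W)
    {s : Stage C} {z : s.obj ⟶ t.ob.pt} (hz : t.DefinedAt s z) (hx : s.Defined z x.star)
    (hxt : S.rst x = t.idemHom) (m : Multiset (t.Vec (S.linearMonoid W.mon).toMon))
    (N : Multiset (s.Vec t.ob.mon)) :
    (msum (matchings (Finset.univ.val.map singleton) (m.map singleton)) fun μ =>
      bcomp (f.germ s ((z ≫ x.star) ≫ c.base)) (pairGrid (L := S.linearMonoid P.mon) (X := P.pt)
        (S.comp x (FaaHom.linear (P := W) (Q := P) c.base c.isMonHom_fib)) s z)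
        (μ.map fun p => (c.comult.grid t x p : t.Vec (S.linearMonoid P.mon).toMon)) N) =
      msum (parts N) fun ρ => msum (matchings (m.map singleton) ρ) fun κ =>
        msum (matchings (Finset.univ.val.map singleton) κ) fun τ =>
          f.germ s ((z ≫ x.star) ≫ c.base) (τ.map fun p => c.grid s (z ≫ x.star) (p.1,
            if p.2 = 0 then 0 else {pairGrid (L := S.linearMonoid W.mon) x s z p.2})) := by
  have hm : ∀ a ∈ m.map (singleton : _ → Multiset (t.Vec (S.linearMonoid W.mon).toMon)),
      a ≠ 0 := fun a ha => by
    obtain ⟨v, -, rfl⟩ := Multiset.mem_map.1 ha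
    exact Multiset.singleton_ne_zero v
  have hr : ∀ a ∈ (Finset.univ : Finset (Fin r)).val.map (singleton : _ → Multiset (Fin r)),
      a ≠ 0 := fun a ha => by
    obtain ⟨v, -, rfl⟩ := Multiset.mem_map.1 ha
    exact Multiset.singleton_ne_zero v
  simp only [bcomp_of_left (f.multiAdditive_germ s _).zero (pairGrid_of_one_lt _ s z)]
  rw [msum_comm]
  refine msum_congr fun ρ _ => ?_
  refine Eq.trans (msum_congr fun μ hμ => ?_) (msum_matchings_assoc _ _ _ _)
  let u : Multiset (Fin r) × Multiset (t.Vec (S.linearMonoid W.mon).toMon) →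
    t.Vec (S.linearMonoid P.mon).toMon := fun p => c.comult.grid t x p
  refine (msum_matchings_map_singleton u (ne_zero_of_mem_matchings hr hm hμ) ρ _).trans ?_
  refine msum_congr fun ν _ => congrArg _ ?_
  rw [Multiset.map_map]
  refine Eq.trans ?_ (Multiset.map_map _ _ _).symm
  refine Multiset.map_congr rfl fun p _ => ?_
  have h := (c.grid_pairGrid x hz hx hxt p.1.1 p.1.2 p.2).symm
  refine Eq.trans ?_ (h.trans ?_)
  · simp only [Function.comp_apply]
    congr
  · change _ = c.grid s (z ≫ x.star) (p.1.1, if (p.1.2, p.2) = 0 then 0 else _)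
    congr

/-- The heart of coassociativity: evaluated twice, `δ(g)` and the formula built from `δ(f)` become
the two orders of matching rows, outer vectors and blocks of inner vectors. -/
theorem isComultAlong_comultMap {f : FaaHom P Q} {g : FaaHom W Q.mon.diag}
    (hg : g.IsComultAlong f c) :
    FaaHom.IsComultAlong (C := S.Cat) (W := S.comultObj W) (P := S.comultObj P)
      (Q := S.comultObj Q) (S.comultMap g) (S.comultMap f) c.comult := by
  have hG := isComultAlong_comultAlong (C := S.Cat) (W := S.comultObj W) (P := S.comultObj P)
      (Q := S.comultObj Q) (S.comultMap f) c.comult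
  suffices h : comultAlong (C := S.Cat) (W := S.comultObj W) (P := S.comultObj P)
      (Q := S.comultObj Q) (S.comultMap f) c.comult = S.comultMap g from h ▸ hG
  have hr : S.rst (FaaHom.star (C := S.Cat) (comultAlong (C := S.Cat) (W := S.comultObj W)
      (P := S.comultObj P) (Q := S.comultObj Q) (S.comultMap f) c.comult)) = S.rst g := by
    refine hG.rst_star.trans (S.rst_congr ?_)
    have hb : FaaHom.star (FaaHom.linear (P := W) (Q := P) c.base c.isMonHom_fib) = c.base :=
      (FaaHom.isLinearOn_linear _ _).star
    refine (congrArg CRStruct.rst ((S.comp_star _ _).trans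
      (congrArg (fun k => k ≫ f.star) hb))).trans ?_
    exact hg.rst_star.symm
  refine FaaHom.ext_full (C := S.Cat) (A := (S.linearMonoid Q.mon).toMon) hr fun t x hx1 hx2 N => ?_
  let LW := S.linearMonoid W.mon
  let LP := S.linearMonoid P.mon
  let LQ := S.linearMonoid Q.mon
  let x' : FaaHom t.ob W := x
  let y : FaaHom t.ob P := S.comp x' (FaaHom.linear (P := W) (Q := P) c.base c.isMonHom_fib)
  have hb : FaaHom.star (FaaHom.linear (P := W) (Q := P) c.base c.isMonHom_fib) = c.base :=
    (FaaHom.isLinearOn_linear _ _).star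
  have hxg : t.Defined (X := W) (Y := Q.mon.diag) x' g := hx2
  have hyf : t.Defined (X := P) (Y := Q) y f := hG.defined hx1
  refine Stage.Vec.ext_full (L := LQ) fun s z hz N' => ?_
  obtain ⟨hd, hdg⟩ := Stage.defined_of_defined hxg hz
  have hR := (full_comultMap g hxg hz N N').trans (hg.bcomp_full_pairGrid x' hdg N N')
  refine Eq.trans ?_ hR.symm
  have ey : (z ≫ x'.star) ≫ c.base = z ≫ y.star := by rw [S.comp_star, hb, Category.assoc]
  refine Eq.trans ?_ (bcomp_comult_grid c f x' hz hd hxg.rst_left N N')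
  have hL := hG.full_eq hx1 N
  refine (congrArg (fun v => (Stage.Vec.hom (L := LQ) v).full s z N') hL).trans ?_
  refine (Stage.Vec.full_msum (L := LQ) hz _ _ N').trans (msum_congr fun μ hμ => ?_)
  rw [ey]
  refine (isComultOf_comultHom f).full_germ hyf ?_ hz N'
  intro h0
  have hc : (Finset.univ : Finset (Fin r)).val ≠ 0 := fun h => by
    have := congrArg Multiset.card h
    simp at this
  obtain ⟨i, hi⟩ := Multiset.exists_mem_of_ne_zero hc
  obtain ⟨m', hm'⟩ := Multiset.exists_cons_of_mem hi
  rw [hm', Multiset.map_cons] at hμ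
  exact ne_zero_of_mem_matchings_cons hμ (Multiset.map_eq_zero.1 h0)

end Coassoc

theorem eqToHom_comp_eqToHom_comp {C : Type u} [Category.{v} C] {X Y Z W : C} (e : X = Y)
    (e' : Y = Z) (e'' : X = Z) (k : Z ⟶ W) : eqToHom e ≫ eqToHom e' ≫ k = eqToHom e'' ≫ k := by
  subst e e'
  simp

/-! ### Coassociativity: identification of objects and coordinates -/

section Coassoc

variable {C : Type u} [CartRest.{v} C] (S : FaaStr C) (S₂ : FaaStr S.Cat)

namespace FaaStr

/-- Both objects have point and vectors of shape `A^r × A`; the right side repeats the vector monoid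
of `(A, A)^r × (A, X)`. -/
theorem pow_diag (P : FaaObj C) : ∀ r : ℕ,
    (pow (C := S.Cat) P.mon.diag P.mon.diag r : FaaObj C) = (S.powDiag P r).mon.diag
  | 0 => rfl
  | r + 1 => congrArg (FaaObj.prod P.mon.diag) (pow_diag P r)

theorem mapMon_comult (A : TotalCommMon C) :
    (S₂.linearMonoid (S.linearMonoid A).toMon).toMon =
      (S.comult S₂).mapMon (S.linearMonoid A).toMon := by
  let M := (S.comult S₂).mapMon (S.linearMonoid A).toMon
  have ma := isMonHom_eqToHom (congrArg FaaObj.mon (S.comultObj_prod A.diag A.diag).symm)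
  have mz := isMonHom_eqToHom (congrArg FaaObj.mon S.comultObj_unit.symm)
  have ka : IsMonHom (A.diag.prod A.diag).mon A.diag.mon A.add := A.isMonHom_add
  have kz : IsMonHom (FaaObj.unit C).mon A.diag.mon A.zero := A.isMonHom_zero
  have ha := (isLinearOn_eqToHom S₂ (S.comultObj_prod A.diag A.diag).symm).comp S₂ ma
    (isLinearOn_comultHom (LP := S.linearMonoid _) (LQ := S.linearMonoid _)
      (S.linearMonoid A).isLinearOn_add ka) (ka.isMonHom_diag _ _)
  have hz := (isLinearOn_eqToHom S₂ S.comultObj_unit.symm).comp S₂ mz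
    (isLinearOn_comultHom (LP := S.linearMonoid _) (LQ := S.linearMonoid _)
      (S.linearMonoid A).isLinearOn_zero kz) (kz.isMonHom_diag _ _)
  refine (S₂.linearMonoid (S.linearMonoid A).toMon).toMon_eq M.isMon
    (ha.congr (S.id_comp _) ((S.id_comp _).trans ?_))
    (hz.congr (S.id_comp _) ((S.id_comp _).trans ?_))
  · exact ka.diag_eq (S.linearMonoid A).isLinearOn_add
  · exact kz.diag_eq (S.linearMonoid A).isLinearOn_zero

theorem comultObj_comultObj (P : FaaObj C) :
    S₂.comultObj (S.comultObj P) = (S.comult S₂).mapObj (S.comultObj P) :=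
  congrArg (fun M => (⟨M, S.comultObj P⟩ : FaaObj S₂.Cat)) (S.mapMon_comult S₂ P.mon)

/-- All coordinates are linear morphisms, so it suffices to compare base maps and linear parts,
which are projections up to transport. -/
theorem comult_coords (P : FaaObj C) (r : ℕ+) :
    (Coords.comult (S := S) (S.coords P r)).pullback
      ((S.comult S₂).obj_pow P.mon.diag P r).symm = S₂.coords (S.comultObj P) r := by
  have hd : ∀ (k : (S.powDiag P r).mon.carrier ⟶ P.mon.carrier)
      (hk : IsMonHom (S.powDiag P r).mon P.mon k)
      (l : FaaHom (pow (C := S.Cat) P.mon.diag P.mon.diag r) P.mon.diag)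
      (p : FaaObj.pt (C := C) (pow (C := S.Cat) P.mon.diag P.mon.diag r) ⟶ P.mon.carrier)
      (v : (FaaObj.mon (C := C) (pow (C := S.Cat) P.mon.diag P.mon.diag r)).carrier ⟶
        P.mon.carrier)
      (hv : IsMonHom (FaaObj.mon (C := C) (pow (C := S.Cat) P.mon.diag P.mon.diag r)) P.mon v)
      (hl : l.IsLinearOn p v) (hp : eqToHom (congrArg FaaObj.pt (S.pow_diag P r).symm) ≫ p = k)
      (hv' : eqToHom (congrArg (fun P => P.mon.carrier) (S.pow_diag P r).symm) ≫ v = k),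
      hk.diag = S.comp (eqToHom (C := S.Cat) (S.pow_diag P r).symm) l := by
    intro k hk l p v hv hl hp hv'
    refine hk.diag_eq (((isLinearOn_eqToHom S (S.pow_diag P r).symm).comp S
      (isMonHom_eqToHom (congrArg FaaObj.mon (S.pow_diag P r).symm)) hl hv).congr hp hv')
  refine Coords.ext (C := S.Cat) (fun i => ?_) ?_ (fun i => ?_) ?_
  · refine (Coords.pullback_pt (C := S.Cat) _ _ i).trans ?_
    have h : FaaHom.linear (P := S.powDiag P r) (Q := P.mon.diag) ((S.coords P r).pt i)
        ((S.coords P r).isMonHom_vec i) = proj (C := S.Cat) P.mon.diag P r i :=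
      ext_isLinearOn (FaaHom.isLinearOn_linear _ _) (isLinearOn_proj S P.mon.diag P r i)
    refine Eq.trans ?_ (ptProj_eq S₂ (S.comultObj P).mon.diag (S.comultObj P) r i).symm
    exact congrArg (fun k : FaaHom (S.powDiag P r) P.mon.diag => S.comp (eqToHom (C := S.Cat) _) k) h
  · refine (Coords.pullback_base (C := S.Cat) _ _).trans ?_
    have h : FaaHom.linear (P := S.powDiag P r) (Q := P) (S.coords P r).base
        (S.coords P r).isMonHom_fib = last (C := S.Cat) P.mon.diag P r :=
      ext_isLinearOn (FaaHom.isLinearOn_linear _ _) (isLinearOn_last S P.mon.diag P r)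
    refine Eq.trans ?_ (ptLast_eq S₂ (S.comultObj P).mon.diag (S.comultObj P) r).symm
    exact congrArg (fun k : FaaHom (S.powDiag P r) P => S.comp (eqToHom (C := S.Cat) _) k) h
  · refine (Coords.pullback_vec (C := S.Cat) _ _ i).trans ?_
    have h := hd _ ((S.coords P r).isMonHom_vec i)
      (proj (C := S.Cat) P.mon.diag P.mon.diag r i) _ _
      (isMonHom_vecProj S P.mon.diag P.mon.diag r i)
      (isLinearOn_proj S P.mon.diag P.mon.diag r i)
      ((congrArg (fun k => _ ≫ k) (ptProj_eq S P.mon.diag P.mon.diag r i)).trans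
        ((eqToHom_comp_eqToHom_comp _ _ _ _).trans (vecProj_eq S P.mon.diag P r i).symm))
      ((congrArg (fun k => _ ≫ k) (vecProj_eq S P.mon.diag P.mon.diag r i)).trans
        ((eqToHom_comp_eqToHom_comp _ _ _ _).trans (vecProj_eq S P.mon.diag P r i).symm))
    refine Eq.trans ?_ (vecProj_eq S₂ (S.comultObj P).mon.diag (S.comultObj P) r i).symm
    exact (congrArg (fun k : FaaHom (S.powDiag P r).mon.diag P.mon.diag =>
      S.comp (eqToHom (C := S.Cat) _) k) h).trans (eqToHom_comp_eqToHom_comp (C := S.Cat) _ _ _ _)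
  · refine (Coords.pullback_fib (C := S.Cat) _ _).trans ?_
    have h := hd _ (S.coords P r).isMonHom_fib
      (last (C := S.Cat) P.mon.diag P.mon.diag r) _ _
      (isMonHom_vecLast S P.mon.diag P.mon.diag r)
      (isLinearOn_last S P.mon.diag P.mon.diag r)
      ((congrArg (fun k => _ ≫ k) (ptLast_eq S P.mon.diag P.mon.diag r)).trans
        ((eqToHom_comp_eqToHom_comp _ _ _ _).trans (vecLast_eq S P.mon.diag P r).symm))
      ((congrArg (fun k => _ ≫ k) (vecLast_eq S P.mon.diag P.mon.diag r)).trans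
        ((eqToHom_comp_eqToHom_comp _ _ _ _).trans (vecLast_eq S P.mon.diag P r).symm))
    refine Eq.trans ?_ (vecLast_eq S₂ (S.comultObj P).mon.diag (S.comultObj P) r).symm
    exact (congrArg (fun k : FaaHom (S.powDiag P r).mon.diag P.mon.diag =>
      S.comp (eqToHom (C := S.Cat) _) k) h).trans (eqToHom_comp_eqToHom_comp (C := S.Cat) _ _ _ _)

theorem mapPow_comultMap {P Q : FaaObj C} (f : FaaHom P Q) (r : ℕ+) :
    comultAlong (C := S.Cat) (S.comultMap f) (S₂.coords (S.comultObj P) r) =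
      (S.comult S₂).mapPow (A := P.mon.diag) (X := P) (B := Q.mon.diag) (n := r)
        (comultAlong f (S.coords P r)) := by
  have h1 := isComultAlong_comultAlong (C := S.Cat) (S.comultMap f)
    (S₂.coords (S.comultObj P) r)
  have h2 := (isComultAlong_comultMap (S.coords P r)
    (isComultAlong_comultAlong f (S.coords P r))).eqToHom_comp S₂
    ((S.comult S₂).obj_pow P.mon.diag P r).symm
  rw [comult_coords] at h2
  exact h1.ext h2

/-- The comultiplication is coassociative. -/
theorem comult_comp_comult (S₃ : FaaStr S₂.Cat) :
    (S.comult S₂).toFunctor ⋙ (S₂.comult S₃).toFunctor =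
      (S.comult S₂).toFunctor ⋙ ((S.comult S₂).faaMap S₂ S₃).toFunctor := by
  refine Functor.hext (S.comultObj_comultObj S₂) fun P Q f => ?_
  exact FaaHom.hext (C := S₂.Cat) (S.comultObj_comultObj S₂ P) (S.comultObj_comultObj S₂ Q) HEq.rfl
    fun r => heq_of_eq (S.mapPow_comultMap S₂ f r)

end FaaStr

end Coassoc

end FaaRes

/-! ### The comonad -/

/-- The comultiplication of `Faà`, as a natural transformation. -/
noncomputable def FaaRes.faaComult : FaaRes.faaEndofunctor.{v, u}.functor ⟶
    FaaRes.faaEndofunctor.{v, u}.functor ⋙ FaaRes.faaEndofunctor.{v, u}.functor where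
  app X := (FaaRes.faaStr X).comult (FaaRes.faaStr (FaaRes.faaStr X).toCartRestCat)
  naturality _ _ F := FaaRes.StrictFunctor.faaMap_comp_comult F _ _ _ _

/-- The comonad `Faà`. -/
noncomputable def FaaRes.faaComonad : CategoryTheory.Comonad FaaRes.CartRestCat.{v, max u v} where
  toFunctor := FaaRes.faaEndofunctor.{v, u}.functor
  ε := FaaRes.faaCounit
  δ := FaaRes.faaComult
  coassoc X := FaaRes.StrictFunctor.eq_of_toFunctor
    ((FaaRes.faaStr X).comult_comp_comult _ _).symm
  left_counit X := FaaRes.StrictFunctor.eq_of_toFunctor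
    ((FaaRes.faaStr X).comult_comp_counit _)
  right_counit X := FaaRes.StrictFunctor.eq_of_toFunctor
    ((FaaRes.faaStr X).comult_comp_faaMap_counit _)

theorem mainTheorem8 :
    ∃ (T : FaaRes.FaaEndofunctor.{v, u})
      (L : ∀ (X : FaaRes.CartRestCat.{v, max u v}) (A : FaaRes.TotalCommMon X),
        FaaRes.LinearMonoid (T.str X) A)
      (ε : T.functor ⟶ 𝟭 FaaRes.CartRestCat.{v, max u v})
      (δ : T.functor ⟶ T.functor ⋙ T.functor),
      (∀ X, FaaRes.IsCounit (T.str X) (ε.app X)) ∧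
      (∀ X, FaaRes.IsComult (T.str X) (T.str (T.functor.obj X)) (L X) (δ.app X)) ∧
      ∃ G : CategoryTheory.Comonad FaaRes.CartRestCat.{v, max u v},
        G.toFunctor = T.functor ∧ HEq G.ε ε ∧ HEq G.δ δ :=
  ⟨FaaRes.faaEndofunctor, fun X A => (FaaRes.faaStr X).linearMonoid A, FaaRes.faaCounit,
    FaaRes.faaComult, fun _ => rfl, fun X => (FaaRes.faaStr X).isComult_comult _,
    FaaRes.faaComonad, rfl, HEq.rfl, HEq.rfl⟩
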